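/- **Setting.** Let $S^2\subset\mathbb R^3$ be the unit sphere with round metric $\sigma_{AB}$, Levi-Civita connection $\nabla$, Laplacian $\Delta$, volume form $\epsilon_{AB}$ (oriented by the outer normal), and coordinate functions $\tilde X^1,\tilde X^2,\tilde X^3$; indices are moved with $\sigma$ and all integrals over $S^2$ use the area measure. A smooth $\varphi$ is of mode $\ell$ if $\Delta\varphi=-\ell(\ell+1)\varphi$; a function is supported in the modes $\ell\ge 2$ if it is $L^2$-orthogonal to all functions of mode $0$ and $1$. The Bondi–Sachs data of a complete future null infinity $\mathbb R_u\times S^2$ of a vacuum spacetime consist of a smooth function $m$ (mass aspect), a smooth one-form $N_A$ (angular momentum aspect) and a smooth symmetric traceless 2-tensor $C_{AB}$ (shear) on $S^2$, depending smoothly on $u$, which satisfy, with the news $N_{AB}=\partial_uC_{AB}$, $$\partial_u m=-\tfrac18N_{AB}N^{AB}+\tfrac14\nabla^A\nabla^BN_{AB},$$ $$\partial_uN_A=\nabla_Am-\tfrac14\nabla^D(\nabla_D\nabla^EC_{EA}-\nabla_A\nabla^EC_{ED})+\tfrac14\nabla_A(C_{BE}N^{BE})-\tfrac14\nabla_B(C^{BD}N_{DA})+\tfrac12C_{AB}\nabla_DN^{DB}.$$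 The potentials $c,\underline c$ of $C_{AB}$ (at each $u$) are the smooth functions supported in the modes $\ell\ge2$ with $$C_{AB}=\nabla_A\nabla_Bc-\tfrac12\sigma_{AB}\Delta c+\tfrac12(\epsilon_A{}^E\nabla_E\nabla_B\underline c+\epsilon_B{}^E\nabla_E\nabla_A\underline c).$$ The linear momentum and the Chen–Wang–Yau angular momentum are $$P^k(u)=\int_{S^2}2m\tilde X^k,\qquad J^k(u)=\int_{S^2}\epsilon^{AB}\nabla_B\tilde X^k\Big(N_A-\tfrac14C_{AB}\nabla_DC^{DB}-c\nabla_Am\Big),\qquad k=1,2,3$$ (in the second term of $J^k$ the index $B$ of $C_{AB}\nabla_DC^{DB}$ is summed within that term). Let $f=\alpha_0+\alpha_i\tilde X^i+f_{\ell\ge2}$ with $\alpha_0,\alpha_i\in\mathbb R$ and $f_{\ell\ge2}$ smooth and supported in the modes $\ell\ge2$. Under the supertranslation $u=\bar u+f(x)$, the data $\bar m,\bar N_A,\bar C_{AB}$ in the coordinates $(\bar u,x)$ satisfy the same evolution equations and $$\bar C_{AB}(\bar u,x)=C_{AB}(\bar u+f,x)-2\nabla_A\nabla_Bf+\Delta f\,\sigma_{AB},$$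 $$\bar m(\bar u,x)=\big(m+\tfrac12\nabla^BN_{BD}\nabla^Df+\tfrac14\partial_uN_{BD}\nabla^Bf\nabla^Df+\tfrac14N_{BD}\nabla^B\nabla^Df\big)(\bar u+f,x).$$ ($\bar N_A$ is thereby fixed up to a $\bar u$-independent one-form, which does not affect the flux; the statement holds for every such $\bar N_A$.) Let $J_f^k(\bar u)$ be the Chen–Wang–Yau angular momentum of the barred data. **Theorem.** Suppose that for some $\varepsilon>0$ $$N_{AB}(u,x)=O(|u|^{-1-\varepsilon})\quad\text{as }u\to\pm\infty,$$ uniformly on $S^2$ and together with the first angular derivative $\nabla_DN_{AB}$. Then the limits $J^k(\pm)$, $J_f^k(\pm)$ and $P^k(\pm)$ of $J^k$, $J^k_f$, $P^k$ as the retarded time tends to $\pm\infty$ exist, and the total flux of $J^k$ is supertranslation invariant in the following sense: for $k=1,2,3$, $$\big(J_f^k(+)-J_f^k(-)\big)-\big(J^k(+)-J^k(-)\big)=\sum_{i,j}\alpha_i\,\varepsilon_{ikj}\,\big(P^j(+)-P^j(-)\big),$$ where $\varepsilon_{ikj}$ is the Levi-Civita symbol. -/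

import Mathlib

open MeasureTheory Filter Topology Asymptotics
open scoped Manifold ContDiff

noncomputable section

/-! ### Tensor calculus on the round unit sphere

The sphere `S2` sits in Euclidean `ℝ³`. A (covariant) tensor field on `S2` is given by its
components in the standard frame of `ℝ³`, annihilated by the normal `x` in every slot; indices are
then raised, lowered and contracted by plain sums over `Fin 3`, because the round metric is the
restriction of the Euclidean one. The Levi-Civita derivative is the tangential projection of the
Euclidean derivative. -/

/-- Euclidean three-space. -/
abbrev E3 : Type := EuclideanSpace ℝ (Fin 3)

/-- The unit sphere in Euclidean three-space. -/
abbrev S2 : Type := Metric.sphere (0 : E3) 1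

/-- The coordinate function `X̃ᵏ` restricted to the sphere. -/
def coordX (k : Fin 3) (x : S2) : ℝ := (x : E3) k

/-- Smooth functions on the sphere. -/
def SmoothS2 (F : S2 → ℝ) : Prop := ContMDiff (𝓡 2) 𝓘(ℝ, ℝ) ∞ F

/-- Smooth functions on `ℝ × S²`. -/
def SmoothScri (F : ℝ → S2 → ℝ) : Prop :=
  ContMDiff ((𝓘(ℝ, ℝ)).prod (𝓡 2)) 𝓘(ℝ, ℝ) ∞ (fun p : ℝ × S2 => F p.1 p.2)

/-- Integral over the sphere with respect to the surface measure of the round metric. -/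
def integralS2 (F : S2 → ℝ) : ℝ := ∫ x, F x ∂((volume : Measure E3).toSphere)

/-- The Levi-Civita symbol with values in `ℝ`, normalised by `ε₀₁₂ = 1`. -/
def leviCivita (i j k : Fin 3) : ℝ :=
  (((j : ℕ) : ℝ) - ((i : ℕ) : ℝ)) * (((k : ℕ) : ℝ) - ((i : ℕ) : ℝ)) *
    (((k : ℕ) : ℝ) - ((j : ℕ) : ℝ)) / 2

/-- The round metric `σ`, that is, the orthogonal projection onto the tangent plane at `x`. -/
def sigma (x : S2) (a b : Fin 3) : ℝ := (if a = b then 1 else 0) - (x : E3) a * (x : E3) b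

/-- The volume form of the round metric (for the orientation by the outer normal). -/
def epsS2 (x : S2) (a b : Fin 3) : ℝ := ∑ c, leviCivita a b c * (x : E3) c

/-- The extension of a function on the sphere to `ℝ³ ∖ {0}` that is constant along rays. -/
def radialExt (F : S2 → ℝ) (y : E3) : ℝ :=
  if h : y = 0 then 0 else
    F ⟨‖y‖⁻¹ • y, by
      rw [mem_sphere_zero_iff_norm, norm_smul, norm_inv, norm_norm,
        inv_mul_cancel₀ (norm_ne_zero_iff.mpr h)]⟩

/-- `∇ₐ F` for a function `F`. The radial extension has no normal derivative, so this is the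
tangential gradient. -/
def grad0 (F : S2 → ℝ) (x : S2) (a : Fin 3) : ℝ :=
  fderiv ℝ (radialExt F) (x : E3) (EuclideanSpace.single a 1)

/-- `∇ₐ w_b` for a one-form `w`. -/
def grad1 (w : S2 → Fin 3 → ℝ) (x : S2) (a b : Fin 3) : ℝ :=
  ∑ d, sigma x b d * grad0 (fun y => w y d) x a

/-- `∇ₐ T_{bc}` for a two-tensor `T`. -/
def grad2 (T : S2 → Fin 3 → Fin 3 → ℝ) (x : S2) (a b c : Fin 3) : ℝ :=
  ∑ d, ∑ e, sigma x b d * sigma x c e * grad0 (fun y => T y d e) x a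

/-- The Hessian `∇ₐ∇_b F`. -/
def hess (F : S2 → ℝ) : S2 → Fin 3 → Fin 3 → ℝ := grad1 (grad0 F)

/-- The divergence `∇ᴬ w_A` of a one-form. -/
def div1 (w : S2 → Fin 3 → ℝ) (x : S2) : ℝ := ∑ a, grad1 w x a a

/-- The divergence `∇ᴬ T_{AB}` of a two-tensor. -/
def div2 (T : S2 → Fin 3 → Fin 3 → ℝ) (x : S2) (b : Fin 3) : ℝ := ∑ a, grad2 T x a a b

/-- The Laplacian of a function. -/
def lap (F : S2 → ℝ) (x : S2) : ℝ := ∑ a, hess F x a a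

/-! ### Modes and potentials -/

/-- `φ` is of mode `ℓ`. -/
def IsMode (ℓ : ℕ) (φ : S2 → ℝ) : Prop :=
  SmoothS2 φ ∧ ∀ x, lap φ x = -((ℓ : ℝ) * ((ℓ : ℝ) + 1)) * φ x

/-- `F` is supported in the modes `ℓ ≥ 2`: it is orthogonal to all functions of mode `0` or `1`. -/
def SupportedGE2 (F : S2 → ℝ) : Prop :=
  ∀ ℓ < 2, ∀ φ, IsMode ℓ φ → integralS2 (fun x => F x * φ x) = 0

/-- `c` and `cu` are the closed and the co-closed potential of the two-tensor `C`, normalised to be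
supported in the modes `ℓ ≥ 2`. -/
structure IsPotentialPair (C : S2 → Fin 3 → Fin 3 → ℝ) (c cu : S2 → ℝ) : Prop where
  smooth_c : SmoothS2 c
  smooth_cu : SmoothS2 cu
  supported_c : SupportedGE2 c
  supported_cu : SupportedGE2 cu
  eq : ∀ x a b, C x a b =
    hess c x a b - 1 / 2 * sigma x a b * lap c x
      + 1 / 2 * (∑ e, epsS2 x a e * hess cu x e b + ∑ e, epsS2 x b e * hess cu x e a)

/-! ### Data on future null infinity -/

/-- The news tensor `N_{AB} = ∂_u C_{AB}` of a shear tensor. -/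
def news (C : ℝ → S2 → Fin 3 → Fin 3 → ℝ) (u : ℝ) (x : S2) (a b : Fin 3) : ℝ :=
  deriv (fun s => C s x a b) u

/-- The Bondi-Sachs data of a complete future null infinity `ℝ × S²` of a vacuum spacetime: mass
aspect, angular momentum aspect and shear, all smooth, with the evolution equations that the vacuum
Einstein equations impose on them. -/
structure NullInfinityData where
  /-- mass aspect `m` -/
  m : ℝ → S2 → ℝ
  /-- angular momentum aspect `N_A` -/
  NA : ℝ → S2 → Fin 3 → ℝ
  /-- shear tensor `C_{AB}` -/
  C : ℝ → S2 → Fin 3 → Fin 3 → ℝ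
  smooth_m : SmoothScri m
  smooth_NA : ∀ a, SmoothScri (fun u x => NA u x a)
  smooth_C : ∀ a b, SmoothScri (fun u x => C u x a b)
  tangent_NA : ∀ (u : ℝ) (x : S2), ∑ a, (x : E3) a * NA u x a = 0
  tangent_C : ∀ (u : ℝ) (x : S2) (b : Fin 3), ∑ a, (x : E3) a * C u x a b = 0
  symm_C : ∀ u x a b, C u x a b = C u x b a
  traceless_C : ∀ u x, ∑ a, C u x a a = 0
  /-- `∂_u m = -(1/8) N_{AB} N^{AB} + (1/4) ∇^A ∇^B N_{AB}` -/
  evol_m : ∀ u x, deriv (fun s => m s x) u =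
    -(1 / 8) * ∑ a, ∑ b, news C u x a b ^ 2 + 1 / 4 * div1 (div2 (news C u)) x
  /-- `∂_u N_A = ∇_A m - (1/4) ∇^D (∇_D ∇^E C_{EA} - ∇_A ∇^E C_{ED}) + (1/4) ∇_A (C_{BE} N^{BE})
  - (1/4) ∇_B (C^{BD} N_{DA}) + (1/2) C_{AB} ∇_D N^{DB}` -/
  evol_NA : ∀ u x a, deriv (fun s => NA s x a) u =
    grad0 (m u) x a
      - 1 / 4 * div2 (fun y d b => grad1 (div2 (C u)) y d b - grad1 (div2 (C u)) y b d) x a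
      + 1 / 4 * grad0 (fun y => ∑ b, ∑ e, C u y b e * news C u y b e) x a
      - 1 / 4 * div2 (fun y b e => ∑ d, C u y b d * news C u y d e) x a
      + 1 / 2 * ∑ b, C u x a b * div2 (news C u) x b

/-- The news decays like `|u|^{-1-ε}` as `u → ±∞`, uniformly on the sphere and together with its
first angular derivative, for some `ε > 0`. -/
def NewsDecay (D : NullInfinityData) : Prop :=
  ∃ ε : ℝ, 0 < ε ∧
    (∀ a b, (fun p : ℝ × S2 => news D.C p.1 p.2 a b)
      =O[(atBot ⊔ atTop) ×ˢ ⊤] (fun p : ℝ × S2 => |p.1| ^ (-1 - ε))) ∧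
    (∀ d a b, (fun p : ℝ × S2 => grad2 (news D.C p.1) p.2 d a b)
      =O[(atBot ⊔ atTop) ×ˢ ⊤] (fun p : ℝ × S2 => |p.1| ^ (-1 - ε)))

/-- `D'` is the data, in the coordinates `(ū, x)`, of the null infinity with data `D` in the
coordinates `(u, x)`, where `u = ū + f(x)`. The aspect `N_A` of `D'` is constrained only by its
evolution equation, which determines it up to a `ū`-independent one-form. -/
structure IsSupertranslation (f : S2 → ℝ) (D D' : NullInfinityData) : Prop where
  /-- `C̄_{AB}(ū, x) = C_{AB}(ū + f, x) - 2 ∇_A ∇_B f + Δf σ_{AB}` -/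
  shear : ∀ u x a b, D'.C u x a b =
    D.C (u + f x) x a b - 2 * hess f x a b + lap f x * sigma x a b
  /-- `m̄(ū, x) = (m + (1/2) ∇^B N_{BD} ∇^D f + (1/4) ∂_u N_{BD} ∇^B f ∇^D f
  + (1/4) N_{BD} ∇^B ∇^D f)(ū + f, x)` -/
  mass : ∀ u x, D'.m u x =
    D.m (u + f x) x
      + 1 / 2 * ∑ d, div2 (news D.C (u + f x)) x d * grad0 f x d
      + 1 / 4 * ∑ b, ∑ d,
          deriv (fun s => news D.C s x b d) (u + f x) * grad0 f x b * grad0 f x d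
      + 1 / 4 * ∑ b, ∑ d, news D.C (u + f x) x b d * hess f x b d

/-- The linear momentum `Pᵏ = ∫ 2 m X̃ᵏ` at retarded time `u`. -/
def linearMomentum (D : NullInfinityData) (k : Fin 3) (u : ℝ) : ℝ :=
  integralS2 (fun x => 2 * D.m u x * coordX k x)

/-- The Chen–Wang–Yau angular momentum
`Jᵏ = ∫ ε^{AB} ∇_B X̃ᵏ (N_A - (1/4) C_{AD} ∇_E C^{ED} - c ∇_A m)` at retarded time `u`, where `c` is
the closed potential of the shear. -/
def cwyAngularMomentum (D : NullInfinityData) (c : ℝ → S2 → ℝ) (k : Fin 3) (u : ℝ) : ℝ :=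
  integralS2 (fun x => ∑ a, (∑ b, epsS2 x a b * grad0 (coordX k) x b) *
    (D.NA u x a - 1 / 4 * ∑ d, D.C u x a d * div2 (D.C u) x d - c u x * grad0 (D.m u) x a))

end

/-! ### Why the total flux is supertranslation invariant

Let `Y` be the rotation field `ε^{AB} ∇_B X̃ᵏ` and split the mass aspect as `m = q + ¼ ∇ᴬ∇ᴮ C_{AB}`.
By the evolution equation the nonlinear part `q` has flux `-⅛ |N|²`, while the linear part is
`⅛ Δ(Δ + 2) c`, a self-adjoint operator of `c` that commutes with rotations and hence drops out of
the term `c Y(m)` of the angular momentum. The total flux of `Jᵏ` is therefore the flux of a *local*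
expression in the data, plus the boundary values of `∫ q Y(c)`.

Under `u ↦ u + f` the flux density of the local expression at `(ū, x)` becomes its value at
`(ū + f, x)` plus a total `u`-derivative, and shifting `u` does not affect integrals over the whole
line. What remains are boundary terms at `u = ±∞`, where the news vanishes and the shear converges:
they contain `q Y(f)` and `C · 𝓛_Y(2 ∇∇f - Δf σ)`. Since `c̄ - c → -2 f_{ℓ ≥ 2}`, the boundary
values of `∫ q Y(c)` cancel the part of `q Y(f)` with modes `ℓ ≥ 2`, and the terms quadratic in
`f_{ℓ ≥ 2}` vanish by antisymmetry of the rotation. This leaves `∫ 2 q Y(α_i X̃^i)`, a combination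
of components of the linear momentum, because `Y_k(X̃^i) = ε_{ikj} X̃^j`. -/

noncomputable section

/-! ### Radial extensions of smooth functions -/

instance fact_finrank_E3 : Fact (Module.finrank ℝ E3 = 2 + 1) := ⟨finrank_euclideanSpace_fin⟩

lemma S2.norm_coe (x : S2) : ‖(x : E3)‖ = 1 := norm_eq_of_mem_sphere x

lemma S2.coe_ne_zero (x : S2) : (x : E3) ≠ 0 := ne_zero_of_mem_unit_sphere x

/-- The radial projection `y ↦ y / ‖y‖` of `ℝ³` to the sphere, with an arbitrary value at `0`. -/
def radialProj (y : E3) : S2 :=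
  if h : y = 0 then ⟨EuclideanSpace.single 0 1, by simp⟩ else ⟨‖y‖⁻¹ • y, by
    rw [mem_sphere_zero_iff_norm, norm_smul, norm_inv, norm_norm,
      inv_mul_cancel₀ (norm_ne_zero_iff.mpr h)]⟩

lemma coe_radialProj {y : E3} (hy : y ≠ 0) : (radialProj y : E3) = ‖y‖⁻¹ • y := by
  rw [radialProj, dif_neg hy]

@[simp] lemma radialProj_coe (x : S2) : radialProj (x : E3) = x :=
  Subtype.ext (by rw [coe_radialProj (S2.coe_ne_zero x), S2.norm_coe, inv_one, one_smul])

lemma radialProj_smul {r : ℝ} (hr : 0 < r) {y : E3} (hy : y ≠ 0) :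
    radialProj (r • y) = radialProj y := by
  ext1
  rw [coe_radialProj hy, coe_radialProj (smul_ne_zero hr.ne' hy), norm_smul, Real.norm_eq_abs,
    abs_of_pos hr, mul_inv, smul_smul, mul_right_comm, inv_mul_cancel₀ hr.ne', one_mul]

lemma contMDiffAt_radialProj {y : E3} (hy : y ≠ 0) :
    ContMDiffAt 𝓘(ℝ, E3) (𝓡 2) ∞ radialProj y := by
  let U : TopologicalSpace.Opens E3 := ⟨{y | y ≠ 0}, isOpen_ne⟩
  have normalize : ContMDiff 𝓘(ℝ, E3) 𝓘(ℝ, E3) ∞ (fun z : U => ‖(z : E3)‖⁻¹ • (z : E3)) :=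
    fun z => (contMDiffAt_subtype_iff (U := U) (f := fun z : E3 => ‖z‖⁻¹ • z)).2
      (((contDiffAt_id.norm ℝ z.2).inv (norm_ne_zero_iff.2 z.2)).smul contDiffAt_id).contMDiffAt
  have restricted : ContMDiff 𝓘(ℝ, E3) (𝓡 2) ∞ (fun z : U => radialProj z) :=
    (ContMDiff.codRestrict_sphere (n := 2) normalize
      fun z => coe_radialProj z.2 ▸ (radialProj z).2).congr
      fun z => Subtype.ext (coe_radialProj z.2)
  exact (contMDiffAt_subtype_iff (U := U)).1 (restricted ⟨y, hy⟩)

lemma radialExt_of_ne (F : S2 → ℝ) {y : E3} (hy : y ≠ 0) :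
    radialExt F y = F (radialProj y) := by
  rw [radialExt, dif_neg hy]
  exact congrArg F (Subtype.ext (coe_radialProj hy).symm)

@[simp] lemma radialExt_coe (F : S2 → ℝ) (x : S2) : radialExt F (x : E3) = F x := by
  rw [radialExt_of_ne F (S2.coe_ne_zero x), radialProj_coe]

lemma radialExt_smul (F : S2 → ℝ) {r : ℝ} (hr : 0 < r) {y : E3} (hy : y ≠ 0) :
    radialExt F (r • y) = radialExt F y := by
  rw [radialExt_of_ne F hy, radialExt_of_ne F (smul_ne_zero hr.ne' hy), radialProj_smul hr hy]

/-- The radial extension of every member of a family of functions on the sphere, as one function on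
`ℝ × ℝ³`. -/
def scriExt (F : ℝ → S2 → ℝ) (p : ℝ × E3) : ℝ := radialExt (F p.1) p.2

@[simp] lemma scriExt_coe (F : ℝ → S2 → ℝ) (u : ℝ) (x : S2) : scriExt F (u, (x : E3)) = F u x :=
  radialExt_coe (F u) x

lemma SmoothScri.contDiffAt {F : ℝ → S2 → ℝ} (hF : SmoothScri F) {p : ℝ × E3} (hp : p.2 ≠ 0) :
    ContDiffAt ℝ ∞ (scriExt F) p := by
  have hproj : ContMDiffAt 𝓘(ℝ, ℝ × E3) ((𝓘(ℝ, ℝ)).prod (𝓡 2)) ∞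
      (fun q : ℝ × E3 => (q.1, radialProj q.2)) p :=
    contDiffAt_fst.contMDiffAt.prodMk
      (ContMDiffAt.comp p (contMDiffAt_radialProj hp) contDiffAt_snd.contMDiffAt)
  have hcomp := (ContMDiffAt.comp p (hF (p.1, radialProj p.2)) hproj).contDiffAt
  refine hcomp.congr_of_eventuallyEq ?_
  filter_upwards [(isOpen_ne.preimage continuous_snd).mem_nhds hp] with q hq
  exact radialExt_of_ne _ hq

lemma SmoothScri.of_contDiffAt {G : ℝ × E3 → ℝ}
    (hG : ∀ (u : ℝ) (x : S2), ContDiffAt ℝ ∞ G (u, x)) :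
    SmoothScri (fun u x => G (u, (x : E3))) := fun p =>
  ContMDiffAt.comp p (hG p.1 p.2).contMDiffAt
    ((contMDiff_fst.prodMk_space ((contMDiff_coe_sphere (n := 2)).comp contMDiff_snd)) p)

lemma smoothS2_coordX (k : Fin 3) : SmoothS2 (coordX k) :=
  (EuclideanSpace.proj (𝕜 := ℝ) k).contDiff.contMDiff.comp (contMDiff_coe_sphere (n := 2))

section SmoothFunctions

variable {F : ℝ → S2 → ℝ} {f : S2 → ℝ}

lemma SmoothS2.smoothScri_const (hf : SmoothS2 f) : SmoothScri (fun _ => f) :=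
  ContMDiff.comp hf contMDiff_snd

lemma SmoothScri.smoothS2 (hF : SmoothScri F) (u : ℝ) : SmoothS2 (F u) :=
  ContMDiff.comp (g := fun p : ℝ × S2 => F p.1 p.2) hF (contMDiff_const.prodMk contMDiff_id)

lemma SmoothScri.comp_add (hF : SmoothScri F) (hf : SmoothS2 f) :
    SmoothScri (fun u x => F (u + f x) x) :=
  ContMDiff.comp hF ((contMDiff_fst.add (ContMDiff.comp hf contMDiff_snd)).prodMk contMDiff_snd)

lemma SmoothScri.hasFDerivAt (hF : SmoothScri F) {p : ℝ × E3} (hp : p.2 ≠ 0) :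
    HasFDerivAt (scriExt F) (fderiv ℝ (scriExt F) p) p :=
  ((hF.contDiffAt hp).differentiableAt (by simp)).hasFDerivAt

lemma SmoothS2.contDiffAt (hf : SmoothS2 f) {y : E3} (hy : y ≠ 0) :
    ContDiffAt ℝ ∞ (radialExt f) y :=
  (hf.smoothScri_const.contDiffAt (p := (0, y)) hy).comp y (contDiffAt_const.prodMk contDiffAt_id)

lemma SmoothS2.hasFDerivAt (hf : SmoothS2 f) {y : E3} (hy : y ≠ 0) :
    HasFDerivAt (radialExt f) (fderiv ℝ (radialExt f) y) y :=
  ((hf.contDiffAt hy).differentiableAt (by simp)).hasFDerivAt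

end SmoothFunctions

/-! ### Derivatives of functions on `ℝ × S²` -/

/-- The derivative `∂_u F` along the generators of null infinity. -/
def timeDeriv (F : ℝ → S2 → ℝ) (u : ℝ) (x : S2) : ℝ := deriv (fun s => F s x) u

section Derivatives

variable {F : ℝ → S2 → ℝ} (hF : SmoothScri F)
include hF

lemma SmoothScri.hasDerivAt_scriExt {p : ℝ × E3} (hp : p.2 ≠ 0) :
    HasDerivAt (fun s => scriExt F (s, p.2)) (fderiv ℝ (scriExt F) p (1, 0)) p.1 := by
  have hline : HasDerivAt (fun s : ℝ => (s, p.2)) (1, 0) p.1 :=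
    (hasDerivAt_id p.1).prodMk (hasDerivAt_const p.1 p.2)
  exact (hF.hasFDerivAt hp).comp_hasDerivAt p.1 hline

lemma SmoothScri.timeDeriv_eq (u : ℝ) (x : S2) :
    timeDeriv F u x = fderiv ℝ (scriExt F) (u, (x : E3)) (1, 0) := by
  simpa [timeDeriv] using (hF.hasDerivAt_scriExt (p := (u, x)) (S2.coe_ne_zero x)).deriv

lemma SmoothScri.hasDerivAt (u : ℝ) (x : S2) :
    HasDerivAt (fun s => F s x) (timeDeriv F u x) u := by
  simpa [hF.timeDeriv_eq] using hF.hasDerivAt_scriExt (p := (u, x)) (S2.coe_ne_zero x)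

lemma SmoothScri.fderiv_radialExt (u : ℝ) {y : E3} (hy : y ≠ 0) (v : E3) :
    fderiv ℝ (radialExt (F u)) y v = fderiv ℝ (scriExt F) (u, y) (0, v) := by
  have h : HasFDerivAt (radialExt (F u)) _ y :=
    HasFDerivAt.comp y (hF.hasFDerivAt (p := (u, y)) hy) (hasFDerivAt_prodMk_right u y)
  simp [h.fderiv]

lemma SmoothScri.grad0_eq (u : ℝ) (x : S2) (a : Fin 3) :
    grad0 (F u) x a = fderiv ℝ (scriExt F) (u, (x : E3)) (0, EuclideanSpace.single a 1) :=
  hF.fderiv_radialExt u (S2.coe_ne_zero x) _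

lemma SmoothScri.contDiffAt_fderiv_apply {p : ℝ × E3} (hp : p.2 ≠ 0) (v : ℝ × E3) :
    ContDiffAt ℝ ∞ (fun q => fderiv ℝ (scriExt F) q v) p :=
  ((hF.contDiffAt hp).fderiv_right (by simp)).clm_apply contDiffAt_const

lemma SmoothScri.smoothScri_timeDeriv : SmoothScri (timeDeriv F) :=
  (funext₂ hF.timeDeriv_eq) ▸
    SmoothScri.of_contDiffAt fun _ x => hF.contDiffAt_fderiv_apply (S2.coe_ne_zero x) (1, 0)

lemma SmoothScri.smoothScri_grad0 (a : Fin 3) : SmoothScri (fun u x => grad0 (F u) x a) := by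
  simp only [hF.grad0_eq]
  exact SmoothScri.of_contDiffAt fun _ x => hF.contDiffAt_fderiv_apply (S2.coe_ne_zero x) _

end Derivatives

lemma SmoothS2.smoothS2_grad0 {F : S2 → ℝ} (hF : SmoothS2 F) (a : Fin 3) :
    SmoothS2 (fun x => grad0 F x a) := (hF.smoothScri_const.smoothScri_grad0 a).smoothS2 0

lemma fderiv_fderiv_apply_comm {E : Type*} [NormedAddCommGroup E] [NormedSpace ℝ E] {G : E → ℝ}
    {p : E} (hG : ContDiffAt ℝ 2 G p) (v w : E) :
    fderiv ℝ (fun q => fderiv ℝ G q v) p w = fderiv ℝ (fun q => fderiv ℝ G q w) p v := by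
  have hdiff : DifferentiableAt ℝ (fderiv ℝ G) p :=
    (hG.fderiv_right (m := 1) (by norm_num)).differentiableAt one_ne_zero
  have happly (v w : E) : fderiv ℝ (fun q => fderiv ℝ G q v) p w = fderiv ℝ (fderiv ℝ G) p w v := by
    simp [fderiv_clm_apply hdiff (differentiableAt_const v)]
  rw [happly, happly]
  exact (hG.isSymmSndFDerivAt (by simp)).eq w v

lemma SmoothScri.timeDeriv_grad0 {F : ℝ → S2 → ℝ} (hF : SmoothScri F) (u : ℝ) (x : S2)
    (a : Fin 3) : timeDeriv (fun s y => grad0 (F s) y a) u x = grad0 (timeDeriv F u) x a := by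
  have hx := S2.coe_ne_zero x
  have hext : scriExt (timeDeriv F) =ᶠ[𝓝 (u, (x : E3))]
      fun q => fderiv ℝ (scriExt F) q (1, 0) := by
    filter_upwards [(isOpen_ne.preimage continuous_snd).mem_nhds hx] with q hq
    rw [← (hF.hasDerivAt_scriExt hq).deriv]
    simp only [scriExt, radialExt_of_ne _ hq, timeDeriv]
  have hline : HasDerivAt (fun s : ℝ => (s, (x : E3))) (1, 0) u :=
    (hasDerivAt_id u).prodMk (hasDerivAt_const u _)
  have hdiff := ((hF.contDiffAt_fderiv_apply (p := (u, x)) hx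
    (0, EuclideanSpace.single a 1)).differentiableAt (by simp)).hasFDerivAt
  rw [hF.smoothScri_timeDeriv.grad0_eq, hext.fderiv_eq,
    fderiv_fderiv_apply_comm ((hF.contDiffAt hx).of_le (by norm_cast)), timeDeriv]
  simp only [hF.grad0_eq]
  exact (hdiff.comp_hasDerivAt u hline).deriv

lemma SmoothScri.grad0_comp_add {F : ℝ → S2 → ℝ} (hF : SmoothScri F) {f : S2 → ℝ}
    (hf : SmoothS2 f) (u : ℝ) (x : S2) (a : Fin 3) :
    grad0 (fun y => F (u + f y) y) x a =
      grad0 (F (u + f x)) x a + timeDeriv F (u + f x) x * grad0 f x a := by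
  have hx := S2.coe_ne_zero x
  have hext : radialExt (fun y => F (u + f y) y) =ᶠ[𝓝 (x : E3)]
      fun y => scriExt F (u + radialExt f y, y) := by
    filter_upwards [isOpen_ne.mem_nhds hx] with y hy
    simp only [scriExt, radialExt_of_ne _ hy]
  have hgraph : HasFDerivAt (fun y : E3 => ((u + radialExt f y, y) : ℝ × E3))
      ((fderiv ℝ (radialExt f) x).prod (ContinuousLinearMap.id ℝ E3)) x :=
    ((hf.hasFDerivAt hx).const_add u).prodMk (hasFDerivAt_id _)
  have hchain := HasFDerivAt.comp (g := scriExt F)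
    (f := fun y : E3 => ((u + radialExt f y, y) : ℝ × E3)) (x : E3)
    (hF.hasFDerivAt (p := (u + radialExt f x, x)) hx) hgraph
  rw [grad0, hext.fderiv_eq, show fderiv ℝ (fun y => scriExt F (u + radialExt f y, y)) x = _
    from hchain.fderiv, hF.grad0_eq, hF.timeDeriv_eq, radialExt_coe,
    mul_comm, ← smul_eq_mul, grad0, ← map_smul, ← map_add]
  simp

/-! ### The tangential gradient -/

lemma grad0_const (r : ℝ) (x : S2) (a : Fin 3) : grad0 (fun _ => r) x a = 0 := by
  have hext : radialExt (fun _ => r) =ᶠ[𝓝 (x : E3)] fun _ => r := by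
    filter_upwards [isOpen_ne.mem_nhds (S2.coe_ne_zero x)] with y hy
    rw [radialExt_of_ne _ hy]
  rw [grad0, hext.fderiv_eq]
  simp

section Leibniz

variable {F G : S2 → ℝ} (hF : SmoothS2 F) (hG : SmoothS2 G)
include hF hG

lemma grad0_add (x : S2) (a : Fin 3) :
    grad0 (fun y => F y + G y) x a = grad0 F x a + grad0 G x a := by
  have hx := S2.coe_ne_zero x
  have hext : radialExt (fun y => F y + G y) =ᶠ[𝓝 (x : E3)] radialExt F + radialExt G := by
    filter_upwards [isOpen_ne.mem_nhds hx] with y hy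
    simp [radialExt_of_ne _ hy]
  rw [grad0, hext.fderiv_eq, ((hF.hasFDerivAt hx).add (hG.hasFDerivAt hx)).fderiv]
  rfl

lemma grad0_mul (x : S2) (a : Fin 3) :
    grad0 (fun y => F y * G y) x a = F x * grad0 G x a + G x * grad0 F x a := by
  have hx := S2.coe_ne_zero x
  have hext : radialExt (fun y => F y * G y) =ᶠ[𝓝 (x : E3)] radialExt F * radialExt G := by
    filter_upwards [isOpen_ne.mem_nhds hx] with y hy
    simp [radialExt_of_ne _ hy]
  rw [grad0, hext.fderiv_eq, ((hF.hasFDerivAt hx).mul (hG.hasFDerivAt hx)).fderiv]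
  simp [grad0]

end Leibniz

lemma sum_coordX_sq (x : S2) : ∑ a, coordX a x * coordX a x = 1 := by
  have h := S2.norm_coe x
  rw [EuclideanSpace.norm_eq, Real.sqrt_eq_one] at h
  simpa [coordX, sq] using h

lemma fderiv_radialExt_apply_eq_sum (F : S2 → ℝ) (x : S2) (v : E3) :
    fderiv ℝ (radialExt F) (x : E3) v = ∑ a, v a * grad0 F x a := by
  conv_lhs => rw [← (EuclideanSpace.basisFun (Fin 3) ℝ).sum_repr v]
  simp [grad0]

lemma hasFDerivAt_norm {E : Type*} [NormedAddCommGroup E] [InnerProductSpace ℝ E] {y : E}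
    (hy : y ≠ 0) : HasFDerivAt (fun z : E => ‖z‖) (‖y‖⁻¹ • innerSL ℝ y) y := by
  have hsqrt := (hasStrictFDerivAt_norm_sq y).hasFDerivAt.sqrt (by simpa using hy)
  simp only [Real.sqrt_sq (norm_nonneg _)] at hsqrt
  refine hsqrt.congr_fderiv (ContinuousLinearMap.ext fun v => ?_)
  simp [two_smul]
  ring

lemma fderiv_radialExt_smul {F : S2 → ℝ} (hF : SmoothS2 F) {r : ℝ} (hr : 0 < r) {y : E3}
    (hy : y ≠ 0) : fderiv ℝ (radialExt F) (r • y) = r⁻¹ • fderiv ℝ (radialExt F) y := by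
  have hscale : (fun z => radialExt F (r • z)) =ᶠ[𝓝 y] radialExt F := by
    filter_upwards [isOpen_ne.mem_nhds hy] with z hz using radialExt_smul F hr hz
  have hchain : HasFDerivAt (fun z => radialExt F (r • z)) _ y :=
    (hF.hasFDerivAt (smul_ne_zero hr.ne' hy)).comp y ((hasFDerivAt_id y).const_smul r)
  rw [← hscale.fderiv_eq, hchain.fderiv]
  ext v
  simp [hr.ne']

lemma sum_coordX_mul_grad0 {F : S2 → ℝ} (hF : SmoothS2 F) (x : S2) :
    ∑ a, coordX a x * grad0 F x a = 0 := by
  have hx := S2.coe_ne_zero x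
  have hray : HasDerivAt (fun t : ℝ => t • (x : E3)) ((1 : ℝ) • (x : E3)) 1 :=
    (hasDerivAt_id (1 : ℝ)).smul_const _
  have hchain := HasFDerivAt.comp_hasDerivAt (l := radialExt F) (1 : ℝ)
    (by simpa using hF.hasFDerivAt hx) hray
  have hconst : (radialExt F ∘ fun t : ℝ => t • (x : E3)) =ᶠ[𝓝 1] fun _ => F x := by
    filter_upwards [lt_mem_nhds (zero_lt_one' ℝ)] with t ht
    simp [radialExt_smul F ht hx]
  have hzero := hchain.unique ((hasDerivAt_const (1 : ℝ) (F x)).congr_of_eventuallyEq hconst)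
  simpa [fderiv_radialExt_apply_eq_sum, coordX] using hzero

lemma grad0_coordX (x : S2) (a b : Fin 3) :
    grad0 (coordX b) x a = (if a = b then 1 else 0) - coordX a x * coordX b x := by
  have hx := S2.coe_ne_zero x
  have hext : radialExt (coordX b) =ᶠ[𝓝 (x : E3)] fun y => ‖y‖⁻¹ * y b := by
    filter_upwards [isOpen_ne.mem_nhds hx] with y hy
    simp [radialExt_of_ne _ hy, coordX, coe_radialProj hy]
  have hcoord : HasFDerivAt (fun y : E3 => y b) (EuclideanSpace.proj (𝕜 := ℝ) b) (x : E3) :=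
    (EuclideanSpace.proj (𝕜 := ℝ) b).hasFDerivAt
  have hinv := (hasDerivAt_inv (norm_ne_zero_iff.2 hx)).comp_hasFDerivAt _ (hasFDerivAt_norm hx)
  have hprod : HasFDerivAt (fun y : E3 => ‖y‖⁻¹ * y b) _ (x : E3) := hinv.mul hcoord
  rw [grad0, hext.fderiv_eq, hprod.fderiv]
  simp [coordX, EuclideanSpace.inner_single_right, eq_comm]
  ring

lemma grad0_grad0_eq_fderiv_fderiv {F : S2 → ℝ} (hF : SmoothS2 F) (x : S2) (a b : Fin 3) :
    grad0 (fun y => grad0 F y b) x a = coordX a x * grad0 F x b +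
      fderiv ℝ (fun y => fderiv ℝ (radialExt F) y (EuclideanSpace.single b 1)) (x : E3)
        (EuclideanSpace.single a 1) := by
  have hx := S2.coe_ne_zero x
  have hext : radialExt (fun y => grad0 F y b) =ᶠ[𝓝 (x : E3)]
      fun y => ‖y‖ * fderiv ℝ (radialExt F) y (EuclideanSpace.single b 1) := by
    filter_upwards [isOpen_ne.mem_nhds hx] with y hy
    have hy' : 0 < ‖y‖⁻¹ := inv_pos.2 (norm_pos_iff.2 hy)
    simp [radialExt_of_ne _ hy, grad0, coe_radialProj hy, fderiv_radialExt_smul hF hy' hy]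
  have hdiff := (((hF.contDiffAt hx).fderiv_right (m := 1) (by norm_cast)).clm_apply
    (contDiffAt_const (c := EuclideanSpace.single b (1 : ℝ)))).differentiableAt one_ne_zero
  have hprod : HasFDerivAt (fun y : E3 => ‖y‖ * fderiv ℝ (radialExt F) y
      (EuclideanSpace.single b 1)) _ (x : E3) := (hasFDerivAt_norm hx).mul hdiff.hasFDerivAt
  rw [grad0, hext.fderiv_eq, hprod.fderiv]
  simp [coordX, EuclideanSpace.inner_single_right, grad0]
  ring

lemma grad0_grad0_comm {F : S2 → ℝ} (hF : SmoothS2 F) (x : S2) (a b : Fin 3) :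
    grad0 (fun y => grad0 F y b) x a =
      grad0 (fun y => grad0 F y a) x b + coordX a x * grad0 F x b - coordX b x * grad0 F x a := by
  rw [grad0_grad0_eq_fderiv_fderiv hF, grad0_grad0_eq_fderiv_fderiv hF, fderiv_fderiv_apply_comm
    ((hF.contDiffAt (S2.coe_ne_zero x)).of_le (by norm_cast))]
  ring

/-! ### Integration on the sphere -/

section SphereRotation

variable {E : Type*} [NormedAddCommGroup E] [InnerProductSpace ℝ E]

/-- The restriction of a linear isometry of `E` to the unit sphere of `E`. -/
def sphereRotation (e : E ≃ₗᵢ[ℝ] E) (x : Metric.sphere (0 : E) 1) : Metric.sphere (0 : E) 1 :=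
  ⟨e x, by simp⟩

open scoped Pointwise in
lemma measurePreserving_sphereRotation [FiniteDimensional ℝ E] [MeasurableSpace E] [BorelSpace E]
    (e : E ≃ₗᵢ[ℝ] E) : MeasurePreserving (sphereRotation e)
      (volume : Measure E).toSphere (volume : Measure E).toSphere := by
  have hcont : Continuous (sphereRotation e) :=
    (e.continuous.comp continuous_subtype_val).subtype_mk _
  refine ⟨hcont.measurable, Measure.ext fun s hs => ?_⟩
  have hcone : Set.Ioo (0 : ℝ) 1 • ((↑) '' (sphereRotation e ⁻¹' s) : Set E) =
      e ⁻¹' (Set.Ioo (0 : ℝ) 1 • ((↑) '' s)) := by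
    ext y
    simp only [Set.mem_smul, Set.mem_image, Set.mem_preimage]
    constructor
    · rintro ⟨r, hr, _, ⟨x, hx, rfl⟩, rfl⟩
      exact ⟨r, hr, e x, ⟨_, hx, rfl⟩, (map_smul e r _).symm⟩
    · rintro ⟨r, hr, _, ⟨x, hx, rfl⟩, hy⟩
      refine ⟨r, hr, e.symm x, ⟨sphereRotation e.symm x, ?_, rfl⟩, ?_⟩
      · simpa [sphereRotation] using hx
      · rw [← map_smul, hy, e.symm_apply_apply]
  rw [Measure.map_apply hcont.measurable hs, Measure.toSphere_apply' _ (hcont.measurable hs),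
    Measure.toSphere_apply' _ hs, hcone,
    e.measurePreserving.measure_preimage_emb e.toHomeomorph.measurableEmbedding]

end SphereRotation

/-- The area measure of the sphere. -/
abbrev areaS2 : Measure S2 := (volume : Measure E3).toSphere

lemma integrable_areaS2 {F : S2 → ℝ} (hF : Continuous F) : Integrable F areaS2 :=
  hF.integrable_of_hasCompactSupport (HasCompactSupport.of_compactSpace F)

lemma SmoothS2.integrable {F : S2 → ℝ} (hF : SmoothS2 F) : Integrable F areaS2 :=
  integrable_areaS2 hF.continuous

/-- The flow of the vector field `x ↦ A x` preserves the area, so the integral of `F` along it is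
constant. -/
lemma integral_fderiv_radialExt_skewAdjoint {F : S2 → ℝ} (hF : SmoothS2 F) {A : E3 →L[ℝ] E3}
    (hA : A ∈ skewAdjoint (E3 →L[ℝ] E3)) :
    ∫ x : S2, fderiv ℝ (radialExt F) (x : E3) (A x) ∂areaS2 = 0 := by
  let +nondep : NormedAlgebra ℚ (E3 →L[ℝ] E3) := .restrictScalars ℚ ℝ _
  let flow (t : ℝ) : E3 ≃ₗᵢ[ℝ] E3 := Unitary.linearIsometryEquiv
    ⟨NormedSpace.exp (t • A), NormedSpace.exp_mem_unitary_of_mem_skewAdjoint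
      (skewAdjoint.smul_mem t hA)⟩
  let G (x : S2) : ℝ := fderiv ℝ (radialExt F) (x : E3) (A x)
  have hG : Continuous G := by
    simp only [G, fderiv_radialExt_apply_eq_sum]
    have hA_cont := A.continuous
    have hgrad (a : Fin 3) := (hF.smoothS2_grad0 a).continuous
    fun_prop
  obtain ⟨K, hK⟩ := isCompact_univ.exists_bound_of_continuousOn hG.continuousOn
  have hderiv (x : S2) (t : ℝ) : HasDerivAt (fun t => F (sphereRotation (flow t) x))
      (G (sphereRotation (flow t) x)) t := by
    have hcurve : HasDerivAt (fun t : ℝ => NormedSpace.exp (t • A) (x : E3))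
        (A (NormedSpace.exp (t • A) (x : E3))) t := by
      simpa using (hasDerivAt_exp_smul_const' A t).clm_apply (hasDerivAt_const t (x : E3))
    have hchain := (hF.hasFDerivAt
      (S2.coe_ne_zero (sphereRotation (flow t) x))).comp_hasDerivAt t hcurve
    exact hchain.congr_of_eventuallyEq
      (Eventually.of_forall fun s => (radialExt_coe F (sphereRotation (flow s) x)).symm)
  have hflow (t : ℝ) := measurePreserving_sphereRotation (flow t)
  have hcont (H : S2 → ℝ) (hH : Continuous H) (t : ℝ) :
      AEStronglyMeasurable (fun x => H (sphereRotation (flow t) x)) areaS2 :=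
    hH.aestronglyMeasurable.comp_measurePreserving (hflow t)
  have hconst (H : S2 → ℝ) (hH : Continuous H) (t : ℝ) :
      ∫ x, H (sphereRotation (flow t) x) ∂areaS2 = ∫ x, H x ∂areaS2 := by
    rw [← integral_map (hflow t).aemeasurable hH.aestronglyMeasurable, (hflow t).map_eq]
  have hintegral := (hasDerivAt_integral_of_dominated_loc_of_deriv_le (μ := areaS2)
    (s := Set.univ) (x₀ := (0 : ℝ)) (bound := fun _ => K) Filter.univ_mem
    (Eventually.of_forall (hcont F hF.continuous))
    ((hflow 0).integrable_comp_of_integrable hF.integrable) (hcont G hG 0)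
    (Eventually.of_forall fun x t _ => hK _ trivial) (integrable_const K)
    (Eventually.of_forall fun x t _ => hderiv x t)).2
  simp only [hconst F hF.continuous, hconst G hG] at hintegral
  exact hintegral.unique (hasDerivAt_const 0 _)

lemma integralS2_rotation {F : S2 → ℝ} (hF : SmoothS2 F) (a b : Fin 3) :
    integralS2 (fun x => coordX b x * grad0 F x a - coordX a x * grad0 F x b) = 0 := by
  let e (i : Fin 3) : E3 := EuclideanSpace.single i 1
  let A : E3 →L[ℝ] E3 :=
    InnerProductSpace.rankOne ℝ (e a) (e b) - InnerProductSpace.rankOne ℝ (e b) (e a)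
  have hA : A ∈ skewAdjoint (E3 →L[ℝ] E3) := by
    simp [skewAdjoint.mem_iff, A, ContinuousLinearMap.star_eq_adjoint]
  refine (integral_congr_ae (Eventually.of_forall fun x => ?_)).trans
    (integral_fderiv_radialExt_skewAdjoint hF hA)
  simp [A, e, grad0, coordX, EuclideanSpace.inner_single_left]

lemma grad0_eq_sum_rotation {F : S2 → ℝ} (hF : SmoothS2 F) (x : S2) (a : Fin 3) :
    grad0 F x a = 2 * (coordX a x * F x) +
      ∑ b, (coordX b x * grad0 (fun y => coordX b y * F y) x a -
        coordX a x * grad0 (fun y => coordX b y * F y) x b) := by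
  have hsq := sum_coordX_sq x
  have hrad := sum_coordX_mul_grad0 hF x
  have hdelta : ∑ b, (if a = b then 1 else 0) * coordX b x = coordX a x := by simp
  simp only [Fin.sum_univ_three] at hsq hrad hdelta
  simp only [grad0_mul (smoothS2_coordX _) hF, grad0_coordX, Fin.sum_univ_three, if_true]
  linear_combination -grad0 F x a * hsq + coordX a x * hrad - F x * hdelta

/-- The divergence theorem on the sphere, in ambient components: the mean curvature term is due to
the normal part of a constant vector field. -/
lemma integralS2_grad0 {F : S2 → ℝ} (hF : SmoothS2 F) (a : Fin 3) :
    integralS2 (fun x => grad0 F x a) = 2 * integralS2 (fun x => coordX a x * F x) := by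
  have hmul (b : Fin 3) : SmoothS2 (fun y => coordX b y * F y) := (smoothS2_coordX b).mul hF
  have hdiff (b : Fin 3) : Integrable (fun x => coordX b x * grad0 (fun y => coordX b y * F y) x a -
      coordX a x * grad0 (fun y => coordX b y * F y) x b) areaS2 :=
    SmoothS2.integrable (((smoothS2_coordX b).mul ((hmul b).smoothS2_grad0 a)).sub
      ((smoothS2_coordX a).mul ((hmul b).smoothS2_grad0 b)))
  simp only [grad0_eq_sum_rotation hF, integralS2]
  rw [integral_add ((hmul a).integrable.const_mul 2) (integrable_finsetSum _ fun b _ => hdiff b),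
    integral_const_mul, integral_finsetSum _ fun b _ => hdiff b]
  exact (congrArg _ (Finset.sum_eq_zero fun b _ => integralS2_rotation (hmul b) a b)).trans
    (add_zero _)

/-! ### Tensor calculus on the round sphere in ambient components -/

/-- An algebraic model of the smooth functions on the round two-sphere: the coordinate functions
`X a`, the ambient components `D a` of the gradient, and the integral. Tensors are represented by
their ambient components, so that covariant differentiation is `D` followed by the projection
`metric`, and every tensor identity becomes an identity in the commutative algebra `A`. -/
structure SphereCalculus (A : Type*) [CommRing A] [Algebra ℝ A] where
  X : Fin 3 → A
  D : Fin 3 → Derivation ℝ A A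
  integral : A →ₗ[ℝ] ℝ
  sum_X_mul_X : ∑ a, X a * X a = 1
  D_X_eq_ite_sub : ∀ a b, D a (X b) = (if a = b then 1 else 0) - X a * X b
  sum_X_mul_D : ∀ F, ∑ a, X a * D a F = 0
  D_comm : ∀ a b F, D a (D b F) = D b (D a F) + X a * D b F - X b * D a F
  integral_D : ∀ a F, integral (D a F) = 2 * integral (X a * F)
  integral_mul_self_nonneg : ∀ F, 0 ≤ integral (F * F)

open scoped Matrix in
lemma cross_eq_dotProduct_smul {R : Type*} [CommRing R] {x v w : Fin 3 → R} (hx : x ⬝ᵥ x = 1)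
    (hv : x ⬝ᵥ v = 0) (hw : x ⬝ᵥ w = 0) : v ⨯₃ w = (x ⬝ᵥ v ⨯₃ w) • x := by
  have hnormal : x ⨯₃ (v ⨯₃ w) = 0 := by
    rw [cross_cross_eq_smul_sub_smul', hw, dotProduct_comm v x, hv, zero_smul, zero_smul, sub_zero]
  have hdouble := cross_cross_eq_smul_sub_smul' x x (v ⨯₃ w)
  rw [hnormal, map_zero, hx, one_smul] at hdouble
  exact (sub_eq_zero.mp hdouble.symm).symm

namespace SphereCalculus

variable {A : Type*} [CommRing A] [Algebra ℝ A]

section Definitions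

variable (S : SphereCalculus A)

/-- The round metric, in ambient components the projection onto the tangent plane. -/
def metric (a b : Fin 3) : A := (if a = b then 1 else 0) - S.X a * S.X b

/-- The Laplacian on functions. -/
def laplacian : A →ₗ[ℝ] A := ∑ a, (S.D a : A →ₗ[ℝ] A) ∘ₗ (S.D a : A →ₗ[ℝ] A)

/-- The Hessian of a function; the second term is the tangential projection of `D a (D b F)`. -/
def hessian (F : A) (a b : Fin 3) : A := S.D a (S.D b F) + S.X b * S.D a F

/-- The operator `Δ(Δ + 2)`, the double divergence of `electricShear`. -/
def biLaplacian : A →ₗ[ℝ] A := S.laplacian ∘ₗ S.laplacian + (2 : ℝ) • S.laplacian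

/-- The electric-parity shear `2∇∇F - σΔF`. A shear with potentials `c` and `c'` is
`(electricShear c + magneticShear c') / 2`. -/
def electricShear (F : A) (a b : Fin 3) : A := 2 * S.hessian F a b - S.metric a b * S.laplacian F

/-- The volume form of the outer normal. -/
def volForm (a b : Fin 3) : A := ∑ c, algebraMap ℝ A (leviCivita a b c) * S.X c

/-- The magnetic-parity shear `ε∇∇F`, symmetrized without a factor one half. -/
def magneticShear (F : A) (a b : Fin 3) : A :=
  ∑ e, S.volForm a e * S.hessian F e b + ∑ e, S.volForm b e * S.hessian F e a

/-- Symmetric traceless tangential two-tensors. -/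
structure IsSTT (T : Fin 3 → Fin 3 → A) : Prop where
  symm : ∀ a b, T a b = T b a
  tangential : ∀ b, ∑ a, S.X a * T a b = 0
  trace : ∑ a, T a a = 0

/-- The ambient divergence of a two-tensor. It is the covariant divergence for symmetric traceless
tangential tensors; for the others see `tangentDiv`. -/
def div (T : Fin 3 → Fin 3 → A) (b : Fin 3) : A := ∑ a, S.D a (T a b)

/-- The double divergence of a symmetric traceless tangential two-tensor. -/
def divDiv (T : Fin 3 → Fin 3 → A) : A := ∑ b, S.D b (S.div T b)

/-- The covariant derivative of a one-form. -/
def covDeriv (w : Fin 3 → A) (a b : Fin 3) : A := ∑ d, S.metric b d * S.D a (w d)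

/-- The covariant divergence of a tangential two-tensor. -/
def tangentDiv (T : Fin 3 → Fin 3 → A) (b : Fin 3) : A := ∑ e, S.metric b e * S.div T e

/-- The rotation vector field `x ↦ κ x` generated by a matrix `κ`. -/
def rotField (κ : Fin 3 → Fin 3 → ℝ) (a : Fin 3) : A := ∑ c, algebraMap ℝ A (κ a c) * S.X c

/-- The derivative of functions along the rotation vector field generated by `κ`. -/
def rot (κ : Fin 3 → Fin 3 → ℝ) : Derivation ℝ A A := ∑ a, S.rotField κ a • S.D a

/-- The Lie derivative of a two-tensor along the rotation vector field generated by `κ`. -/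
def lieRot (κ : Fin 3 → Fin 3 → ℝ) (T : Fin 3 → Fin 3 → A) (a b : Fin 3) : A :=
  S.rot κ (T a b) + ∑ d, algebraMap ℝ A (κ d a) * T d b + ∑ d, algebraMap ℝ A (κ d b) * T a d

/-- Antisymmetric matrices, the generators of rotations. -/
def IsSkew (κ : Fin 3 → Fin 3 → ℝ) : Prop := ∀ a b, κ b a = -κ a b

end Definitions

section Basic

variable (S : SphereCalculus A)

lemma D_X (a b : Fin 3) : S.D a (S.X b) = S.metric a b := S.D_X_eq_ite_sub a b

lemma D_mul (a : Fin 3) (F G : A) : S.D a (F * G) = S.D a F * G + F * S.D a G := by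
  simp only [Derivation.leibniz, smul_eq_mul]; ring

lemma D_algebraMap (a : Fin 3) (r : ℝ) : S.D a (algebraMap ℝ A r) = 0 :=
  Derivation.map_algebraMap _ _

lemma D_two (a : Fin 3) : S.D a (2 : A) = 0 := by
  simpa only [map_ofNat] using S.D_algebraMap a 2

lemma sum_X_mul_X_fin : S.X 0 * S.X 0 + S.X 1 * S.X 1 + S.X 2 * S.X 2 = 1 := by
  simpa only [Fin.sum_univ_three] using S.sum_X_mul_X

lemma metric_symm (a b : Fin 3) : S.metric a b = S.metric b a := by
  simp only [metric, eq_comm (a := a)]; ring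

lemma sum_metric_mul (b : Fin 3) (v : Fin 3 → A) :
    ∑ a, S.metric b a * v a = v b - S.X b * ∑ a, S.X a * v a := by
  simp only [metric, sub_mul, ite_mul, one_mul, zero_mul, Finset.sum_sub_distrib,
    Finset.sum_ite_eq, Finset.mem_univ, if_true, Finset.mul_sum, mul_assoc]

lemma sum_metric_mul_of_tangential {v : Fin 3 → A} (hv : ∑ a, S.X a * v a = 0) (b : Fin 3) :
    ∑ a, S.metric b a * v a = v b := by
  rw [sum_metric_mul, hv, mul_zero, sub_zero]

lemma sum_X_mul_metric (b : Fin 3) : ∑ a, S.X a * S.metric a b = 0 := by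
  simp only [S.metric_symm _ b, mul_comm (S.X _)]
  rw [sum_metric_mul, S.sum_X_mul_X, mul_one, sub_self]

lemma sum_metric_diag : ∑ a, S.metric a a = 2 := by
  simp only [metric, if_true, Fin.sum_univ_three]; linear_combination -S.sum_X_mul_X_fin

lemma sum_metric_mul_D (b : Fin 3) (F : A) : ∑ a, S.metric b a * S.D a F = S.D b F :=
  S.sum_metric_mul_of_tangential (S.sum_X_mul_D F) b

lemma D_metric (c a b : Fin 3) :
    S.D c (S.metric a b) = -(S.metric c a * S.X b) - S.X a * S.metric c b := by
  have hdelta : S.D c (if a = b then (1 : A) else 0) = 0 := by split_ifs <;> simp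
  conv_lhs => rw [metric]
  rw [map_sub, hdelta, D_mul, D_X, D_X]; ring

/-- Differentiating `∑ a, X a * v a = 0`: the normal part of the derivative of a tangential
field. -/
lemma sum_X_mul_D_of_tangential {v : Fin 3 → A} (hv : ∑ a, S.X a * v a = 0) (b : Fin 3) :
    ∑ a, S.X a * S.D b (v a) = -v b := by
  have hD := congrArg (S.D b) hv
  simp only [map_sum, D_mul, D_X, Finset.sum_add_distrib, map_zero,
    S.sum_metric_mul_of_tangential hv] at hD
  exact eq_neg_of_add_eq_zero_right hD

lemma sum_X_mul_sum_mul {T : Fin 3 → Fin 3 → A} (hT : ∀ b, ∑ a, S.X a * T a b = 0)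
    (w : Fin 3 → A) : ∑ a, S.X a * ∑ b, T a b * w b = 0 := by
  simp only [Finset.mul_sum, ← mul_assoc]
  rw [Finset.sum_comm]
  simp only [← Finset.sum_mul, hT, zero_mul, Finset.sum_const_zero]

lemma integral_sum_D (v : Fin 3 → A) (hv : ∑ a, S.X a * v a = 0) :
    S.integral (∑ a, S.D a (v a)) = 0 := by
  simp only [map_sum, integral_D, ← Finset.mul_sum]
  rw [← map_sum, hv, map_zero, mul_zero]

lemma laplacian_apply (F : A) : S.laplacian F = ∑ a, S.D a (S.D a F) := by
  simp [laplacian, LinearMap.sum_apply]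

lemma biLaplacian_apply (F : A) :
    S.biLaplacian F = S.laplacian (S.laplacian F) + 2 * S.laplacian F := by
  simp [biLaplacian, Algebra.smul_def, map_ofNat]

lemma laplacian_mul (F G : A) :
    S.laplacian (F * G) =
      S.laplacian F * G + F * S.laplacian G + 2 * ∑ a, S.D a F * S.D a G := by
  simp only [laplacian_apply, D_mul, map_add, Fin.sum_univ_three]; ring

lemma laplacian_X (k : Fin 3) : S.laplacian (S.X k) = -2 * S.X k := by
  have htang := S.sum_X_mul_metric k
  have htrace := S.sum_metric_diag
  simp only [laplacian_apply, D_X, D_metric, Fin.sum_univ_three] at htang htrace ⊢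
  linear_combination -htang - S.X k * htrace

lemma laplacian_D (b : Fin 3) (F : A) :
    S.laplacian (S.D b F) = S.D b (S.laplacian F) - 2 * S.X b * S.laplacian F := by
  have hcomm (a : Fin 3) : S.D a (S.D a (S.D b F)) =
      S.D b (S.D a (S.D a F)) + S.X a * S.D b (S.D a F) - S.X b * S.D a (S.D a F) +
        S.metric a a * S.D b F + S.X a * S.D a (S.D b F) - S.metric a b * S.D a F -
        S.X b * S.D a (S.D a F) := by
    have hfst := congrArg (S.D a) (S.D_comm a b F)
    have hsnd := S.D_comm a b (S.D a F)
    simp only [map_add, map_sub, D_mul, D_X] at hfst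
    linear_combination hfst + hsnd
  have hnormal := S.sum_X_mul_D_of_tangential (S.sum_X_mul_D F) b
  have htrace := S.sum_metric_diag
  have htang := S.sum_X_mul_D (S.D b F)
  have hproj := S.sum_metric_mul_D b F
  simp only [S.metric_symm b, hcomm, laplacian_apply, map_add, Fin.sum_univ_three]
    at hnormal htrace htang hproj ⊢
  linear_combination hnormal + S.D b F * htrace + htang - hproj

end Basic

/-! ### Symmetric traceless tensors -/

section TracelessTensors

variable {S : SphereCalculus A}

lemma IsSTT.sum_mul_X {T : Fin 3 → Fin 3 → A} (hT : S.IsSTT T) (a : Fin 3) :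
    ∑ b, S.X b * T a b = 0 := by
  simpa only [hT.symm a] using hT.tangential a

lemma IsSTT.sum_X_mul_div {T : Fin 3 → Fin 3 → A} (hT : S.IsSTT T) :
    ∑ b, S.X b * S.div T b = 0 := by
  have hnormal (a : Fin 3) : ∑ b, S.X b * S.D a (T a b) = -T a a :=
    S.sum_X_mul_D_of_tangential (hT.sum_mul_X a) a
  simp only [div, Finset.mul_sum]
  rw [Finset.sum_comm]
  simp only [hnormal, Finset.sum_neg_distrib, hT.trace, neg_zero]

lemma IsSTT.tangentDiv_eq {T : Fin 3 → Fin 3 → A} (hT : S.IsSTT T) : S.tangentDiv T = S.div T :=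
  funext fun b => S.sum_metric_mul_of_tangential hT.sum_X_mul_div b

open scoped Matrix in
/-- The Codazzi identity for symmetric traceless tensors in dimension two, contracted with a
symmetric traceless tensor and a tangent vector; `E d a b` stands for the derivative `D d (C a b)`.
The cross product of the tangent vectors `v` and `T b` is normal, so only the normal component of
the curl of `C` contributes, and its antisymmetric part is the divergence. -/
lemma codazzi_of_traceless {R : Type*} [CommRing R] {x v : Fin 3 → R} {T : Fin 3 → Fin 3 → R}
    {E : Fin 3 → Fin 3 → Fin 3 → R} (hx : x ⬝ᵥ x = 1) (hv : x ⬝ᵥ v = 0)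
    (hTsymm : ∀ a b, T a b = T b a) (hTtang : ∀ b, x ⬝ᵥ T b = 0) (hTtrace : ∑ a, T a a = 0)
    (hEsymm : ∀ d a b, E d a b = E d b a) (hEtrace : ∀ d, ∑ a, E d a a = 0)
    (hEnormal : ∀ d a, x ⬝ᵥ E d a = x ⬝ᵥ E a d) :
    ∑ a, ∑ b, ∑ d, T a b * v d * E d a b =
      ∑ a, ∑ b, ∑ d, T a b * v d * E a d b + ∑ a, ∑ b, T a b * v b * ∑ d, E d d a := by
  let curl (b : Fin 3) : Fin 3 → R :=
    ![E 1 2 b - E 2 1 b, E 2 0 b - E 0 2 b, E 0 1 b - E 1 0 b]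
  have hcross (b c : Fin 3) : (v ⨯₃ T b) c = (x ⬝ᵥ v ⨯₃ T b) * x c :=
    congrFun (cross_eq_dotProduct_smul hx hv (hTtang b)) c
  have hcurl (c : Fin 3) : ∑ b, x b * curl b c = 0 := by
    have hE := hEnormal
    simp only [Matrix.vec3_dotProduct] at hE
    fin_cases c <;> simp [curl, Fin.sum_univ_three]
    · linear_combination hE 1 2
    · linear_combination hE 2 0
    · linear_combination hE 0 1
  rw [← sub_eq_iff_eq_add']
  calc ∑ a, ∑ b, ∑ d, T a b * v d * E d a b - ∑ a, ∑ b, ∑ d, T a b * v d * E a d b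
      = ∑ b, ∑ c, (v ⨯₃ T b) c * curl b c := by
        simp [curl, cross_apply, Fin.sum_univ_three, hTsymm 1 0, hTsymm 2 0, hTsymm 2 1]
        ring
    _ = ∑ b, ∑ c, (v ⨯₃ T b) c * curl b c - ∑ b, (x ⬝ᵥ v ⨯₃ T b) * ∑ c, x c * curl c b := by
        simp only [hcurl, mul_zero, Finset.sum_const_zero, sub_zero]
    _ = ∑ b, ∑ c, (v ⨯₃ T b) c * (curl b c - curl c b) := by
        simp only [Finset.mul_sum, ← mul_assoc, ← hcross, mul_sub, Finset.sum_sub_distrib]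
    _ = ∑ a, ∑ b, T a b * v b * ∑ d, E d d a := by
        have htr := hTtrace
        have hE0 := hEtrace 0
        have hE1 := hEtrace 1
        have hE2 := hEtrace 2
        simp only [Fin.sum_univ_three] at htr hE0 hE1 hE2
        simp [curl, cross_apply, Fin.sum_univ_three, hTsymm 1 0, hTsymm 2 0, hTsymm 2 1,
          hEsymm _ 1 0, hEsymm _ 2 0, hEsymm _ 2 1]
        linear_combination
          -(v 0 * (E 0 0 0 + E 1 0 1 + E 2 0 2) + v 1 * (E 0 0 1 + E 1 1 1 + E 2 1 2) +
            v 2 * (E 0 0 2 + E 1 1 2 + E 2 2 2)) * htr -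
          (v 0 * T 0 0 + v 1 * T 0 1 + v 2 * T 0 2 - v 0 * (T 0 0 + T 1 1 + T 2 2)) * hE0 -
          (v 0 * T 0 1 + v 1 * T 1 1 + v 2 * T 1 2 - v 1 * (T 0 0 + T 1 1 + T 2 2)) * hE1 -
          (v 0 * T 0 2 + v 1 * T 1 2 + v 2 * T 2 2 - v 2 * (T 0 0 + T 1 1 + T 2 2)) * hE2

lemma IsSTT.codazzi {T C : Fin 3 → Fin 3 → A} (hT : S.IsSTT T) (hC : S.IsSTT C)
    {v : Fin 3 → A} (hv : ∑ a, S.X a * v a = 0) :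
    ∑ a, ∑ b, ∑ d, T a b * v d * S.D d (C a b) =
      ∑ a, ∑ b, ∑ d, T a b * v d * S.D a (C d b) + ∑ a, ∑ b, T a b * v b * S.div C a := by
  refine codazzi_of_traceless (x := S.X) (E := fun d a b => S.D d (C a b)) S.sum_X_mul_X hv hT.symm
    (fun b => hT.sum_mul_X b) hT.trace (fun d a b => by rw [hC.symm])
    (fun d => by rw [← map_sum, hC.trace, map_zero]) fun d a => ?_
  refine (S.sum_X_mul_D_of_tangential (hC.sum_mul_X a) d).trans ?_
  rw [hC.symm, ← S.sum_X_mul_D_of_tangential (hC.sum_mul_X d) a]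
  rfl

lemma hessian_symm (F : A) (a b : Fin 3) : S.hessian F a b = S.hessian F b a := by
  rw [hessian, hessian, S.D_comm a b F]; ring

lemma sum_X_mul_hessian (F : A) (b : Fin 3) : ∑ a, S.X a * S.hessian F a b = 0 := by
  have hfst := S.sum_X_mul_D (S.D b F)
  have hsnd := S.sum_X_mul_D F
  simp only [hessian, Fin.sum_univ_three] at hfst hsnd ⊢
  linear_combination hfst + S.X b * hsnd

lemma sum_hessian_diag (F : A) : ∑ a, S.hessian F a a = S.laplacian F := by
  simp only [hessian, Finset.sum_add_distrib, S.sum_X_mul_D, add_zero, laplacian_apply]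

lemma isSTT_electricShear (F : A) : S.IsSTT (S.electricShear F) where
  symm a b := by rw [electricShear, electricShear, hessian_symm, S.metric_symm]
  tangential b := by
    have hhess := sum_X_mul_hessian (S := S) F b
    have hmetric := S.sum_X_mul_metric b
    simp only [electricShear, Fin.sum_univ_three] at hhess hmetric ⊢
    linear_combination 2 * hhess - S.laplacian F * hmetric
  trace := by
    simp only [electricShear, Finset.sum_sub_distrib, ← Finset.mul_sum, ← Finset.sum_mul,
      sum_hessian_diag, S.sum_metric_diag, sub_self]

lemma div_electricShear (F : A) (b : Fin 3) :
    S.div (S.electricShear F) b = S.D b (S.laplacian F) + 2 * S.D b F := by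
  have hcomm := S.laplacian_D b F
  have hproj := S.sum_metric_mul_D b F
  have hproj' := S.sum_metric_mul_D b (S.laplacian F)
  have htrace := S.sum_metric_diag
  have htang := S.sum_X_mul_metric b
  have hlap : S.laplacian F = ∑ a, S.D a (S.D a F) := S.laplacian_apply F
  have hlapD : S.laplacian (S.D b F) = ∑ a, S.D a (S.D a (S.D b F)) := S.laplacian_apply _
  simp only [S.metric_symm b, div, electricShear, hessian, map_sub, map_add, D_mul, D_two, D_X,
    D_metric, Fin.sum_univ_three] at hcomm hproj hproj' htrace htang hlap hlapD ⊢
  linear_combination 2 * hcomm - 2 * hlapD + 2 * hproj - hproj' + S.laplacian F * S.X b * htrace +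
    S.laplacian F * htang - 2 * S.X b * hlap

lemma divDiv_electricShear (F : A) : S.divDiv (S.electricShear F) = S.biLaplacian F := by
  simp only [divDiv, div_electricShear, biLaplacian_apply, laplacian_apply, map_add, D_mul, D_two,
    Finset.sum_add_distrib, zero_mul, zero_add, ← Finset.mul_sum]

lemma electricShear_X (k a b : Fin 3) : S.electricShear (S.X k) a b = 0 := by
  simp only [electricShear, hessian, laplacian_X, D_X, D_metric]; ring

lemma electricShear_algebraMap (r : ℝ) (a b : Fin 3) :
    S.electricShear (algebraMap ℝ A r) a b = 0 := by
  simp only [electricShear, hessian, laplacian_apply, D_algebraMap, map_zero, Finset.sum_const_zero,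
    mul_zero, add_zero, sub_zero]

lemma IsSTT.sum_mul_electricShear {T : Fin 3 → Fin 3 → A} (hT : S.IsSTT T) (F : A) :
    ∑ a, ∑ b, T a b * S.electricShear F a b = 2 * ∑ a, ∑ b, T a b * S.D a (S.D b F) := by
  have hnormal (a : Fin 3) : ∑ b, T a b * S.X b = 0 := by
    simpa only [mul_comm (T a _)] using hT.sum_mul_X a
  have hdelta (a : Fin 3) : ∑ b, T a b * S.metric a b = T a a := by
    simp only [mul_comm (T a _)]
    exact S.sum_metric_mul_of_tangential (hT.sum_mul_X a) a
  have hterm (a b : Fin 3) : T a b * S.electricShear F a b = 2 * (T a b * S.D a (S.D b F)) +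
      (2 * S.D a F * (T a b * S.X b) - S.laplacian F * (T a b * S.metric a b)) := by
    rw [electricShear, hessian]; ring
  simp only [hterm, Finset.sum_add_distrib, Finset.sum_sub_distrib, ← Finset.mul_sum, hnormal,
    hdelta, hT.trace, mul_zero, Finset.sum_const_zero, sub_zero, add_zero]

lemma IsSTT.integral_sum_mul_electricShear {T : Fin 3 → Fin 3 → A} (hT : S.IsSTT T) (F : A) :
    S.integral (∑ a, ∑ b, T a b * S.electricShear F a b) = 2 * S.integral (S.divDiv T * F) := by
  have hparts : ∑ a, ∑ b, T a b * S.D a (S.D b F) - S.divDiv T * F =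
      ∑ a, S.D a (∑ b, T a b * S.D b F) - ∑ a, S.D a (S.div T a * F) := by
    simp only [divDiv, div, map_add, D_mul, Fin.sum_univ_three]; ring
  have hfst := S.integral_sum_D _ (S.sum_X_mul_sum_mul hT.tangential fun b => S.D b F)
  have hsnd := S.integral_sum_D (fun a => S.div T a * F) (by
    simp only [← mul_assoc, ← Finset.sum_mul, hT.sum_X_mul_div, zero_mul])
  have hintegral := congrArg S.integral hparts
  rw [map_sub, map_sub, hfst, hsnd, sub_zero, sub_eq_zero] at hintegral
  rw [hT.sum_mul_electricShear, two_mul, map_add, hintegral, two_mul]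

lemma volForm_entries : S.volForm 0 0 = 0 ∧ S.volForm 1 1 = 0 ∧ S.volForm 2 2 = 0 ∧
    S.volForm 0 1 = S.X 2 ∧ S.volForm 1 2 = S.X 0 ∧ S.volForm 2 0 = S.X 1 ∧
    S.volForm 1 0 = -S.X 2 ∧ S.volForm 2 1 = -S.X 0 ∧ S.volForm 0 2 = -S.X 1 := by
  refine ⟨?_, ?_, ?_, ?_, ?_, ?_, ?_, ?_, ?_⟩ <;>
    norm_num [volForm, leviCivita, Fin.sum_univ_three, map_ofNat]

lemma sum_X_mul_volForm (b : Fin 3) : ∑ a, S.X a * S.volForm a b = 0 := by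
  obtain ⟨h00, h11, h22, h01, h12, h20, h10, h21, h02⟩ := S.volForm_entries
  fin_cases b <;> simp [Fin.sum_univ_three, h00, h11, h22, h01, h12, h20, h10, h21, h02] <;> ring

lemma div_volForm_mul_hessian (F : A) (b : Fin 3) :
    S.div (fun a b => ∑ e, S.volForm a e * S.hessian F e b) b = ∑ e, S.volForm b e * S.D e F := by
  obtain ⟨h00, h11, h22, h01, h12, h20, h10, h21, h02⟩ := S.volForm_entries
  have hcomm10 := S.D_comm 1 0
  have hcomm20 := S.D_comm 2 0
  have hcomm21 := S.D_comm 2 1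
  fin_cases b <;>
  · simp [div, Fin.sum_univ_three, h00, h11, h22, h01, h12, h20, h10, h21, h02, hessian, D_X,
      metric, hcomm10, hcomm20, hcomm21]
    ring

lemma sum_D_volForm_mul_D (F : A) : ∑ b, S.D b (∑ e, S.volForm b e * S.D e F) = 0 := by
  obtain ⟨h00, h11, h22, h01, h12, h20, h10, h21, h02⟩ := S.volForm_entries
  have hcomm10 := S.D_comm 1 0
  have hcomm20 := S.D_comm 2 0
  have hcomm21 := S.D_comm 2 1
  simp [Fin.sum_univ_three, h00, h11, h22, h01, h12, h20, h10, h21, h02, D_X, metric,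
    hcomm10, hcomm20, hcomm21]
  ring

lemma sum_D_sum_D_comm (Q : Fin 3 → Fin 3 → A) :
    ∑ b, S.D b (∑ a, S.D a (Q a b)) = ∑ a, S.D a (∑ b, S.D b (Q a b)) +
      (∑ a, ∑ b, S.X b * S.D a (Q a b) - ∑ a, ∑ b, S.X a * S.D b (Q a b)) := by
  have hcomm (a b : Fin 3) : S.D b (S.D a (Q a b)) = S.D a (S.D b (Q a b)) +
      (S.X b * S.D a (Q a b) - S.X a * S.D b (Q a b)) := by
    rw [S.D_comm b a]; ring
  simp only [map_sum]
  rw [Finset.sum_comm]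
  simp only [hcomm, Finset.sum_add_distrib, Finset.sum_sub_distrib]

/-- With `Q b a = ∑ e, volForm b e * hessian F e a`, both the divergence of `Q` and that of its
transpose are divergence free, the latter because commuting the two derivatives only produces the
trace of `Q`, and the Hessian is symmetric. -/
lemma divDiv_magneticShear (F : A) : S.divDiv (S.magneticShear F) = 0 := by
  set Q : Fin 3 → Fin 3 → A := fun b a => ∑ e, S.volForm b e * S.hessian F e a with hQ
  have hdiv (b : Fin 3) : ∑ a, S.D a (Q a b) = ∑ e, S.volForm b e * S.D e F :=
    div_volForm_mul_hessian F b
  have hnormal (a : Fin 3) : ∑ b, S.X b * Q b a = 0 :=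
    S.sum_X_mul_sum_mul sum_X_mul_volForm fun e => S.hessian F e a
  have htrace : ∑ a, Q a a = 0 := by
    obtain ⟨h00, h11, h22, h01, h12, h20, h10, h21, h02⟩ := S.volForm_entries
    simp only [hQ, Fin.sum_univ_three, h00, h11, h22, h01, h12, h20, h10, h21, h02,
      hessian_symm F 1 0, hessian_symm F 2 0, hessian_symm F 2 1]
    ring
  have hfst : ∑ b, S.D b (∑ a, S.D a (Q a b)) = 0 := by
    simp only [hdiv, sum_D_volForm_mul_D]
  have hsnd : ∑ b, S.D b (∑ a, S.D a (Q b a)) = 0 := by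
    rw [sum_D_sum_D_comm fun a b => Q b a, hfst]
    simp only [S.sum_X_mul_D_of_tangential (hnormal _), ← Finset.mul_sum, hdiv,
      S.sum_X_mul_sum_mul sum_X_mul_volForm, Finset.sum_neg_distrib, htrace, neg_zero, sub_zero,
      add_zero]
  have hsplit : S.divDiv (S.magneticShear F) =
      ∑ b, S.D b (∑ a, S.D a (Q a b)) + ∑ b, S.D b (∑ a, S.D a (Q b a)) := by
    simp only [divDiv, div, magneticShear, hQ, map_add, Finset.sum_add_distrib]
  rw [hsplit, hfst, hsnd, add_zero]

end TracelessTensors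
end SphereCalculus

/-! ### Rotations and the flux of angular momentum -/

namespace SphereCalculus

variable {A : Type*} [CommRing A] [Algebra ℝ A] {S : SphereCalculus A} {κ : Fin 3 → Fin 3 → ℝ}

lemma IsSkew.entries (hκ : IsSkew κ) :
    κ 0 0 = 0 ∧ κ 1 1 = 0 ∧ κ 2 2 = 0 ∧ κ 1 0 = -κ 0 1 ∧ κ 2 0 = -κ 0 2 ∧ κ 2 1 = -κ 1 2 :=
  ⟨self_eq_neg.mp (hκ 0 0), self_eq_neg.mp (hκ 1 1), self_eq_neg.mp (hκ 2 2), hκ _ _, hκ _ _,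
    hκ _ _⟩

lemma rot_apply (F : A) : S.rot κ F = ∑ a, S.rotField κ a * S.D a F := by
  simp [rot, Fin.sum_univ_three]

lemma rot_mul (F G : A) : S.rot κ (F * G) = S.rot κ F * G + F * S.rot κ G := by
  simp only [Derivation.leibniz, smul_eq_mul]; ring

lemma rot_two : S.rot κ (2 : A) = 0 := by
  simp only [rot_apply, D_two, mul_zero, Finset.sum_const_zero]

lemma sum_X_mul_rotField (hκ : IsSkew κ) : ∑ a, S.X a * S.rotField κ a = 0 := by
  obtain ⟨h00, h11, h22, h10, h20, h21⟩ := hκ.entries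
  simp only [rotField, Fin.sum_univ_three, h00, h11, h22, h10, h20, h21, map_zero, map_neg]; ring

lemma D_rotField (b a : Fin 3) :
    S.D b (S.rotField κ a) = algebraMap ℝ A (κ a b) - S.X b * S.rotField κ a := by
  simp only [rotField, map_sum, D_mul, D_algebraMap, D_X, zero_mul, zero_add]
  simpa only [mul_comm] using S.sum_metric_mul b fun c => algebraMap ℝ A (κ a c)

lemma rot_X (hκ : IsSkew κ) (b : Fin 3) : S.rot κ (S.X b) = S.rotField κ b := by
  simp only [rot_apply, D_X, S.metric_symm _ b, mul_comm (S.rotField κ _)]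
  exact S.sum_metric_mul_of_tangential (sum_X_mul_rotField hκ) b

lemma D_rot (hκ : IsSkew κ) (b : Fin 3) (F : A) :
    S.D b (S.rot κ F) = S.rot κ (S.D b F) + ∑ a, algebraMap ℝ A (κ a b) * S.D a F := by
  have htang := sum_X_mul_rotField (S := S) hκ
  simp only [rot_apply, map_sum, D_mul, D_rotField, S.D_comm b]
  simp only [Fin.sum_univ_three] at htang ⊢
  linear_combination -S.D b F * htang

/-- Rotations are Killing, so they preserve the integral. -/
lemma integral_rot (hκ : IsSkew κ) (F : A) : S.integral (S.rot κ F) = 0 := by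
  have hdiv : S.rot κ F = ∑ a, S.D a (S.rotField κ a * F) := by
    have htang := sum_X_mul_rotField (S := S) hκ
    obtain ⟨h00, h11, h22, -⟩ := hκ.entries
    simp only [rot_apply, D_mul, D_rotField, Fin.sum_univ_three, h00, h11, h22, map_zero]
      at htang ⊢
    linear_combination F * htang
  rw [hdiv]
  refine S.integral_sum_D _ ?_
  simp only [← mul_assoc, ← Finset.sum_mul, sum_X_mul_rotField hκ, zero_mul]

lemma integral_rot_mul (hκ : IsSkew κ) (F G : A) :
    S.integral (S.rot κ F * G) = -S.integral (F * S.rot κ G) := by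
  have hrot := integral_rot (S := S) hκ (F * G)
  rw [rot_mul, map_add] at hrot
  exact eq_neg_of_add_eq_zero_left hrot

lemma laplacian_rot (hκ : IsSkew κ) (F : A) :
    S.laplacian (S.rot κ F) = S.rot κ (S.laplacian F) := by
  obtain ⟨h00, h11, h22, h10, h20, h21⟩ := hκ.entries
  simp only [laplacian_apply, D_rot hκ, map_add, D_mul, D_algebraMap, Fin.sum_univ_three, h00,
    h11, h22, h10, h20, h21, map_zero, map_neg]
  ring

lemma biLaplacian_rot (hκ : IsSkew κ) (F : A) :
    S.biLaplacian (S.rot κ F) = S.rot κ (S.biLaplacian F) := by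
  simp only [biLaplacian_apply, laplacian_rot hκ, map_add, rot_mul, rot_two, zero_mul, zero_add]

lemma sum_X_mul_algebraMap (hκ : IsSkew κ) (b : Fin 3) :
    ∑ d, algebraMap ℝ A (κ d b) * S.X d = -S.rotField κ b := by
  simp only [rotField, hκ b, map_neg, neg_mul, Finset.sum_neg_distrib]

lemma lieRot_metric (hκ : IsSkew κ) (a b : Fin 3) : S.lieRot κ S.metric a b = 0 := by
  have hdelta : S.rot κ (if a = b then (1 : A) else 0) = 0 := by split_ifs <;> simp
  have hrot : S.rot κ (S.metric a b) = -(S.rotField κ a * S.X b) - S.X a * S.rotField κ b := by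
    rw [metric, map_sub, hdelta, rot_mul, rot_X hκ, rot_X hκ]; ring
  have hfst := sum_X_mul_algebraMap (S := S) hκ a
  have hsnd := sum_X_mul_algebraMap (S := S) hκ b
  have hskew : algebraMap ℝ A (κ b a) = -algebraMap ℝ A (κ a b) := by rw [hκ a b, map_neg]
  rw [lieRot, hrot]
  simp only [metric, mul_sub, mul_ite, mul_one, mul_zero, Finset.sum_sub_distrib,
    Finset.sum_ite_eq, Finset.sum_ite_eq', Finset.mem_univ, if_true, ← mul_assoc,
    ← Finset.sum_mul, hfst, hskew]
  simp only [mul_right_comm _ (S.X a), ← Finset.sum_mul, hsnd]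
  ring

lemma lieRot_hessian (hκ : IsSkew κ) (F : A) (a b : Fin 3) :
    S.lieRot κ (S.hessian F) a b = S.hessian (S.rot κ F) a b := by
  have hX := sum_X_mul_algebraMap (S := S) hκ b
  simp only [lieRot, hessian, D_rot hκ, map_add, D_mul, D_algebraMap, rot_mul, rot_X hκ,
    Fin.sum_univ_three] at hX ⊢
  linear_combination S.D a F * hX

lemma lieRot_electricShear (hκ : IsSkew κ) (F : A) (a b : Fin 3) :
    S.lieRot κ (S.electricShear F) a b = S.electricShear (S.rot κ F) a b := by
  have hhess := lieRot_hessian (S := S) hκ F a b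
  have hmetric := lieRot_metric (S := S) hκ a b
  simp only [lieRot, electricShear, map_sub, rot_mul, rot_two, laplacian_rot hκ,
    Fin.sum_univ_three] at hhess hmetric ⊢
  linear_combination 2 * hhess - S.laplacian F * hmetric

lemma integral_sum_mul_lieRot (hκ : IsSkew κ) {T C : Fin 3 → Fin 3 → A} (hT : S.IsSTT T)
    (hC : S.IsSTT C) :
    S.integral (∑ a, ∑ b, T a b * S.lieRot κ C a b) =
      S.integral (∑ a, ∑ b, T a b * S.rotField κ b * S.div C a) -
        S.integral (∑ a, ∑ b, C a b * S.rotField κ b * S.div T a) +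
        S.integral (∑ a, ∑ b, ∑ d, algebraMap ℝ A (κ d a) * T a b * C d b) := by
  have hlie : ∑ a, ∑ b, T a b * S.lieRot κ C a b =
      ∑ a, ∑ b, ∑ d, T a b * S.rotField κ d * S.D d (C a b) +
        2 * ∑ a, ∑ b, ∑ d, algebraMap ℝ A (κ d a) * T a b * C d b := by
    simp only [lieRot, rot_apply, Fin.sum_univ_three, hT.symm 1 0, hT.symm 2 0, hT.symm 2 1,
      hC.symm 1 0, hC.symm 2 0, hC.symm 2 1]
    ring
  have hnormal (w : Fin 3 → A) := S.sum_X_mul_sum_mul hT.tangential w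
  have hparts : ∑ a, ∑ b, ∑ d, T a b * S.rotField κ d * S.D a (C d b) =
      ∑ a, S.D a (∑ b, T a b * ∑ d, S.rotField κ d * C d b) -
        ∑ a, ∑ b, C a b * S.rotField κ b * S.div T a -
        ∑ a, ∑ b, ∑ d, algebraMap ℝ A (κ d a) * T a b * C d b := by
    have htang := hnormal fun b => ∑ d, S.rotField κ d * C d b
    simp only [div, Fin.sum_univ_three, map_add, D_mul, D_rotField, hT.symm 1 0, hT.symm 2 0,
      hT.symm 2 1, hC.symm 1 0, hC.symm 2 0, hC.symm 2 1] at htang ⊢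
    linear_combination htang
  rw [hlie, hT.codazzi hC (sum_X_mul_rotField hκ), hparts, two_mul]
  simp only [map_add, map_sub, S.integral_sum_D _ (hnormal _)]
  ring

lemma integral_rotField_tangentDiv (hκ : IsSkew κ) {T : Fin 3 → Fin 3 → A}
    (hT : ∀ e, ∑ d, S.X d * T d e = 0) :
    S.integral (∑ b, S.rotField κ b * S.tangentDiv T b) =
      -S.integral (∑ e, ∑ d, algebraMap ℝ A (κ e d) * T d e) := by
  have hproj : ∑ b, S.rotField κ b * S.tangentDiv T b = ∑ e, S.rotField κ e * S.div T e := by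
    have hfield (e : Fin 3) : ∑ b, S.rotField κ b * S.metric b e = S.rotField κ e := by
      simpa only [rot_apply, D_X] using rot_X hκ e
    simp only [tangentDiv, Finset.mul_sum, ← mul_assoc]
    rw [Finset.sum_comm]
    simp only [← Finset.sum_mul, hfield]
  have hnormal := S.sum_X_mul_sum_mul hT (S.rotField κ)
  have hparts : ∑ d, S.D d (∑ e, T d e * S.rotField κ e) = ∑ e, S.rotField κ e * S.div T e +
      ∑ e, ∑ d, algebraMap ℝ A (κ e d) * T d e := by
    simp only [div, Fin.sum_univ_three, map_add, D_mul, D_rotField] at hnormal ⊢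
    linear_combination -hnormal
  have hintegral := S.integral_sum_D _ hnormal
  rw [hparts, map_add] at hintegral
  rw [hproj, eq_neg_of_add_eq_zero_left hintegral]

lemma IsSTT.covDeriv_div {C : Fin 3 → Fin 3 → A} (hC : S.IsSTT C) (a b : Fin 3) :
    S.covDeriv (S.div C) a b = S.D a (S.div C b) + S.X b * S.div C a := by
  rw [covDeriv, S.sum_metric_mul b, S.sum_X_mul_D_of_tangential hC.sum_X_mul_div]
  ring

lemma sum_X_mul_covDeriv (w : Fin 3 → A) (b : Fin 3) : ∑ a, S.X a * S.covDeriv w a b = 0 := by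
  simp only [covDeriv, Finset.mul_sum, mul_left_comm (S.X _)]
  rw [Finset.sum_comm]
  simp only [← Finset.mul_sum, S.sum_X_mul_D, mul_zero, Finset.sum_const_zero]

lemma sum_X_mul_covDeriv' (w : Fin 3 → A) (a : Fin 3) : ∑ b, S.X b * S.covDeriv w a b = 0 := by
  simp only [covDeriv]
  exact S.sum_X_mul_sum_mul S.sum_X_mul_metric fun d => S.D a (w d)

/-- The curl of the divergence of a shear is a total divergence against a rotation field, so this
linear term in the evolution of the angular momentum aspect carries no angular momentum. -/
lemma integral_rotField_curl_div (hκ : IsSkew κ) {C : Fin 3 → Fin 3 → A} (hC : S.IsSTT C) :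
    S.integral (∑ b, S.rotField κ b * S.tangentDiv (fun d b =>
      S.covDeriv (S.tangentDiv C) d b - S.covDeriv (S.tangentDiv C) b d) b) = 0 := by
  obtain ⟨h00, h11, h22, h10, h20, h21⟩ := hκ.entries
  rw [hC.tangentDiv_eq, integral_rotField_tangentDiv hκ fun e => by
    simp only [mul_sub, Finset.sum_sub_distrib, sum_X_mul_covDeriv, sum_X_mul_covDeriv', sub_self],
    neg_eq_zero]
  set v : Fin 3 → A := fun d => ∑ e, algebraMap ℝ A (κ e d) * S.div C e
  have hsplit : ∑ e, ∑ d, algebraMap ℝ A (κ e d) *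
        (S.covDeriv (S.div C) d e - S.covDeriv (S.div C) e d) =
      2 • (∑ d, (S.D d (v d) - 2 • (S.X d * v d))) +
        2 • ∑ b, S.rotField κ b * S.tangentDiv C b := by
    simp only [v, hC.tangentDiv_eq, hC.covDeriv_div, rotField, Fin.sum_univ_three, map_add, D_mul,
      D_algebraMap, h00, h11, h22, h10, h20, h21, map_zero, map_neg, nsmul_eq_mul, Nat.cast_ofNat]
    ring
  have hdiv : S.integral (∑ d, (S.D d (v d) - 2 • (S.X d * v d))) = 0 := by
    simp only [map_sum, map_sub, map_nsmul, integral_D]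
    simp only [nsmul_eq_mul, Nat.cast_ofNat, sub_self, Finset.sum_const_zero]
  have hsymm : ∑ e, ∑ d, algebraMap ℝ A (κ e d) * C d e = 0 := by
    simp only [Fin.sum_univ_three, h00, h11, h22, h10, h20, h21, hC.symm 1 0, hC.symm 2 0,
      hC.symm 2 1, map_zero, map_neg]
    ring
  rw [hsplit, map_add, map_nsmul, map_nsmul, hdiv, integral_rotField_tangentDiv hκ hC.tangential,
    hsymm, map_zero, neg_zero, smul_zero, add_zero]

/-- The rate of change of the part of the angular momentum that is local in the data: `n` is the
time derivative of the angular momentum aspect and `N` the news. -/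
lemma integral_angularMomentum_flux (hκ : IsSkew κ) {C N : Fin 3 → Fin 3 → A} (hC : S.IsSTT C)
    (hN : S.IsSTT N) (m h : A) {n : Fin 3 → A}
    (hn : ∀ a, 4 * n a = 4 * S.D a m
      - S.tangentDiv (fun d b =>
          S.covDeriv (S.tangentDiv C) d b - S.covDeriv (S.tangentDiv C) b d) a
      + S.D a h - S.tangentDiv (fun b e => ∑ d, C b d * N d e) a
      + 2 * ∑ b, C a b * S.tangentDiv N b) :
    S.integral (∑ a, S.rotField κ a *
        (4 * n a - ∑ d, N a d * S.tangentDiv C d - ∑ d, C a d * S.tangentDiv N d)) =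
      -S.integral (∑ a, ∑ b, N a b * S.lieRot κ C a b) := by
  have hsplit : ∑ a, S.rotField κ a *
        (4 * n a - ∑ d, N a d * S.tangentDiv C d - ∑ d, C a d * S.tangentDiv N d) =
      4 • S.rot κ m - ∑ b, S.rotField κ b * S.tangentDiv (fun d b =>
          S.covDeriv (S.tangentDiv C) d b - S.covDeriv (S.tangentDiv C) b d) b
      + S.rot κ h - ∑ a, S.rotField κ a * S.tangentDiv (fun b e => ∑ d, C b d * N d e) a
      + ∑ a, ∑ b, C a b * S.rotField κ b * S.div N a
      - ∑ a, ∑ b, N a b * S.rotField κ b * S.div C a := by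
    simp only [hn, hC.tangentDiv_eq, hN.tangentDiv_eq, rot_apply, Fin.sum_univ_three,
      hC.symm 1 0, hC.symm 2 0, hC.symm 2 1, hN.symm 1 0, hN.symm 2 0, hN.symm 2 1,
      nsmul_eq_mul, Nat.cast_ofNat]
    ring
  have hquad := integral_rotField_tangentDiv hκ (T := fun b e => ∑ d, C b d * N d e) fun e =>
    S.sum_X_mul_sum_mul hC.tangential fun d => N d e
  have hskew : ∑ e, ∑ d, algebraMap ℝ A (κ e d) * ∑ f, C d f * N f e =
      -∑ a, ∑ b, ∑ d, algebraMap ℝ A (κ d a) * N a b * C d b := by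
    obtain ⟨h00, h11, h22, h10, h20, h21⟩ := hκ.entries
    simp only [Fin.sum_univ_three, h00, h11, h22, h10, h20, h21, hC.symm 1 0, hC.symm 2 0,
      hC.symm 2 1, hN.symm 1 0, hN.symm 2 0, hN.symm 2 1, map_zero, map_neg]
    ring
  rw [hskew, map_neg] at hquad
  rw [hsplit, integral_sum_mul_lieRot hκ hN hC]
  simp only [map_add, map_sub, map_nsmul, integral_rot hκ, integral_rotField_curl_div hκ hC, hquad]
  ring

end SphereCalculus

/-! ### The algebra of smooth functions on the sphere -/

/-- The algebra of smooth functions on the sphere. -/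
abbrev SmoothFn : Type := ContMDiffMap (𝓡 2) 𝓘(ℝ, ℝ) S2 ℝ ∞

namespace SmoothFn

/-- A smooth function as an element of the algebra. -/
def mk {F : S2 → ℝ} (hF : SmoothS2 F) : SmoothFn := ⟨F, hF⟩

lemma smoothS2 (F : SmoothFn) : SmoothS2 F := F.contMDiff

@[simp] lemma mk_apply {F : S2 → ℝ} (hF : SmoothS2 F) (x : S2) : mk hF x = F x := rfl
@[simp] lemma add_apply (F G : SmoothFn) (x : S2) : (F + G) x = F x + G x := rfl
@[simp] lemma sub_apply (F G : SmoothFn) (x : S2) : (F - G) x = F x - G x := rfl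
@[simp] lemma neg_apply (F : SmoothFn) (x : S2) : (-F) x = -F x := rfl
@[simp] lemma mul_apply (F G : SmoothFn) (x : S2) : (F * G) x = F x * G x := rfl
@[simp] lemma smul_apply (r : ℝ) (F : SmoothFn) (x : S2) : (r • F) x = r * F x := rfl
@[simp] lemma algebraMap_apply (r : ℝ) (x : S2) : algebraMap ℝ SmoothFn r x = r := rfl

@[simp] lemma ofNat_apply (n : ℕ) [n.AtLeastTwo] (x : S2) :
    (ofNat(n) : SmoothFn) x = ofNat(n) := by
  rw [← map_ofNat (algebraMap ℝ SmoothFn) n, algebraMap_apply]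

@[simp] lemma sum_apply {ι : Type*} (s : Finset ι) (F : ι → SmoothFn) (x : S2) :
    (∑ i ∈ s, F i) x = ∑ i ∈ s, F i x :=
  map_sum (Pi.evalRingHom (fun _ : S2 => ℝ) x |>.comp ContMDiffMap.coeFnRingHom) F s

lemma integrable (F : SmoothFn) : Integrable F areaS2 :=
  SmoothS2.integrable F.smoothS2

/-- A component of the tangential gradient. -/
def grad (a : Fin 3) : Derivation ℝ SmoothFn SmoothFn :=
  Derivation.mk'
    { toFun := fun F => mk (F.smoothS2.smoothS2_grad0 a)
      map_add' := fun F G => ContMDiffMap.ext fun x => grad0_add F.smoothS2 G.smoothS2 x a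
      map_smul' := fun r F => ContMDiffMap.ext fun x => by
        have hmul := grad0_mul (F := fun _ => r) contMDiff_const F.smoothS2 x a
        rw [grad0_const, mul_zero, add_zero] at hmul
        exact hmul }
    (fun F G => ContMDiffMap.ext fun x => grad0_mul F.smoothS2 G.smoothS2 x a)

@[simp] lemma grad_apply (a : Fin 3) (F : SmoothFn) (x : S2) : grad a F x = grad0 F x a := rfl

/-- The integral over the sphere. -/
def integral : SmoothFn →ₗ[ℝ] ℝ where
  toFun F := integralS2 F
  map_add' F G := integral_add F.integrable G.integrable
  map_smul' r _ := integral_const_mul r _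

/-- Smooth functions as continuous functions. -/
def toContinuousMap : SmoothFn →ₐ[ℝ] C(S2, ℝ) where
  toFun F := ⟨F, F.smoothS2.continuous⟩
  map_one' := rfl
  map_mul' _ _ := rfl
  map_zero' := rfl
  map_add' _ _ := rfl
  commutes' _ := rfl

@[simp] lemma toContinuousMap_apply (F : SmoothFn) (x : S2) : F.toContinuousMap x = F x := rfl

/-- Smooth functions as elements of `L²`. -/
def toL2 : SmoothFn →ₗ[ℝ] Lp ℝ 2 areaS2 :=
  (ContinuousMap.toLp (E := ℝ) 2 areaS2 ℝ).toLinearMap ∘ₗ toContinuousMap.toLinearMap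

end SmoothFn

/-- The calculus of smooth functions on the round sphere. -/
def sphereCalc : SphereCalculus SmoothFn where
  X a := .mk (smoothS2_coordX a)
  D := SmoothFn.grad
  integral := SmoothFn.integral
  sum_X_mul_X := ContMDiffMap.ext fun x => by simpa using sum_coordX_sq x
  D_X_eq_ite_sub a b := ContMDiffMap.ext fun x => by
    have hgrad := grad0_coordX x a b
    split_ifs at hgrad ⊢ <;> exact hgrad
  sum_X_mul_D F := ContMDiffMap.ext fun x => by
    simpa [coordX] using sum_coordX_mul_grad0 F.smoothS2 x
  D_comm a b F := ContMDiffMap.ext fun x => grad0_grad0_comm F.smoothS2 x a b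
  integral_D a F := integralS2_grad0 F.smoothS2 a
  integral_mul_self_nonneg F := integral_nonneg fun x => mul_self_nonneg (F x)

@[simp] lemma sphereCalc_X (a : Fin 3) (x : S2) : sphereCalc.X a x = coordX a x := rfl

@[simp] lemma sphereCalc_D (a : Fin 3) (F : SmoothFn) (x : S2) :
    sphereCalc.D a F x = grad0 F x a := rfl

lemma sphereCalc_integral (F : SmoothFn) : sphereCalc.integral F = integralS2 F := rfl

lemma SmoothFn.inner_toL2 (F G : SmoothFn) :
    inner ℝ F.toL2 G.toL2 = sphereCalc.integral (F * G) := by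
  refine (ContinuousMap.inner_toLp (𝕜 := ℝ) areaS2 F.toContinuousMap G.toContinuousMap).trans
    (integral_congr_ae (Eventually.of_forall fun x => ?_))
  simp [mul_comm]

lemma SmoothFn.norm_sq_toL2 (F : SmoothFn) : ‖F.toL2‖ ^ 2 = sphereCalc.integral (F * F) := by
  rw [← SmoothFn.inner_toL2, real_inner_self_eq_norm_sq]

@[simp] lemma sphereCalc_metric (a b : Fin 3) (x : S2) : sphereCalc.metric a b x = sigma x a b := by
  rw [SphereCalculus.metric, sigma]
  split_ifs <;> rfl

@[simp] lemma sphereCalc_volForm (a b : Fin 3) (x : S2) :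
    sphereCalc.volForm a b x = epsS2 x a b := by
  simp [SphereCalculus.volForm, epsS2, coordX]

lemma grad1_eq_covDeriv (w : Fin 3 → SmoothFn) (x : S2) (a b : Fin 3) :
    grad1 (fun y d => w d y) x a b = sphereCalc.covDeriv w a b x := by
  simp [grad1, SphereCalculus.covDeriv]

namespace SphereCalculus

variable {A : Type*} [CommRing A] [Algebra ℝ A] (S : SphereCalculus A)

lemma covDeriv_D (F : A) (a b : Fin 3) : S.covDeriv (fun d => S.D d F) a b = S.hessian F a b := by
  rw [covDeriv, sum_metric_mul, S.sum_X_mul_D_of_tangential (S.sum_X_mul_D F), hessian]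
  ring

lemma sum_covDeriv_diag (w : Fin 3 → A) : ∑ a, S.covDeriv w a a = ∑ a, S.D a (w a) := by
  simp only [covDeriv]
  rw [Finset.sum_comm]
  refine Finset.sum_congr rfl fun d _ => ?_
  simp only [S.metric_symm _ d, sum_metric_mul_D]

lemma tangentDiv_eq_sum (T : Fin 3 → Fin 3 → A) (b : Fin 3) :
    S.tangentDiv T b = ∑ a, ∑ d, ∑ e, S.metric a d * S.metric b e * S.D a (T d e) := by
  have hdiv : ∀ e, S.div T e = ∑ a, ∑ d, S.metric a d * S.D a (T d e) := by
    intro e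
    rw [Finset.sum_comm]
    refine Finset.sum_congr rfl fun d _ => ?_
    simp only [S.metric_symm _ d, sum_metric_mul_D]
  simp only [tangentDiv, hdiv, Fin.sum_univ_three]; ring

end SphereCalculus

lemma hess_eq_hessian (F : SmoothFn) (x : S2) (a b : Fin 3) :
    hess F x a b = sphereCalc.hessian F a b x := by
  rw [← sphereCalc.covDeriv_D, ← grad1_eq_covDeriv]; rfl

lemma lap_eq_laplacian (F : SmoothFn) (x : S2) : lap F x = sphereCalc.laplacian F x := by
  rw [sphereCalc.laplacian_apply, ← sphereCalc.sum_covDeriv_diag]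
  simp only [lap, hess_eq_hessian, ← sphereCalc.covDeriv_D, SmoothFn.sum_apply]

lemma div2_eq_tangentDiv (T : Fin 3 → Fin 3 → SmoothFn) (x : S2) (b : Fin 3) :
    div2 (fun y d e => T d e y) x b = sphereCalc.tangentDiv T b x := by
  rw [sphereCalc.tangentDiv_eq_sum]
  simp [div2, grad2]

lemma div1_eq_sum_D (w : Fin 3 → SmoothFn) (x : S2) :
    div1 (fun y d => w d y) x = (∑ a, sphereCalc.D a (w a)) x := by
  simp only [div1, grad1_eq_covDeriv, ← sphereCalc.sum_covDeriv_diag, SmoothFn.sum_apply]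

/-! ### Modes and the elliptic estimate -/

namespace SphereCalculus

variable {A : Type*} [CommRing A] [Algebra ℝ A] {S : SphereCalculus A}

variable (S) in
/-- The functions of mode `ℓ`. -/
def Mode (ℓ : ℕ) : Submodule ℝ A := LinearMap.ker (S.laplacian + ((ℓ : ℝ) * (ℓ + 1)) • .id)

lemma mem_mode {ℓ : ℕ} {F : A} : F ∈ S.Mode ℓ ↔ S.laplacian F = -(((ℓ : ℝ) * (ℓ + 1)) • F) := by
  rw [Mode, LinearMap.mem_ker, LinearMap.add_apply, add_eq_zero_iff_eq_neg]
  rfl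

lemma one_mem_mode_zero : (1 : A) ∈ S.Mode 0 := by
  simp [mem_mode, laplacian_apply]

/-- The ladder operators of the spherical harmonics: `s = ℓ` lowers the mode `ℓ` by one, and
`s = -(ℓ + 1)` raises it by one. -/
lemma laplacian_D_add_smul_X_mul {ℓ : ℕ} {F : A} (hF : F ∈ S.Mode ℓ) (j : Fin 3) {s : ℝ}
    (hs : s * s + s = ℓ * (ℓ + 1)) :
    S.laplacian (S.D j F + s • (S.X j * F)) =
      -((s * s - s) • (S.D j F + s • (S.X j * F))) := by
  rw [mem_mode, ← hs] at hF
  have hX := S.laplacian_mul (S.X j) F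
  simp only [S.D_X, S.metric_symm _ j, S.sum_metric_mul_D, S.laplacian_X, hF] at hX
  rw [map_add, map_smul, S.laplacian_D, hX, hF, map_neg, (S.D j).map_smul]
  simp only [Algebra.smul_def, map_sub, map_mul, map_add]
  ring

lemma X_mul_mem_iSup_mode {F : A} (hF : F ∈ ⨆ n, S.Mode n) (j : Fin 3) :
    S.X j * F ∈ ⨆ n, S.Mode n := by
  suffices hle : ⨆ n, S.Mode n ≤ (⨆ n, S.Mode n).comap (LinearMap.mulLeft ℝ (S.X j)) from hle hF
  refine iSup_le fun ℓ G hG => ?_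
  have hlower : S.D j G + (ℓ : ℝ) • (S.X j * G) ∈ S.Mode (ℓ - 1) := by
    rw [mem_mode, laplacian_D_add_smul_X_mul hG j (by ring)]
    rcases ℓ with _ | n
    · simp
    · congr 2; push_cast [Nat.add_sub_cancel]; ring
  have hraise : S.D j G + (-(ℓ + 1) : ℝ) • (S.X j * G) ∈ S.Mode (ℓ + 1) := by
    rw [mem_mode, laplacian_D_add_smul_X_mul hG j (by ring)]
    congr 2; push_cast; ring
  have hdiff : S.X j * G = (1 / (2 * ℓ + 1) : ℝ) •
      ((S.D j G + (ℓ : ℝ) • (S.X j * G)) - (S.D j G + (-(ℓ + 1) : ℝ) • (S.X j * G))) := by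
    have hne : (2 * ℓ + 1 : ℝ) ≠ 0 := by positivity
    rw [add_sub_add_left_eq_sub, ← sub_smul, smul_smul]
    have hcoeff : (1 / (2 * ℓ + 1) : ℝ) * (ℓ - -(ℓ + 1)) = 1 := by field_simp; ring
    rw [hcoeff, one_smul]
  rw [Submodule.mem_comap, LinearMap.mulLeft_apply, hdiff]
  exact Submodule.smul_mem _ _ (Submodule.sub_mem _ (Submodule.mem_iSup_of_mem _ hlower)
    (Submodule.mem_iSup_of_mem _ hraise))

lemma mem_iSup_mode_of_mem_adjoin {F : A} (hF : F ∈ Algebra.adjoin ℝ (Set.range S.X)) :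
    F ∈ ⨆ n, S.Mode n := by
  suffices hmul : ∀ G ∈ ⨆ n, S.Mode n, F * G ∈ ⨆ n, S.Mode n by
    simpa using hmul 1 (Submodule.mem_iSup_of_mem 0 one_mem_mode_zero)
  induction hF using Algebra.adjoin_induction with
  | mem F hF =>
    obtain ⟨j, rfl⟩ := hF
    exact fun G hG => X_mul_mem_iSup_mode hG j
  | algebraMap r =>
    intro G hG
    rw [← Algebra.smul_def]
    exact Submodule.smul_mem _ r hG
  | add F₁ F₂ _ _ ih₁ ih₂ =>
    intro G hG
    rw [add_mul]
    exact Submodule.add_mem _ (ih₁ G hG) (ih₂ G hG)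
  | mul F₁ F₂ _ _ ih₁ ih₂ =>
    intro G hG
    rw [mul_assoc]
    exact ih₁ _ (ih₂ G hG)

lemma integral_laplacian_mul (F G : A) :
    S.integral (S.laplacian F * G) = S.integral (F * S.laplacian G) := by
  have htang : ∑ a, S.X a * (S.D a F * G - F * S.D a G) = 0 := by
    have hF := S.sum_X_mul_D F
    have hG := S.sum_X_mul_D G
    simp only [Fin.sum_univ_three] at hF hG ⊢
    linear_combination G * hF - F * hG
  have hgreen : ∑ a, S.D a (S.D a F * G - F * S.D a G) =
      S.laplacian F * G - F * S.laplacian G := by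
    simp only [laplacian_apply, map_sub, D_mul, Fin.sum_univ_three]; ring
  have hzero := S.integral_sum_D _ htang
  rwa [hgreen, map_sub, sub_eq_zero] at hzero

lemma integral_biLaplacian_mul (F G : A) :
    S.integral (S.biLaplacian F * G) = S.integral (F * S.biLaplacian G) := by
  simp only [biLaplacian_apply, two_mul, add_mul, mul_add, map_add, integral_laplacian_mul]

lemma integral_mul_eq_zero_of_mem_mode {k ℓ : ℕ} (hkl : k ≠ ℓ) {F G : A} (hF : F ∈ S.Mode k)
    (hG : G ∈ S.Mode ℓ) : S.integral (F * G) = 0 := by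
  rw [mem_mode] at hF hG
  have hsymm := integral_laplacian_mul (S := S) F G
  rw [hF, hG, neg_mul, mul_neg, smul_mul_assoc, mul_smul_comm, map_neg, map_neg, map_smul, map_smul,
    smul_eq_mul, smul_eq_mul] at hsymm
  have hprod : ((k : ℝ) - ℓ) * (k + ℓ + 1) * S.integral (F * G) = 0 := by linarith
  have hkl' : ((k : ℝ) - ℓ) ≠ 0 := sub_ne_zero.2 (by exact_mod_cast hkl)
  have hpos : (k + ℓ + 1 : ℝ) ≠ 0 := by positivity
  simpa [hkl', hpos] using hprod

/-- The eigenvalue of `Δ(Δ + 2)` on the functions of mode `ℓ`. -/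
def biLaplacianEigenvalue (ℓ : ℕ) : ℝ := (ℓ * (ℓ + 1)) * (ℓ * (ℓ + 1) - 2)

lemma biLaplacianEigenvalue_of_lt_two {ℓ : ℕ} (hℓ : ℓ < 2) : biLaplacianEigenvalue ℓ = 0 := by
  interval_cases ℓ <;> norm_num [biLaplacianEigenvalue]

lemma two_le_biLaplacianEigenvalue {ℓ : ℕ} (hℓ : 2 ≤ ℓ) : 2 ≤ biLaplacianEigenvalue ℓ := by
  have hℓ' : (2 : ℝ) ≤ ℓ := by exact_mod_cast hℓ
  rw [biLaplacianEigenvalue]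
  nlinarith [mul_nonneg (sub_nonneg.2 hℓ') (by linarith : (0 : ℝ) ≤ ℓ)]

lemma two_mul_biLaplacianEigenvalue_le_sq (ℓ : ℕ) :
    2 * biLaplacianEigenvalue ℓ ≤ biLaplacianEigenvalue ℓ ^ 2 := by
  rcases lt_or_ge ℓ 2 with hℓ | hℓ
  · simp [biLaplacianEigenvalue_of_lt_two hℓ]
  · nlinarith [two_le_biLaplacianEigenvalue hℓ]

lemma biLaplacian_of_mem_mode {ℓ : ℕ} {F : A} (hF : F ∈ S.Mode ℓ) :
    S.biLaplacian F = biLaplacianEigenvalue ℓ • F := by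
  rw [mem_mode] at hF
  rw [biLaplacian_apply, hF, map_neg, map_smul, hF, biLaplacianEigenvalue]
  simp only [Algebra.smul_def, map_sub, map_mul, map_ofNat]
  ring

lemma integral_sum_mode_mul_sum_smul {s : Finset ℕ} {q : ℕ → A} (hq : ∀ ℓ, q ℓ ∈ S.Mode ℓ)
    (v w : ℕ → ℝ) :
    S.integral ((∑ ℓ ∈ s, v ℓ • q ℓ) * ∑ ℓ ∈ s, w ℓ • q ℓ) =
      ∑ ℓ ∈ s, v ℓ * w ℓ * S.integral (q ℓ * q ℓ) := by
  rw [Finset.sum_mul, map_sum]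
  refine Finset.sum_congr rfl fun ℓ hℓ => ?_
  rw [Finset.mul_sum, map_sum, Finset.sum_eq_single_of_mem ℓ hℓ]
  · rw [smul_mul_smul_comm, map_smul, smul_eq_mul]
  · intro k _ hk
    rw [smul_mul_smul_comm, map_smul, integral_mul_eq_zero_of_mem_mode hk.symm (hq ℓ) (hq k),
      smul_zero]

/-- The spectral gap of `Δ(Δ + 2)`: its nonzero eigenvalues are at least `2`. -/
lemma two_mul_integral_mul_biLaplacian_le {F : A} (hF : F ∈ ⨆ n, S.Mode n) :
    2 * S.integral (F * S.biLaplacian F) ≤ S.integral (S.biLaplacian F * S.biLaplacian F) := by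
  obtain ⟨q, hq, rfl⟩ := (Submodule.mem_iSup_iff_exists_finsupp S.Mode F).1 hF
  have hsum : (q.sum fun _ G => G) = ∑ ℓ ∈ q.support, (1 : ℝ) • q ℓ := by simp [Finsupp.sum]
  have hbi : S.biLaplacian (q.sum fun _ G => G) =
      ∑ ℓ ∈ q.support, biLaplacianEigenvalue ℓ • q ℓ := by
    simp only [Finsupp.sum, map_sum, biLaplacian_of_mem_mode (hq _)]
  rw [hbi, hsum, integral_sum_mode_mul_sum_smul hq (fun _ => 1), integral_sum_mode_mul_sum_smul hq,
    Finset.mul_sum]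
  refine Finset.sum_le_sum fun ℓ _ => ?_
  nlinarith [two_mul_biLaplacianEigenvalue_le_sq ℓ, S.integral_mul_self_nonneg (q ℓ)]

lemma iSup_mode_le : ⨆ n, S.Mode n ≤
    (S.Mode 0 ⊔ S.Mode 1) ⊔ (⨆ n, S.Mode n).map S.biLaplacian := by
  refine iSup_le fun ℓ F hF => ?_
  rcases lt_or_ge ℓ 2 with hℓ | hℓ
  · refine Submodule.mem_sup_left ?_
    interval_cases ℓ
    · exact Submodule.mem_sup_left hF
    · exact Submodule.mem_sup_right hF
  · have hne : biLaplacianEigenvalue ℓ ≠ 0 := by linarith [two_le_biLaplacianEigenvalue hℓ]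
    refine Submodule.mem_sup_right ⟨(biLaplacianEigenvalue ℓ)⁻¹ • F,
      Submodule.smul_mem _ _ (Submodule.mem_iSup_of_mem ℓ hF), ?_⟩
    rw [map_smul, biLaplacian_of_mem_mode hF, inv_smul_smul₀ hne]

lemma sq_integral_sum_mul_le {ι : Type*} [Fintype ι] (F G : ι → A) :
    S.integral (∑ i, F i * G i) ^ 2 ≤
      S.integral (∑ i, F i * F i) * S.integral (∑ i, G i * G i) := by
  have hexpand : ∀ t : ℝ, S.integral (∑ i, (F i + t • G i) * (F i + t • G i)) =
      S.integral (∑ i, G i * G i) * (t * t) + (2 * S.integral (∑ i, F i * G i)) * t +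
        S.integral (∑ i, F i * F i) := by
    intro t
    have hsq : ∀ i, (F i + t • G i) * (F i + t • G i) =
        (t * t) • (G i * G i) + (2 * t) • (F i * G i) + F i * F i := by
      intro i; simp only [Algebra.smul_def, map_mul, map_ofNat]; ring
    simp only [hsq, Finset.sum_add_distrib, ← Finset.smul_sum, map_add, map_smul, smul_eq_mul]
    ring
  have hdiscrim := discrim_le_zero (K := ℝ) fun t => by
    rw [← hexpand t, map_sum]
    exact Finset.sum_nonneg fun i _ => S.integral_mul_self_nonneg _
  rw [discrim] at hdiscrim
  nlinarith

lemma integral_sum_mul_self_nonneg (T : Fin 3 → Fin 3 → A) :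
    0 ≤ S.integral (∑ a, ∑ b, T a b * T a b) := by
  simp only [map_sum]
  exact Finset.sum_nonneg fun a _ => Finset.sum_nonneg fun b _ => S.integral_mul_self_nonneg _

lemma sq_integral_sum_mul_electricShear_le {F : A} (hF : F ∈ ⨆ n, S.Mode n)
    (T : Fin 3 → Fin 3 → A) :
    S.integral (∑ a, ∑ b, T a b * S.electricShear F a b) ^ 2 ≤
      S.integral (∑ a, ∑ b, T a b * T a b) *
        S.integral (S.biLaplacian F * S.biLaplacian F) := by
  have hcs := S.sq_integral_sum_mul_le (fun i : Fin 3 × Fin 3 => T i.1 i.2)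
    (fun i => S.electricShear F i.1 i.2)
  simp only [Fintype.sum_prod_type] at hcs
  rw [(isSTT_electricShear F).integral_sum_mul_electricShear, divDiv_electricShear,
    mul_comm (S.biLaplacian F)] at hcs
  exact hcs.trans (mul_le_mul_of_nonneg_left (two_mul_integral_mul_biLaplacian_le hF)
    (integral_sum_mul_self_nonneg T))

/-- The elliptic estimate for `Δ(Δ + 2) c = 2 div div T`, tested on a finite sum of modes. -/
lemma sq_integral_mul_le {c : A} {T : Fin 3 → Fin 3 → A} (hT : S.IsSTT T)
    (hcT : S.biLaplacian c = 2 * S.divDiv T)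
    (hc : ∀ ℓ < 2, ∀ F ∈ S.Mode ℓ, S.integral (c * F) = 0) {p : A} (hp : p ∈ ⨆ n, S.Mode n) :
    S.integral (c * p) ^ 2 ≤ S.integral (∑ a, ∑ b, T a b * T a b) * S.integral (p * p) := by
  obtain ⟨r, hr, _, ⟨ψ, hψ, rfl⟩, rfl⟩ := Submodule.mem_sup.1 (iSup_mode_le hp)
  obtain ⟨r₀, hr₀, r₁, hr₁, rfl⟩ := Submodule.mem_sup.1 hr
  have hshear : S.integral (c * (r₀ + r₁ + S.biLaplacian ψ)) =
      S.integral (∑ a, ∑ b, T a b * S.electricShear ψ a b) := by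
    rw [mul_add, mul_add, map_add, map_add, hc 0 two_pos r₀ hr₀, hc 1 one_lt_two r₁ hr₁,
      ← integral_biLaplacian_mul, hcT, hT.integral_sum_mul_electricShear, mul_assoc, two_mul,
      map_add]
    ring
  have hkernel : S.biLaplacian (r₀ + r₁) = 0 := by
    rw [map_add, biLaplacian_of_mem_mode hr₀, biLaplacian_of_mem_mode hr₁,
      biLaplacianEigenvalue_of_lt_two two_pos, biLaplacianEigenvalue_of_lt_two one_lt_two]
    simp
  have hpythagoras : S.integral ((r₀ + r₁ + S.biLaplacian ψ) * (r₀ + r₁ + S.biLaplacian ψ)) =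
      S.integral ((r₀ + r₁) * (r₀ + r₁)) + S.integral (S.biLaplacian ψ * S.biLaplacian ψ) := by
    have horth : S.integral ((r₀ + r₁) * S.biLaplacian ψ) = 0 := by
      rw [← integral_biLaplacian_mul, hkernel, zero_mul, map_zero]
    rw [add_mul_self_eq, mul_assoc, two_mul, map_add, map_add, map_add, horth]
    ring
  rw [hshear]
  refine (sq_integral_sum_mul_electricShear_le hψ T).trans
    (mul_le_mul_of_nonneg_left ?_ (integral_sum_mul_self_nonneg T))
  linarith [S.integral_mul_self_nonneg (r₀ + r₁)]

end SphereCalculus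

lemma dense_toContinuousMap_iSup_mode :
    Dense (SmoothFn.toContinuousMap '' (⨆ n, sphereCalc.Mode n : Submodule ℝ SmoothFn)) := by
  set polynomials := (Algebra.adjoin ℝ (Set.range sphereCalc.X)).map SmoothFn.toContinuousMap
  have hsep : polynomials.SeparatesPoints := by
    intro x y hxy
    obtain ⟨a, ha⟩ : ∃ a, coordX a x ≠ coordX a y := by
      by_contra! hcoord
      exact hxy (Subtype.ext (PiLp.ext hcoord))
    exact ⟨_, ⟨_, ⟨sphereCalc.X a, Algebra.subset_adjoin ⟨a, rfl⟩, rfl⟩, rfl⟩, ha⟩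
  have hdense : Dense (polynomials : Set C(S2, ℝ)) := by
    rw [dense_iff_closure_eq, ← Subalgebra.topologicalClosure_coe,
      ContinuousMap.subalgebra_topologicalClosure_eq_top_of_separatesPoints _ hsep]
    rfl
  exact hdense.mono (Set.image_mono fun F hF => SphereCalculus.mem_iSup_mode_of_mem_adjoin hF)

lemma integral_mul_self_le_of_biLaplacian_eq {c : SmoothFn} {T : Fin 3 → Fin 3 → SmoothFn}
    (hT : sphereCalc.IsSTT T) (hcT : sphereCalc.biLaplacian c = 2 * sphereCalc.divDiv T)
    (hc : ∀ ℓ < 2, ∀ F ∈ sphereCalc.Mode ℓ, sphereCalc.integral (c * F) = 0) :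
    sphereCalc.integral (c * c) ≤ sphereCalc.integral (∑ a, ∑ b, T a b * T a b) := by
  set B := sphereCalc.integral (∑ a, ∑ b, T a b * T a b)
  set toL2 : C(S2, ℝ) →L[ℝ] Lp ℝ 2 areaS2 := ContinuousMap.toLp 2 areaS2 ℝ
  have hclosed : IsClosed {h | inner ℝ c.toL2 (toL2 h) ^ 2 ≤ B * ‖toL2 h‖ ^ 2} :=
    isClosed_le (by fun_prop) (by fun_prop)
  have hmodes : SmoothFn.toContinuousMap '' (⨆ n, sphereCalc.Mode n : Submodule ℝ SmoothFn) ⊆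
      {h | inner ℝ c.toL2 (toL2 h) ^ 2 ≤ B * ‖toL2 h‖ ^ 2} := by
    rintro _ ⟨p, hp, rfl⟩
    change inner ℝ c.toL2 p.toL2 ^ 2 ≤ B * ‖p.toL2‖ ^ 2
    rw [SmoothFn.inner_toL2, SmoothFn.norm_sq_toL2]
    exact SphereCalculus.sq_integral_mul_le hT hcT hc hp
  have hself : inner ℝ c.toL2 c.toL2 ^ 2 ≤ B * ‖c.toL2‖ ^ 2 :=
    hclosed.closure_subset_iff.2 hmodes (dense_toContinuousMap_iSup_mode c.toContinuousMap)
  rw [SmoothFn.inner_toL2, SmoothFn.norm_sq_toL2, sq] at hself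
  rcases (sphereCalc.integral_mul_self_nonneg c).eq_or_lt with hzero | hpos
  · rw [← hzero]; exact SphereCalculus.integral_sum_mul_self_nonneg T
  · exact le_of_mul_le_mul_right hself hpos

/-! ### Families of functions depending on retarded time -/

/-- The family of smooth functions `F'` is the derivative of the family `F` in retarded time, where
both depend smoothly on retarded time and the point of the sphere. -/
structure HasTimeDeriv (F F' : ℝ → SmoothFn) : Prop where
  smooth : SmoothScri fun u x => F u x
  smooth' : SmoothScri fun u x => F' u x
  hasDerivAt : ∀ u x, HasDerivAt (fun s => F s x) (F' u x) u

namespace HasTimeDeriv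

variable {F F' G G' : ℝ → SmoothFn}

lemma of_smoothScri {F : ℝ → S2 → ℝ} (hF : SmoothScri F) :
    HasTimeDeriv (fun u => .mk (hF.smoothS2 u))
      (fun u => .mk (hF.smoothScri_timeDeriv.smoothS2 u)) :=
  ⟨hF, hF.smoothScri_timeDeriv, hF.hasDerivAt⟩

lemma timeDeriv_eq (hF : HasTimeDeriv F F') (u : ℝ) (x : S2) :
    timeDeriv (fun u x => F u x) u x = F' u x :=
  (hF.hasDerivAt u x).deriv

lemma unique (hF : HasTimeDeriv F F') (hG : HasTimeDeriv F G') : F' = G' :=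
  funext fun u => ContMDiffMap.ext fun x => (hF.hasDerivAt u x).unique (hG.hasDerivAt u x)

lemma const (F : SmoothFn) : HasTimeDeriv (fun _ => F) (fun _ => 0) :=
  ⟨F.smoothS2.smoothScri_const, contMDiff_const, fun u x => hasDerivAt_const u (F x)⟩

lemma add (hF : HasTimeDeriv F F') (hG : HasTimeDeriv G G') :
    HasTimeDeriv (fun u => F u + G u) (fun u => F' u + G' u) :=
  ⟨hF.smooth.add hG.smooth, hF.smooth'.add hG.smooth',
    fun u x => (hF.hasDerivAt u x).add (hG.hasDerivAt u x)⟩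

lemma mul (hF : HasTimeDeriv F F') (hG : HasTimeDeriv G G') :
    HasTimeDeriv (fun u => F u * G u) (fun u => F' u * G u + F u * G' u) :=
  ⟨hF.smooth.mul hG.smooth, (hF.smooth'.mul hG.smooth).add (hF.smooth.mul hG.smooth'),
    fun u x => (hF.hasDerivAt u x).mul (hG.hasDerivAt u x)⟩

lemma const_mul (H : SmoothFn) (hF : HasTimeDeriv F F') :
    HasTimeDeriv (fun u => H * F u) (fun u => H * F' u) := by
  simpa using (const H).mul hF

lemma const_smul (r : ℝ) (hF : HasTimeDeriv F F') :
    HasTimeDeriv (fun u => r • F u) (fun u => r • F' u) := by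
  simp only [Algebra.smul_def]; exact hF.const_mul _

lemma sub (hF : HasTimeDeriv F F') (hG : HasTimeDeriv G G') :
    HasTimeDeriv (fun u => F u - G u) (fun u => F' u - G' u) := by
  simpa [sub_eq_add_neg] using hF.add (hG.const_smul (-1))

lemma sum {ι : Type*} {s : Finset ι} {F F' : ι → ℝ → SmoothFn}
    (h : ∀ i ∈ s, HasTimeDeriv (F i) (F' i)) :
    HasTimeDeriv (fun u => ∑ i ∈ s, F i u) (fun u => ∑ i ∈ s, F' i u) := by
  classical
  induction s using Finset.induction_on with
  | empty => simpa using const 0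
  | insert i s hi ih =>
    simp only [Finset.sum_insert hi]
    exact (h i (Finset.mem_insert_self i s)).add (ih fun j hj => h j (Finset.mem_insert_of_mem hj))

lemma D (hF : HasTimeDeriv F F') (a : Fin 3) :
    HasTimeDeriv (fun u => sphereCalc.D a (F u)) (fun u => sphereCalc.D a (F' u)) := by
  have hcomm (u : ℝ) (x : S2) : timeDeriv (fun s y => grad0 (F s) y a) u x = grad0 (F' u) x a := by
    rw [hF.smooth.timeDeriv_grad0, funext (hF.timeDeriv_eq u)]
  refine ⟨hF.smooth.smoothScri_grad0 a, hF.smooth'.smoothScri_grad0 a, fun u x => ?_⟩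
  have hderiv := (hF.smooth.smoothScri_grad0 a).hasDerivAt u x
  rwa [hcomm] at hderiv

lemma rot (hF : HasTimeDeriv F F') (κ : Fin 3 → Fin 3 → ℝ) :
    HasTimeDeriv (fun u => sphereCalc.rot κ (F u)) (fun u => sphereCalc.rot κ (F' u)) := by
  simp only [SphereCalculus.rot_apply]
  exact sum fun a _ => (hF.D a).const_mul _

lemma continuous (hF : HasTimeDeriv F F') : Continuous fun p : ℝ × S2 => F p.1 p.2 :=
  ContMDiff.continuous hF.smooth

lemma continuous' (hF : HasTimeDeriv F F') : Continuous fun p : ℝ × S2 => F' p.1 p.2 :=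
  ContMDiff.continuous hF.smooth'

section tensor

variable {T T' : Fin 3 → Fin 3 → ℝ → SmoothFn}

lemma divDiv (h : ∀ a b, HasTimeDeriv (T a b) (T' a b)) :
    HasTimeDeriv (fun u => sphereCalc.divDiv fun a b => T a b u)
      (fun u => sphereCalc.divDiv fun a b => T' a b u) :=
  sum fun b _ => D (sum fun a _ => (h a b).D a) b

lemma tangentDiv (h : ∀ a b, HasTimeDeriv (T a b) (T' a b)) (b : Fin 3) :
    HasTimeDeriv (fun u => sphereCalc.tangentDiv (fun a b => T a b u) b)
      (fun u => sphereCalc.tangentDiv (fun a b => T' a b u) b) :=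
  sum fun e _ => (sum fun a _ => (h a e).D a).const_mul _

lemma lieRot (h : ∀ a b, HasTimeDeriv (T a b) (T' a b)) (κ : Fin 3 → Fin 3 → ℝ) (a b : Fin 3) :
    HasTimeDeriv (fun u => sphereCalc.lieRot κ (fun a b => T a b u) a b)
      (fun u => sphereCalc.lieRot κ (fun a b => T' a b u) a b) :=
  (((h a b).rot κ).add (sum fun d _ => (h d b).const_mul _)).add
    (sum fun d _ => (h a d).const_mul _)

end tensor

end HasTimeDeriv

lemma hasDerivAt_integralS2 {F F' : ℝ → S2 → ℝ} (hF : ∀ u, Continuous (F u))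
    (hF' : Continuous fun p : ℝ × S2 => F' p.1 p.2)
    (hderiv : ∀ u x, HasDerivAt (fun s => F s x) (F' u x) u) (u : ℝ) :
    HasDerivAt (fun s => integralS2 (F s)) (integralS2 (F' u)) u := by
  obtain ⟨K, hK⟩ := ((isCompact_Icc (a := u - 1) (b := u + 1)).prod
    (isCompact_univ (X := S2))).exists_bound_of_continuousOn hF'.continuousOn
  refine (hasDerivAt_integral_of_dominated_loc_of_deriv_le (μ := areaS2) (bound := fun _ => K)
    (Metric.ball_mem_nhds u zero_lt_one) (.of_forall fun s => (hF s).aestronglyMeasurable)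
    (integrable_areaS2 (hF u)) (hF'.comp (Continuous.prodMk_right u)).aestronglyMeasurable
    (.of_forall fun x s hs => hK (s, x) ⟨?_, Set.mem_univ _⟩) (integrable_const _)
    (.of_forall fun x s _ => hderiv s x)).2
  rw [Metric.mem_ball, Real.dist_eq, abs_lt] at hs
  constructor <;> linarith [hs.1, hs.2]

lemma HasTimeDeriv.integral {F F' : ℝ → SmoothFn} (h : HasTimeDeriv F F') (u : ℝ) :
    HasDerivAt (fun s => sphereCalc.integral (F s)) (sphereCalc.integral (F' u)) u :=
  hasDerivAt_integralS2 (fun u => (F u).smoothS2.continuous) h.continuous' h.hasDerivAt u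

/-! ### Decay in retarded time -/

/-- The weight `(1 + |u|) ^ (-1 - ε)` that measures the decay in retarded time. -/
def weight (ε u : ℝ) : ℝ := (1 + |u|) ^ (-(1 + ε))

/-- The primitive of the weight. -/
def weightIntegral (ε u : ℝ) : ℝ := ∫ s in (0 : ℝ)..u, weight ε s

lemma weight_pos (ε u : ℝ) : 0 < weight ε u := Real.rpow_pos_of_pos (by positivity) _

lemma continuous_weight (ε : ℝ) : Continuous (weight ε) :=
  (continuous_const.add continuous_abs).rpow_const fun u =>
    .inl (show (0 : ℝ) < 1 + |u| by positivity).ne'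

lemma integrable_weight {ε : ℝ} (hε : 0 < ε) : Integrable (weight ε) :=
  integrable_one_add_norm (E := ℝ) (by simpa using hε)

lemma hasDerivAt_weightIntegral (ε u : ℝ) : HasDerivAt (weightIntegral ε) (weight ε u) u :=
  (continuous_weight ε).integral_hasStrictDerivAt 0 u |>.hasDerivAt

lemma monotone_weightIntegral (ε : ℝ) : Monotone (weightIntegral ε) :=
  monotone_of_hasDerivAt_nonneg (hasDerivAt_weightIntegral ε) fun u => (weight_pos ε u).le

lemma weight_le_one {ε : ℝ} (hε : 0 < ε) (u : ℝ) : weight ε u ≤ 1 :=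
  Real.rpow_le_one_of_one_le_of_nonpos (by linarith [abs_nonneg u]) (by linarith)

lemma weight_add_le {ε : ℝ} (hε : 0 < ε) {t M : ℝ} (ht : |t| ≤ M) (u : ℝ) :
    weight ε (u + t) ≤ (1 + M) ^ (1 + ε) * weight ε u := by
  have hM : 0 < 1 + M := by linarith [abs_nonneg t]
  have hu : 0 < 1 + |u| := by positivity
  have hratio : (1 + |u|) / (1 + M) ≤ 1 + |u + t| := by
    rw [div_le_iff₀ hM]
    have htri : |u| ≤ |u + t| + |t| := by simpa using abs_sub (u + t) t
    nlinarith [abs_nonneg (u + t), abs_nonneg t]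
  calc weight ε (u + t) ≤ ((1 + |u|) / (1 + M)) ^ (-(1 + ε)) :=
        Real.rpow_le_rpow_of_nonpos (by positivity) hratio (by linarith)
    _ = (1 + M) ^ (1 + ε) * weight ε u := by
        rw [weight, Real.div_rpow hu.le hM.le, Real.rpow_neg hM.le, div_inv_eq_mul, mul_comm]

lemma abs_rpow_le_weight {ε : ℝ} (hε : 0 < ε) {u : ℝ} (hu : 1 ≤ |u|) :
    |u| ^ (-1 - ε) ≤ 2 ^ (1 + ε) * weight ε u := by
  calc |u| ^ (-1 - ε) = 2 ^ (1 + ε) * (2 * |u|) ^ (-(1 + ε)) := by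
        rw [Real.mul_rpow (by norm_num) (abs_nonneg u), ← mul_assoc,
          ← Real.rpow_add (by norm_num), add_neg_cancel, Real.rpow_zero, one_mul, neg_add']
    _ ≤ 2 ^ (1 + ε) * weight ε u := by
        gcongr
        exact Real.rpow_le_rpow_of_nonpos (by positivity) (by linarith) (by linarith)

/-- A filter along which retarded time tends to an end of the time axis. -/
structure IsEnd (ε : ℝ) (l : Filter ℝ) : Prop where
  neBot : l.NeBot
  exists_tendsto : ∃ w, Tendsto (weightIntegral ε) l (𝓝 w)
  tendsto_add_const : ∀ M : ℝ, Tendsto (fun u => u + M) l l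
  tendsto_weight : Tendsto (weight ε) l (𝓝 0)

lemma isEnd_atTop {ε : ℝ} (hε : 0 < ε) : IsEnd ε atTop where
  neBot := inferInstance
  exists_tendsto :=
    ⟨_, intervalIntegral_tendsto_integral_Ioi 0 (integrable_weight hε).integrableOn tendsto_id⟩
  tendsto_add_const M := tendsto_atTop_add_const_right _ M tendsto_id
  tendsto_weight := (tendsto_rpow_neg_atTop (by linarith)).comp
    (tendsto_atTop_add_const_left _ 1 tendsto_abs_atTop_atTop)

lemma isEnd_atBot {ε : ℝ} (hε : 0 < ε) : IsEnd ε atBot where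
  neBot := inferInstance
  exists_tendsto := by
    refine ⟨_, ((intervalIntegral_tendsto_integral_Iic 0 (integrable_weight hε).integrableOn
      tendsto_id).neg).congr fun u => ?_⟩
    rw [id, weightIntegral, intervalIntegral.integral_symm, neg_neg]
  tendsto_add_const M := tendsto_atBot_add_const_right _ M tendsto_id
  tendsto_weight := (tendsto_rpow_neg_atTop (by linarith)).comp
    (tendsto_atTop_add_const_left _ 1 tendsto_abs_atBot_atTop)

lemma IsEnd.tendsto_weightIntegral_sub {ε : ℝ} {l : Filter ℝ} (hl : IsEnd ε l) (M : ℝ) :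
    Tendsto (fun u => weightIntegral ε (u + M) - weightIntegral ε (u + -M)) l (𝓝 0) := by
  obtain ⟨w, hw⟩ := hl.exists_tendsto
  simpa using (hw.comp (hl.tendsto_add_const M)).sub (hw.comp (hl.tendsto_add_const (-M)))

lemma IsEnd.exists_tendsto_of_dist_le {X : Type*} [MetricSpace X] [CompleteSpace X] {ε : ℝ}
    {l : Filter ℝ} (hl : IsEnd ε l) {F : ℝ → X} {K : ℝ}
    (hF : ∀ u v, dist (F u) (F v) ≤ K * |weightIntegral ε u - weightIntegral ε v|) :
    ∃ y, Tendsto F l (𝓝 y) := by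
  have := hl.neBot
  obtain ⟨w, hw⟩ := hl.exists_tendsto
  refine cauchy_map_iff_exists_tendsto.1 (cauchy_map_iff.2 ⟨hl.neBot, ?_⟩)
  rw [tendsto_uniformity_iff_dist_tendsto_zero]
  refine squeeze_zero (fun _ => dist_nonneg) (fun p => hF p.1 p.2) ?_
  simpa using ((hw.comp tendsto_fst).sub (hw.comp tendsto_snd)).abs.const_mul K

lemma abs_sub_le_weightIntegral {ε : ℝ} {φ φ' : ℝ → ℝ} {K : ℝ}
    (hφ : ∀ u, HasDerivAt φ (φ' u) u) (hK : ∀ u, |φ' u| ≤ K * weight ε u) (u v : ℝ) :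
    |φ u - φ v| ≤ K * |weightIntegral ε u - weightIntegral ε v| := by
  wlog hvu : v ≤ u generalizing u v
  · rw [abs_sub_comm, abs_sub_comm (weightIntegral ε u)]
    exact this v u (le_of_not_ge hvu)
  have hsub : Monotone fun s => K * weightIntegral ε s - φ s :=
    monotone_of_hasDerivAt_nonneg
      (fun s => ((hasDerivAt_weightIntegral ε s).const_mul K).sub (hφ s))
      fun s => sub_nonneg.2 (abs_le.1 (hK s)).2
  have hadd : Monotone fun s => K * weightIntegral ε s + φ s :=
    monotone_of_hasDerivAt_nonneg
      (fun s => ((hasDerivAt_weightIntegral ε s).const_mul K).add (hφ s))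
      fun s => neg_le_iff_add_nonneg'.1 (abs_le.1 (hK s)).1
  have hsub_le := hsub hvu
  have hadd_le := hadd hvu
  rw [abs_of_nonneg (sub_nonneg.2 (monotone_weightIntegral ε hvu)), abs_le]
  constructor <;> simp only at hsub_le hadd_le <;> linarith

/-- A family of functions that is dominated by the weight, uniformly on the sphere. -/
def Decays (ε : ℝ) (F : ℝ → SmoothFn) : Prop :=
  (fun p : ℝ × S2 => F p.1 p.2) =O[⊤] fun p => weight ε p.1

/-- A family of functions that is bounded uniformly in retarded time and on the sphere. -/
def UniformlyBounded (F : ℝ → SmoothFn) : Prop :=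
  (fun p : ℝ × S2 => F p.1 p.2) =O[⊤] fun _ => (1 : ℝ)

/-- A family of functions whose increments in retarded time are dominated by those of the primitive
of the weight, uniformly on the sphere. -/
def WeightLipschitz (ε : ℝ) (F : ℝ → S2 → ℝ) : Prop :=
  ∃ K, 0 ≤ K ∧ ∀ u v x, |F u x - F v x| ≤ K * |weightIntegral ε u - weightIntegral ε v|

lemma SmoothFn.exists_abs_le (H : SmoothFn) : ∃ M, ∀ x, |H x| ≤ M := by
  obtain ⟨M, hM⟩ := isCompact_univ.exists_bound_of_continuousOn H.smoothS2.continuous.continuousOn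
  exact ⟨M, fun x => hM x (Set.mem_univ x)⟩

lemma SmoothFn.uniformlyBounded (H : SmoothFn) : UniformlyBounded fun _ => H := by
  obtain ⟨M, hM⟩ := H.exists_abs_le
  exact isBigO_top.2 ⟨M, fun p => by simpa using hM p.2⟩

namespace Decays

variable {ε : ℝ} {F G : ℝ → SmoothFn}

lemma exists_bound (hF : Decays ε F) : ∃ K, 0 ≤ K ∧ ∀ u x, |F u x| ≤ K * weight ε u := by
  obtain ⟨K, hK0, hK⟩ := IsBigO.exists_nonneg hF
  refine ⟨K, hK0, fun u x => ?_⟩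
  simpa [abs_of_pos (weight_pos ε u)] using isBigOWith_top.1 hK (u, x)

lemma of_bound {K : ℝ} (hK : ∀ u x, |F u x| ≤ K * weight ε u) : Decays ε F :=
  isBigO_top.2 ⟨K, fun p => by simpa [abs_of_pos (weight_pos ε p.1)] using hK p.1 p.2⟩

lemma add (hF : Decays ε F) (hG : Decays ε G) : Decays ε fun u => F u + G u :=
  IsBigO.add hF hG

lemma mul_bounded (hF : Decays ε F) (hG : UniformlyBounded G) : Decays ε fun u => F u * G u := by
  simpa only [Decays, SmoothFn.mul_apply, mul_one] using IsBigO.mul hF hG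

lemma const_mul (hF : Decays ε F) (H : SmoothFn) : Decays ε fun u => H * F u := by
  simpa only [mul_comm] using hF.mul_bounded H.uniformlyBounded

lemma const_smul (hF : Decays ε F) (r : ℝ) : Decays ε fun u => r • F u := by
  simpa only [Algebra.smul_def] using hF.const_mul (algebraMap ℝ SmoothFn r)

lemma sum {ι : Type*} {s : Finset ι} {F : ι → ℝ → SmoothFn} (hF : ∀ i ∈ s, Decays ε (F i)) :
    Decays ε fun u => ∑ i ∈ s, F i u := by
  simpa only [Decays, SmoothFn.sum_apply, Finset.sum_fn] using IsBigO.sum hF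

lemma uniformlyBounded (hF : Decays ε F) (hε : 0 < ε) : UniformlyBounded F :=
  IsBigO.trans hF <| isBigO_top.2 ⟨1, fun p => by
    simpa [abs_of_pos (weight_pos ε p.1)] using weight_le_one hε p.1⟩

lemma shift {Fs : ℝ → SmoothFn} (hF : Decays ε F) (hε : 0 < ε) (f : SmoothFn)
    (hFs : ∀ u x, Fs u x = F (u + f x) x) : Decays ε Fs := by
  obtain ⟨K, hK0, hK⟩ := hF.exists_bound
  obtain ⟨M, hM⟩ := f.exists_abs_le
  refine of_bound (K := K * (1 + M) ^ (1 + ε)) fun u x => ?_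
  rw [hFs, mul_assoc]
  exact (hK _ x).trans (mul_le_mul_of_nonneg_left (weight_add_le hε (hM x) u) hK0)

end Decays

namespace WeightLipschitz

variable {ε : ℝ} {F : ℝ → S2 → ℝ}

lemma of_decays {F' : ℝ → SmoothFn} (hderiv : ∀ u x, HasDerivAt (fun s => F s x) (F' u x) u)
    (hF' : Decays ε F') : WeightLipschitz ε F := by
  obtain ⟨K, hK0, hK⟩ := hF'.exists_bound
  exact ⟨K, hK0, fun u v x =>
    abs_sub_le_weightIntegral (fun s => hderiv s x) (fun s => hK s x) u v⟩

lemma abs_shift_sub_le (hF : WeightLipschitz ε F) (f : SmoothFn) : ∃ K M : ℝ, ∀ u x,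
    |F (u + f x) x - F u x| ≤ K * (weightIntegral ε (u + M) - weightIntegral ε (u + -M)) := by
  obtain ⟨K, hK0, hK⟩ := hF
  obtain ⟨M, hM⟩ := f.exists_abs_le
  refine ⟨K, M, fun u x => (hK _ _ x).trans (mul_le_mul_of_nonneg_left ?_ hK0)⟩
  have hmono := monotone_weightIntegral ε
  obtain ⟨hlower, hupper⟩ := abs_le.1 (hM x)
  exact abs_sub_le_of_le_of_le (hmono (by linarith)) (hmono (by linarith)) (hmono (by linarith))
    (hmono (by linarith))

lemma uniformlyBounded {F : ℝ → SmoothFn} (hF : WeightLipschitz ε fun u x => F u x) (hε : 0 < ε) :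
    UniformlyBounded F := by
  obtain ⟨K, hK0, hK⟩ := hF
  obtain ⟨B, hB⟩ := (F 0).exists_abs_le
  obtain ⟨top, htop⟩ := (isEnd_atTop hε).exists_tendsto
  obtain ⟨bot, hbot⟩ := (isEnd_atBot hε).exists_tendsto
  have hmono := monotone_weightIntegral ε
  refine isBigO_top.2 ⟨K * (top - bot) + B, fun p => ?_⟩
  have hincrement : |F p.1 p.2 - F 0 p.2| ≤ K * (top - bot) :=
    (hK p.1 0 p.2).trans (mul_le_mul_of_nonneg_left
      (abs_sub_le_of_le_of_le (hmono.le_of_tendsto hbot _) (hmono.ge_of_tendsto htop _)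
        (hmono.le_of_tendsto hbot _) (hmono.ge_of_tendsto htop _)) hK0)
  have htri := abs_add_le (F p.1 p.2 - F 0 p.2) (F 0 p.2)
  rw [sub_add_cancel] at htri
  rw [norm_one, mul_one, Real.norm_eq_abs]
  linarith [hB p.2]

lemma tendsto_integral_shift_sub (hF : WeightLipschitz ε F)
    (hFc : Continuous fun p : ℝ × S2 => F p.1 p.2) (f : SmoothFn) {l : Filter ℝ}
    (hl : IsEnd ε l) :
    Tendsto (fun u => integralS2 (fun x => F (u + f x) x) - integralS2 (F u)) l (𝓝 0) := by
  obtain ⟨K, M, hKM⟩ := hF.abs_shift_sub_le f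
  have hFu (u : ℝ) : Continuous (F u) := hFc.comp (Continuous.prodMk_right u)
  have hFs (u : ℝ) : Continuous fun x => F (u + f x) x :=
    hFc.comp ((continuous_const.add f.smoothS2.continuous).prodMk continuous_id)
  refine squeeze_zero_norm
    (a := fun u => K * (weightIntegral ε (u + M) - weightIntegral ε (u + -M)) *
      areaS2.real Set.univ) (fun u => ?_) ?_
  · rw [integralS2, integralS2,
      ← integral_sub (integrable_areaS2 (hFs u)) (integrable_areaS2 (hFu u))]
    exact norm_integral_le_of_norm_le_const (.of_forall fun x => hKM u x)
  · simpa using ((hl.tendsto_weightIntegral_sub M).const_mul K).mul_const (areaS2.real Set.univ)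

end WeightLipschitz

section convergence

variable {ε : ℝ} {l : Filter ℝ} {F : ℝ → SmoothFn}

lemma tendsto_toL2_of_tendsto {y : C(S2, ℝ)}
    (hF : Tendsto (fun u => (F u).toContinuousMap) l (𝓝 y)) :
    Tendsto (fun u => (F u).toL2) l (𝓝 (ContinuousMap.toLp (E := ℝ) 2 areaS2 ℝ y)) :=
  ((ContinuousMap.toLp (E := ℝ) 2 areaS2 ℝ).continuous.tendsto y).comp hF

lemma tendsto_toL2_zero {r : ℝ → ℝ} (hF : ∀ u x, |F u x| ≤ r u) (hr : Tendsto r l (𝓝 0)) :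
    Tendsto (fun u => (F u).toL2) l (𝓝 0) := by
  have : Nonempty S2 := (NormedSpace.sphere_nonempty.2 zero_le_one).to_subtype
  have hsup : Tendsto (fun u => (F u).toContinuousMap) l (𝓝 0) :=
    squeeze_zero_norm
      (fun u => (ContinuousMap.norm_le_of_nonempty _).2 fun x => hF u x) hr
  simpa only [map_zero] using tendsto_toL2_of_tendsto hsup

lemma Decays.tendsto_toL2 (hF : Decays ε F) (hl : IsEnd ε l) :
    Tendsto (fun u => (F u).toL2) l (𝓝 0) := by
  obtain ⟨K, -, hK⟩ := hF.exists_bound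
  exact tendsto_toL2_zero hK (by simpa using hl.tendsto_weight.const_mul K)

lemma WeightLipschitz.exists_tendsto_toL2 (hF : WeightLipschitz ε fun u x => F u x)
    (hl : IsEnd ε l) : ∃ v, Tendsto (fun u => (F u).toL2) l (𝓝 v) := by
  obtain ⟨K, hK0, hK⟩ := hF
  obtain ⟨y, hy⟩ : ∃ y, Tendsto (fun u => (F u).toContinuousMap) l (𝓝 y) :=
    hl.exists_tendsto_of_dist_le (K := K) fun u v =>
      (ContinuousMap.dist_le (by positivity)).2 fun x => hK u v x
  exact ⟨_, tendsto_toL2_of_tendsto hy⟩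

lemma WeightLipschitz.tendsto_toL2_shift_sub {Fs : ℝ → SmoothFn}
    (hF : WeightLipschitz ε fun u x => F u x) (f : SmoothFn)
    (hFs : ∀ u x, Fs u x = F (u + f x) x) (hl : IsEnd ε l) :
    Tendsto (fun u => (Fs u - F u).toL2) l (𝓝 0) := by
  obtain ⟨K, M, hKM⟩ := hF.abs_shift_sub_le f
  refine tendsto_toL2_zero (fun u x => ?_)
    (by simpa using (hl.tendsto_weightIntegral_sub M).const_mul K)
  rw [SmoothFn.sub_apply, hFs]
  exact hKM u x

end convergence

lemma isBigO_top_of_cocompact {X : Type*} [TopologicalSpace X] {f g : X → ℝ} (hf : Continuous f)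
    (hg : Continuous g) (hg0 : ∀ x, g x ≠ 0) (h : f =O[cocompact X] g) : f =O[⊤] g := by
  obtain ⟨C, hC⟩ := h.bound
  obtain ⟨K, hK, hKC⟩ := mem_cocompact.1 hC
  have hquotient : (fun x => f x / g x) =O[𝓟 K] fun _ => (1 : ℝ) :=
    (hf.div hg hg0).continuousOn.isBigO_principal hK (by simp)
  have hinside : f =O[𝓟 K] g := by
    simpa only [div_mul_cancel₀ _ (hg0 _), one_mul] using hquotient.mul (isBigO_refl g _)
  have houtside : f =O[𝓟 Kᶜ] g := isBigO_principal.2 ⟨C, fun x hx => hKC hx⟩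
  simpa using hinside.sup houtside

lemma prod_top_eq_cocompact :
    (atBot ⊔ atTop : Filter ℝ) ×ˢ (⊤ : Filter S2) = cocompact (ℝ × S2) := by
  rw [← cocompact_eq_atBot_atTop, prod_top, ← coprod_cocompact, cocompact_eq_bot (X := S2),
    coprod_bot]

lemma Decays.of_isBigO {ε : ℝ} (hε : 0 < ε) {F : ℝ → SmoothFn}
    (hFc : Continuous fun p : ℝ × S2 => F p.1 p.2)
    (hF : (fun p : ℝ × S2 => F p.1 p.2) =O[(atBot ⊔ atTop) ×ˢ ⊤]
      (fun p : ℝ × S2 => |p.1| ^ (-1 - ε))) : Decays ε F := by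
  have hlarge : ∀ᶠ u : ℝ in atBot ⊔ atTop, 1 ≤ |u| :=
    eventually_sup.2 ⟨tendsto_abs_atBot_atTop.eventually_ge_atTop 1,
      tendsto_abs_atTop_atTop.eventually_ge_atTop 1⟩
  have hpow : (fun p : ℝ × S2 => |p.1| ^ (-1 - ε)) =O[(atBot ⊔ atTop) ×ˢ ⊤]
      fun p => weight ε p.1 := by
    refine .of_bound (2 ^ (1 + ε)) (hlarge.prod_inl ⊤ |>.mono fun p hp => ?_)
    rw [Real.norm_of_nonneg (by positivity), Real.norm_of_nonneg (weight_pos ε _).le]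
    exact abs_rpow_le_weight hε hp
  refine isBigO_top_of_cocompact hFc ((continuous_weight ε).comp continuous_fst)
    (fun p => (weight_pos ε p.1).ne') ?_
  rw [← prod_top_eq_cocompact]
  exact hF.trans hpow

/-! ### The data on null infinity in terms of the calculus -/

namespace SphereCalculus

variable {A : Type*} [CommRing A] [Algebra ℝ A] {S : SphereCalculus A} {T U : Fin 3 → Fin 3 → A}

lemma IsSTT.sub (hT : S.IsSTT T) (hU : S.IsSTT U) : S.IsSTT fun a b => T a b - U a b where
  symm a b := by rw [hT.symm, hU.symm]
  tangential b := by
    simp only [mul_sub, Finset.sum_sub_distrib, hT.tangential, hU.tangential, sub_zero]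
  trace := by simp only [Finset.sum_sub_distrib, hT.trace, hU.trace, sub_zero]

lemma divDiv_add : S.divDiv (fun a b => T a b + U a b) = S.divDiv T + S.divDiv U := by
  simp only [divDiv, div, map_add, Finset.sum_add_distrib]

lemma divDiv_sub : S.divDiv (fun a b => T a b - U a b) = S.divDiv T - S.divDiv U := by
  simp only [divDiv, div, map_sub, Finset.sum_sub_distrib]

lemma lieRot_sub (κ : Fin 3 → Fin 3 → ℝ) (a b : Fin 3) :
    S.lieRot κ (fun a b => T a b - U a b) a b = S.lieRot κ T a b - S.lieRot κ U a b := by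
  simp only [lieRot, map_sub, mul_sub, Finset.sum_sub_distrib]
  ring

lemma biLaplacian_of_potential {c c' : A}
    (h : ∀ a b, 2 * T a b = S.electricShear c a b + S.magneticShear c' a b) :
    S.biLaplacian c = 2 * S.divDiv T := by
  have hT : (fun a b => T a b + T a b) =
      fun a b => S.electricShear c a b + S.magneticShear c' a b :=
    funext₂ fun a b => by rw [← h, two_mul]
  rw [two_mul, ← divDiv_add, hT, divDiv_add, divDiv_electricShear, divDiv_magneticShear, add_zero]

lemma IsSTT.D_eq (hT : S.IsSTT T) (d b c : Fin 3) :
    S.D d (T b c) = ∑ a, ∑ e, S.metric b a * S.metric c e * S.D d (T a e)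
      - S.X b * T d c - S.X c * T b d := by
  have hfst (e : Fin 3) : ∑ a, S.metric b a * S.D d (T a e) = S.D d (T b e) + S.X b * T d e := by
    rw [S.sum_metric_mul b, S.sum_X_mul_D_of_tangential (hT.tangential e)]; ring
  have hsnd : ∑ e, S.metric c e * S.D d (T b e) = S.D d (T b c) + S.X c * T b d := by
    rw [S.sum_metric_mul c, S.sum_X_mul_D_of_tangential (hT.sum_mul_X b)]; ring
  have hproj : ∑ e, S.metric c e * T d e = T d c :=
    S.sum_metric_mul_of_tangential (hT.sum_mul_X d) c
  have hsum : ∑ a, ∑ e, S.metric b a * S.metric c e * S.D d (T a e) =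
      ∑ e, S.metric c e * S.D d (T b e) + S.X b * ∑ e, S.metric c e * T d e := by
    rw [Finset.sum_comm, Finset.mul_sum, ← Finset.sum_add_distrib]
    refine Finset.sum_congr rfl fun e _ => ?_
    simp only [mul_comm (S.metric b _) (S.metric c e), mul_assoc, ← Finset.mul_sum, hfst]
    ring
  rw [hsum, hsnd, hproj]
  ring

variable {κ : Fin 3 → Fin 3 → ℝ}

lemma integral_mul_rot_biLaplacian (hκ : IsSkew κ) (c : A) :
    S.integral (c * S.rot κ (S.biLaplacian c)) = 0 := by
  have hskew := integral_rot_mul (S := S) hκ c (S.biLaplacian c)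
  have hsymm := integral_biLaplacian_mul (S := S) c (S.rot κ c)
  rw [biLaplacian_rot hκ] at hsymm
  rw [mul_comm (S.rot κ c), hsymm] at hskew
  linarith

lemma integral_sum_mul_lieRot_electricShear (hκ : IsSkew κ) (hT : S.IsSTT T) {c : A}
    (hc : S.biLaplacian c = 2 * S.divDiv T) (f : A) :
    S.integral (∑ a, ∑ b, T a b * S.lieRot κ (S.electricShear f) a b) =
      S.integral (c * S.rot κ (S.biLaplacian f)) := by
  simp only [lieRot_electricShear hκ]
  rw [hT.integral_sum_mul_electricShear, ← biLaplacian_rot hκ, ← integral_biLaplacian_mul, hc,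
    mul_assoc, two_mul, two_mul, map_add]

end SphereCalculus

open SphereCalculus

/-- The smooth function `c` is the closed potential of the shear `T`, expressed by the equation
`Δ(Δ + 2) c = 2 ∇ᴬ∇ᴮ T_{AB}`, which does not involve the co-closed potential. -/
structure IsClosedPotential (T : Fin 3 → Fin 3 → SmoothFn) (c : SmoothFn) : Prop where
  isSTT : sphereCalc.IsSTT T
  biLaplacian_eq : sphereCalc.biLaplacian c = 2 * sphereCalc.divDiv T
  supported : SupportedGE2 c

lemma SupportedGE2.integral_mul_eq_zero {c : SmoothFn} (hc : SupportedGE2 c) (ℓ : ℕ) (hℓ : ℓ < 2)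
    (F : SmoothFn) (hF : F ∈ sphereCalc.Mode ℓ) : sphereCalc.integral (c * F) = 0 := by
  refine hc ℓ hℓ F ⟨F.smoothS2, fun x => ?_⟩
  rw [sphereCalc.mem_mode] at hF
  rw [lap_eq_laplacian, hF, SmoothFn.neg_apply, SmoothFn.smul_apply, neg_mul]

lemma SupportedGE2.sub {c d : SmoothFn} (hc : SupportedGE2 c) (hd : SupportedGE2 d) :
    SupportedGE2 (c - d : SmoothFn) := by
  intro ℓ hℓ φ hφ
  have hsub := congrArg₂ (· - ·) (hc ℓ hℓ φ hφ) (hd ℓ hℓ φ hφ)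
  rw [sub_zero] at hsub
  rw [← hsub]
  exact (map_sub sphereCalc.integral (c * .mk hφ.1) (d * .mk hφ.1)).symm ▸
    congrArg sphereCalc.integral (sub_mul c d (.mk hφ.1))

lemma SupportedGE2.const_smul {c : SmoothFn} (hc : SupportedGE2 c) (r : ℝ) :
    SupportedGE2 (r • c : SmoothFn) := by
  intro ℓ hℓ φ hφ
  have hsmul := congrArg (r * ·) (hc ℓ hℓ φ hφ)
  simp only [mul_zero] at hsmul
  rw [← hsmul]
  exact (congrArg sphereCalc.integral (smul_mul_assoc r c (.mk hφ.1))).trans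
    (map_smul sphereCalc.integral r (c * .mk hφ.1))

namespace IsClosedPotential

variable {T U : Fin 3 → Fin 3 → SmoothFn} {c d : SmoothFn}

lemma sub (hc : IsClosedPotential T c) (hd : IsClosedPotential U d) :
    IsClosedPotential (fun a b => T a b - U a b) (c - d) where
  isSTT := hc.isSTT.sub hd.isSTT
  biLaplacian_eq := by rw [map_sub, hc.biLaplacian_eq, hd.biLaplacian_eq, divDiv_sub, mul_sub]
  supported := hc.supported.sub hd.supported

lemma norm_sq_toL2_le (hc : IsClosedPotential T c) :
    ‖c.toL2‖ ^ 2 ≤ ∑ a, ∑ b, ‖(T a b).toL2‖ ^ 2 := by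
  simp only [SmoothFn.norm_sq_toL2, ← map_sum]
  exact integral_mul_self_le_of_biLaplacian_eq hc.isSTT hc.biLaplacian_eq
    hc.supported.integral_mul_eq_zero

lemma tendsto_toL2_zero {ι : Type*} {l : Filter ι} {T : Fin 3 → Fin 3 → ι → SmoothFn}
    {c : ι → SmoothFn} (hc : ∀ i, IsClosedPotential (fun a b => T a b i) (c i))
    (hT : ∀ a b, Tendsto (fun i => (T a b i).toL2) l (𝓝 0)) :
    Tendsto (fun i => (c i).toL2) l (𝓝 0) := by
  have hsum : Tendsto (fun i => ∑ a, ∑ b, ‖(T a b i).toL2‖ ^ 2) l (𝓝 0) := by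
    simpa using tendsto_finsetSum Finset.univ fun a _ =>
      tendsto_finsetSum Finset.univ fun b _ => (hT a b).norm.pow 2
  have hsq : Tendsto (fun i => ‖(c i).toL2‖ ^ 2) l (𝓝 0) :=
    squeeze_zero (fun i => sq_nonneg _) (fun i => (hc i).norm_sq_toL2_le) hsum
  rw [tendsto_zero_iff_norm_tendsto_zero]
  simpa using hsq.sqrt

lemma exists_tendsto_toL2 {ι : Type*} {l : Filter ι} [l.NeBot] {T : Fin 3 → Fin 3 → ι → SmoothFn}
    {c : ι → SmoothFn} (hc : ∀ i, IsClosedPotential (fun a b => T a b i) (c i))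
    (hT : ∀ a b, ∃ v, Tendsto (fun i => (T a b i).toL2) l (𝓝 v)) :
    ∃ v, Tendsto (fun i => (c i).toL2) l (𝓝 v) := by
  rw [← cauchy_map_iff_exists_tendsto, cauchy_map_iff', tendsto_uniformity_iff_dist_tendsto_zero]
  have hdiff : Tendsto (fun p : ι × ι => (c p.1 - c p.2).toL2) (l ×ˢ l) (𝓝 0) := by
    refine tendsto_toL2_zero (T := fun a b p => T a b p.1 - T a b p.2)
      (fun p => (hc p.1).sub (hc p.2)) fun a b => ?_
    obtain ⟨v, hv⟩ := hT a b
    simpa only [map_sub, sub_self, Function.comp_apply] using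
      (hv.comp tendsto_fst).sub (hv.comp tendsto_snd)
  simpa only [dist_eq_norm, map_sub, norm_zero] using hdiff.norm

end IsClosedPotential

/-- The matrix generating the rotation about the `k`-th axis. -/
def axis (k a c : Fin 3) : ℝ := leviCivita a k c

lemma isSkew_axis (k : Fin 3) : IsSkew (axis k) := fun a c => by
  simp only [axis, leviCivita]; ring

lemma sum_volForm_mul_D_X (k a : Fin 3) :
    ∑ b, sphereCalc.volForm a b * sphereCalc.D b (sphereCalc.X k) =
      sphereCalc.rotField (axis k) a := by
  have htang : ∑ b, sphereCalc.X b * sphereCalc.volForm a b = 0 := by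
    obtain ⟨h00, h01, h02, h10, h11, h12, h20, h21, h22⟩ := sphereCalc.volForm_entries
    fin_cases a <;>
      simp [Fin.sum_univ_three, h00, h01, h02, h10, h11, h12, h20, h21, h22] <;> ring
  simp only [D_X, mul_comm (sphereCalc.volForm a _), sphereCalc.metric_symm _ k]
  rw [sphereCalc.sum_metric_mul_of_tangential htang, volForm, rotField]
  rfl

lemma rotField_axis_apply (k a : Fin 3) (x : S2) :
    sphereCalc.rotField (axis k) a x = ∑ b, epsS2 x a b * grad0 (coordX k) x b := by
  rw [← sum_volForm_mul_D_X]
  simp only [SmoothFn.sum_apply, SmoothFn.mul_apply, sphereCalc_volForm, sphereCalc_D]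
  rfl

lemma rot_axis_X (k i : Fin 3) : sphereCalc.rot (axis k) (sphereCalc.X i) =
    ∑ j, leviCivita i k j • sphereCalc.X j := by
  simp only [rot_X (isSkew_axis k), rotField, axis, Algebra.smul_def]

namespace NullInfinityData

variable (D : NullInfinityData)

/-- The mass aspect as a family of smooth functions. -/
def massAspect (u : ℝ) : SmoothFn := .mk (D.smooth_m.smoothS2 u)

/-- A component of the angular momentum aspect as a family of smooth functions. -/
def angularAspect (a : Fin 3) (u : ℝ) : SmoothFn := .mk ((D.smooth_NA a).smoothS2 u)

/-- A component of the shear as a family of smooth functions. -/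
def shearFn (a b : Fin 3) (u : ℝ) : SmoothFn := .mk ((D.smooth_C a b).smoothS2 u)

/-- The retarded-time derivative of `massAspect`. -/
def massRate (u : ℝ) : SmoothFn := .mk (D.smooth_m.smoothScri_timeDeriv.smoothS2 u)

/-- The retarded-time derivative of `angularAspect`. -/
def angularRate (a : Fin 3) (u : ℝ) : SmoothFn :=
  .mk ((D.smooth_NA a).smoothScri_timeDeriv.smoothS2 u)

/-- A component of the news as a family of smooth functions. -/
def newsFn (a b : Fin 3) (u : ℝ) : SmoothFn :=
  .mk ((D.smooth_C a b).smoothScri_timeDeriv.smoothS2 u)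

/-- The retarded-time derivative of `newsFn`. -/
def newsRate (a b : Fin 3) (u : ℝ) : SmoothFn :=
  .mk ((D.smooth_C a b).smoothScri_timeDeriv.smoothScri_timeDeriv.smoothS2 u)

lemma hasTimeDeriv_massAspect : HasTimeDeriv D.massAspect D.massRate := .of_smoothScri D.smooth_m

lemma hasTimeDeriv_angularAspect (a : Fin 3) :
    HasTimeDeriv (D.angularAspect a) (D.angularRate a) := .of_smoothScri (D.smooth_NA a)

lemma hasTimeDeriv_shearFn (a b : Fin 3) : HasTimeDeriv (D.shearFn a b) (D.newsFn a b) :=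
  .of_smoothScri (D.smooth_C a b)

lemma hasTimeDeriv_newsFn (a b : Fin 3) : HasTimeDeriv (D.newsFn a b) (D.newsRate a b) :=
  .of_smoothScri (D.smooth_C a b).smoothScri_timeDeriv

lemma newsFn_apply (a b : Fin 3) (u : ℝ) (x : S2) : D.newsFn a b u x = news D.C u x a b := rfl

lemma isSTT_shearFn (u : ℝ) : sphereCalc.IsSTT fun a b => D.shearFn a b u where
  symm a b := ContMDiffMap.ext fun x => D.symm_C u x a b
  tangential b := ContMDiffMap.ext fun x => by
    simp only [SmoothFn.sum_apply, SmoothFn.mul_apply]; exact D.tangent_C u x b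
  trace := ContMDiffMap.ext fun x => by
    simp only [SmoothFn.sum_apply]; exact D.traceless_C u x

lemma isSTT_newsFn (u : ℝ) : sphereCalc.IsSTT fun a b => D.newsFn a b u where
  symm a b := by
    have hsymm : D.shearFn a b = D.shearFn b a := funext fun u => (D.isSTT_shearFn u).symm a b
    have hderiv := D.hasTimeDeriv_shearFn a b
    rw [hsymm] at hderiv
    exact congrFun (hderiv.unique (D.hasTimeDeriv_shearFn b a)) u
  tangential b := by
    have hderiv := HasTimeDeriv.sum (s := Finset.univ) fun a _ =>
      (D.hasTimeDeriv_shearFn a b).const_mul (sphereCalc.X a)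
    simp only [(D.isSTT_shearFn _).tangential b] at hderiv
    exact congrFun (hderiv.unique (.const 0)) u
  trace := by
    have hderiv := HasTimeDeriv.sum (s := Finset.univ) fun a _ => D.hasTimeDeriv_shearFn a a
    simp only [(D.isSTT_shearFn _).trace] at hderiv
    exact congrFun (hderiv.unique (.const 0)) u

lemma div2_shear (u : ℝ) :
    div2 (D.C u) = fun x b => sphereCalc.tangentDiv (fun a b => D.shearFn a b u) b x :=
  funext₂ fun x b => div2_eq_tangentDiv (fun a b => D.shearFn a b u) x b

lemma div2_news (u : ℝ) :
    div2 (news D.C u) = fun x b => sphereCalc.tangentDiv (fun a b => D.newsFn a b u) b x :=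
  funext₂ fun x b => div2_eq_tangentDiv (fun a b => D.newsFn a b u) x b

lemma grad2_news (u : ℝ) (x : S2) (d b c : Fin 3) : grad2 (news D.C u) x d b c =
    (∑ a, ∑ e, sphereCalc.metric b a * sphereCalc.metric c e *
      sphereCalc.D d (D.newsFn a e u)) x := by
  simp only [grad2, SmoothFn.sum_apply, SmoothFn.mul_apply, sphereCalc_metric, sphereCalc_D]
  rfl

lemma angularRate_eq (u : ℝ) (a : Fin 3) :
    4 * D.angularRate a u = 4 * sphereCalc.D a (D.massAspect u)
      - sphereCalc.tangentDiv (fun d b =>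
          sphereCalc.covDeriv (sphereCalc.tangentDiv fun a b => D.shearFn a b u) d b
          - sphereCalc.covDeriv (sphereCalc.tangentDiv fun a b => D.shearFn a b u) b d) a
      + sphereCalc.D a (∑ b, ∑ e, D.shearFn b e u * D.newsFn b e u)
      - sphereCalc.tangentDiv (fun b e => ∑ d, D.shearFn b d u * D.newsFn d e u) a
      + 2 * ∑ b, D.shearFn a b u * sphereCalc.tangentDiv (fun a b => D.newsFn a b u) b := by
  refine ContMDiffMap.ext fun x => ?_
  have hcurl : div2 (fun y d b => grad1 (div2 (D.C u)) y d b - grad1 (div2 (D.C u)) y b d) x a =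
      sphereCalc.tangentDiv (fun d b =>
        sphereCalc.covDeriv (sphereCalc.tangentDiv fun a b => D.shearFn a b u) d b
        - sphereCalc.covDeriv (sphereCalc.tangentDiv fun a b => D.shearFn a b u) b d) a x := by
    rw [← div2_eq_tangentDiv, D.div2_shear]
    simp only [grad1_eq_covDeriv, SmoothFn.sub_apply]
  have hgrad : grad0 (fun y => ∑ b, ∑ e, D.C u y b e * news D.C u y b e) x a =
      sphereCalc.D a (∑ b, ∑ e, D.shearFn b e u * D.newsFn b e u) x := by
    rw [sphereCalc_D]
    congr 1
  have hdiv : div2 (fun y b e => ∑ d, D.C u y b d * news D.C u y d e) x a =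
      sphereCalc.tangentDiv (fun b e => ∑ d, D.shearFn b d u * D.newsFn d e u) a x := by
    rw [← div2_eq_tangentDiv]
    simp only [SmoothFn.sum_apply]
    rfl
  have hevol : D.angularRate a u x = _ := D.evol_NA u x a
  rw [hcurl, hgrad, hdiv, D.div2_news] at hevol
  have hmass : sphereCalc.D a (D.massAspect u) x = grad0 (D.m u) x a := rfl
  have hshear (b : Fin 3) : D.shearFn a b u x = D.C u x a b := rfl
  simp only [SmoothFn.add_apply, SmoothFn.sub_apply, SmoothFn.mul_apply, SmoothFn.ofNat_apply,
    SmoothFn.sum_apply, hevol, hmass, hshear]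
  ring

/-- The part of the angular momentum along the rotation generated by `κ` that does not involve the
potential of the shear. -/
def localJ (κ : Fin 3 → Fin 3 → ℝ) (u : ℝ) : ℝ :=
  sphereCalc.integral (∑ a, sphereCalc.rotField κ a * (D.angularAspect a u -
    (1 / 4 : ℝ) •
      ∑ d, D.shearFn a d u * sphereCalc.tangentDiv (fun a b => D.shearFn a b u) d))

/-- The flux density of `localJ`, up to the factor `-1/4`. -/
def fluxDensity (κ : Fin 3 → Fin 3 → ℝ) (u : ℝ) : SmoothFn :=
  ∑ a, ∑ b, D.newsFn a b u * sphereCalc.lieRot κ (fun a b => D.shearFn a b u) a b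

lemma hasDerivAt_localJ {κ : Fin 3 → Fin 3 → ℝ} (hκ : IsSkew κ) (u : ℝ) :
    HasDerivAt (D.localJ κ) (-(1 / 4) * sphereCalc.integral (D.fluxDensity κ u)) u := by
  have hderiv := HasTimeDeriv.sum (s := Finset.univ) fun a _ =>
    ((D.hasTimeDeriv_angularAspect a).sub ((HasTimeDeriv.sum (s := Finset.univ) fun d _ =>
      (D.hasTimeDeriv_shearFn a d).mul (HasTimeDeriv.tangentDiv D.hasTimeDeriv_shearFn d)
        ).const_smul (1 / 4))).const_mul (sphereCalc.rotField κ a)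
  refine (hderiv.integral u).congr_deriv ?_
  rw [fluxDensity, neg_mul, ← mul_neg, ← integral_angularMomentum_flux hκ (D.isSTT_shearFn u)
    (D.isSTT_newsFn u) _ _ (D.angularRate_eq u), ← smul_eq_mul, ← map_smul, Finset.smul_sum]
  congr 1
  refine Finset.sum_congr rfl fun a _ => ContMDiffMap.ext fun x => ?_
  simp only [SmoothFn.mul_apply, SmoothFn.sub_apply, SmoothFn.smul_apply, SmoothFn.add_apply,
    SmoothFn.ofNat_apply, SmoothFn.sum_apply, Finset.sum_add_distrib]
  ring

/-- The mass aspect without its part that is linear in the shear. Only this nonlinear part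
contributes to the angular and to the linear momentum, and its flux is quadratic in the news. -/
def nonlinearMass (u : ℝ) : SmoothFn :=
  D.massAspect u - (1 / 4 : ℝ) • sphereCalc.divDiv fun a b => D.shearFn a b u

/-- The retarded-time derivative of `nonlinearMass`. -/
def nonlinearMassRate (u : ℝ) : SmoothFn :=
  (-(1 / 8) : ℝ) • ∑ a, ∑ b, D.newsFn a b u * D.newsFn a b u

/-- The Chen–Wang–Yau angular momentum along the rotation generated by `κ`, for the closed potential
`c` of the shear. The mass aspect may be replaced by its nonlinear part in this integral. -/
def angularMomentum (κ : Fin 3 → Fin 3 → ℝ) (c : SmoothFn) (u : ℝ) : ℝ :=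
  D.localJ κ u - sphereCalc.integral (c * sphereCalc.rot κ (D.nonlinearMass u))

lemma hasTimeDeriv_nonlinearMass : HasTimeDeriv D.nonlinearMass D.nonlinearMassRate := by
  have hrate : D.nonlinearMassRate = fun u =>
      D.massRate u - (1 / 4 : ℝ) • sphereCalc.divDiv fun a b => D.newsFn a b u := by
    refine funext fun u => ContMDiffMap.ext fun x => ?_
    have hevol : D.massRate u x = _ := D.evol_m u x
    have hdiv : div1 (div2 (news D.C u)) x = sphereCalc.divDiv (fun a b => D.newsFn a b u) x := by
      rw [D.div2_news, div1_eq_sum_D, (D.isSTT_newsFn u).tangentDiv_eq, divDiv]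
    simp only [SmoothFn.sub_apply, hevol, hdiv, nonlinearMassRate, SmoothFn.smul_apply,
      SmoothFn.sum_apply, SmoothFn.mul_apply, D.newsFn_apply, sq]
    ring
  rw [hrate]
  exact D.hasTimeDeriv_massAspect.sub
    ((HasTimeDeriv.divDiv D.hasTimeDeriv_shearFn).const_smul (1 / 4))

end NullInfinityData

namespace IsPotentialPair

variable {D : NullInfinityData} {u : ℝ}

lemma isClosedPotential {c c' : S2 → ℝ} (h : IsPotentialPair (D.C u) c c') :
    IsClosedPotential (fun a b => D.shearFn a b u) (.mk h.smooth_c) := by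
  refine ⟨D.isSTT_shearFn u, ?_, h.supported_c⟩
  refine biLaplacian_of_potential (c' := .mk h.smooth_cu) fun a b => ContMDiffMap.ext fun x => ?_
  have hshear : D.shearFn a b u x = _ := h.eq x a b
  have hhess (e b : Fin 3) : hess c x e b = sphereCalc.hessian (.mk h.smooth_c) e b x :=
    hess_eq_hessian (.mk h.smooth_c) x e b
  have hhess' (e b : Fin 3) : hess c' x e b = sphereCalc.hessian (.mk h.smooth_cu) e b x :=
    hess_eq_hessian (.mk h.smooth_cu) x e b
  have hlap : lap c x = sphereCalc.laplacian (.mk h.smooth_c) x :=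
    lap_eq_laplacian (.mk h.smooth_c) x
  simp only [SmoothFn.mul_apply, SmoothFn.ofNat_apply, hshear, hhess, hhess', hlap, electricShear,
    magneticShear, SmoothFn.add_apply, SmoothFn.sub_apply, SmoothFn.sum_apply, sphereCalc_metric,
    sphereCalc_volForm]
  ring

lemma massAspect_eq {c c' : S2 → ℝ} (h : IsPotentialPair (D.C u) c c') : D.massAspect u =
    D.nonlinearMass u + (1 / 8 : ℝ) • sphereCalc.biLaplacian (.mk h.smooth_c) := by
  refine ContMDiffMap.ext fun x => ?_
  rw [h.isClosedPotential.biLaplacian_eq]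
  simp only [NullInfinityData.nonlinearMass, SmoothFn.add_apply, SmoothFn.sub_apply,
    SmoothFn.smul_apply, SmoothFn.mul_apply, SmoothFn.ofNat_apply]
  ring

lemma cwyAngularMomentum_eq_massAspect {c : ℝ → S2 → ℝ} {c' : S2 → ℝ}
    (h : IsPotentialPair (D.C u) (c u) c') (k : Fin 3) :
    cwyAngularMomentum D c k u = D.localJ (axis k) u -
      sphereCalc.integral (.mk h.smooth_c * sphereCalc.rot (axis k) (D.massAspect u)) := by
  rw [NullInfinityData.localJ, ← map_sub, sphereCalc_integral, cwyAngularMomentum]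
  congr 1
  funext x
  simp only [SmoothFn.sub_apply, SmoothFn.sum_apply, SmoothFn.mul_apply, SmoothFn.smul_apply,
    rot_apply, ← rotField_axis_apply, D.div2_shear, Finset.mul_sum, ← Finset.sum_sub_distrib,
    sphereCalc_D]
  refine Finset.sum_congr rfl fun a _ => ?_
  have hangular : D.angularAspect a u x = D.NA u x a := rfl
  have hshear (d : Fin 3) : D.shearFn a d u x = D.C u x a d := rfl
  have hmass : grad0 (D.massAspect u) x a = grad0 (D.m u) x a := rfl
  simp only [hangular, hmass, hshear, SmoothFn.mk_apply, mul_sub, ← Finset.mul_sum]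
  ring

lemma cwyAngularMomentum_eq {c : ℝ → S2 → ℝ} {c' : S2 → ℝ} (h : IsPotentialPair (D.C u) (c u) c')
    (k : Fin 3) : cwyAngularMomentum D c k u = D.angularMomentum (axis k) (.mk h.smooth_c) u := by
  rw [h.cwyAngularMomentum_eq_massAspect, h.massAspect_eq, map_add, Derivation.map_smul, mul_add,
    map_add, mul_smul_comm, map_smul, integral_mul_rot_biLaplacian (isSkew_axis k), smul_zero,
    add_zero, NullInfinityData.angularMomentum]

end IsPotentialPair

lemma linearMomentum_eq (D : NullInfinityData) (k : Fin 3) (u : ℝ) :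
    linearMomentum D k u = 2 * sphereCalc.integral (D.nonlinearMass u * sphereCalc.X k) := by
  have hlinear := (D.isSTT_shearFn u).integral_sum_mul_electricShear (sphereCalc.X k)
  simp only [electricShear_X, mul_zero, Finset.sum_const_zero, map_zero, zero_eq_mul,
    OfNat.ofNat_ne_zero, false_or] at hlinear
  have hmass : linearMomentum D k u =
      sphereCalc.integral ((2 : ℝ) • (D.massAspect u * sphereCalc.X k)) := by
    rw [linearMomentum, sphereCalc_integral]
    congr 1
    funext x
    simp only [SmoothFn.smul_apply, SmoothFn.mul_apply, sphereCalc_X, ← mul_assoc]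
    rfl
  rw [hmass, NullInfinityData.nonlinearMass, sub_mul, map_sub, smul_mul_assoc, map_smul, map_smul,
    hlinear, smul_zero, sub_zero, smul_eq_mul]

/-! ### Consequences of the decay of the news -/

namespace NullInfinityData

/-- The decay of the news and of the ambient components of its angular derivative. -/
structure Falloff (D : NullInfinityData) (ε : ℝ) : Prop where
  pos : 0 < ε
  news : ∀ a b, Decays ε (D.newsFn a b)
  grad : ∀ d a b, Decays ε fun u => sphereCalc.D d (D.newsFn a b u)

end NullInfinityData

lemma NewsDecay.exists_falloff {D : NullInfinityData} (h : NewsDecay D) : ∃ ε, D.Falloff ε := by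
  obtain ⟨ε, hε, hnews, hgrad⟩ := h
  have hdecay (a b : Fin 3) : Decays ε (D.newsFn a b) :=
    .of_isBigO hε (D.hasTimeDeriv_newsFn a b).continuous (hnews a b)
  refine ⟨ε, hε, hdecay, fun d b c => ?_⟩
  have hcov : Decays ε fun u => ∑ a, ∑ e, sphereCalc.metric b a * sphereCalc.metric c e *
      sphereCalc.D d (D.newsFn a e u) := by
    refine .of_isBigO hε (HasTimeDeriv.sum fun a _ => HasTimeDeriv.sum fun e _ =>
      ((D.hasTimeDeriv_newsFn a e).D d).const_mul _).continuous ?_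
    simpa only [D.grad2_news] using hgrad d b c
  simp only [(D.isSTT_newsFn _).D_eq d b c, sub_eq_add_neg, ← neg_mul]
  exact (hcov.add ((hdecay d c).const_mul _)).add ((hdecay b d).const_mul _)

namespace NullInfinityData.Falloff

variable {D : NullInfinityData} {ε : ℝ} (h : D.Falloff ε) (κ : Fin 3 → Fin 3 → ℝ)
include h

lemma rot_news (a b : Fin 3) : Decays ε fun u => sphereCalc.rot κ (D.newsFn a b u) := by
  simp only [rot_apply]
  exact .sum fun d _ => (h.grad d a b).const_mul _

lemma lieRot_news (a b : Fin 3) :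
    Decays ε fun u => sphereCalc.lieRot κ (fun a b => D.newsFn a b u) a b :=
  ((h.rot_news κ a b).add (.sum fun d _ => (h.news d b).const_mul _)).add
    (.sum fun d _ => (h.news a d).const_mul _)

lemma weightLipschitz_shearFn (a b : Fin 3) : WeightLipschitz ε fun u x => D.shearFn a b u x :=
  .of_decays (D.hasTimeDeriv_shearFn a b).hasDerivAt (h.news a b)

lemma uniformlyBounded_lieRot_shearFn (a b : Fin 3) :
    UniformlyBounded fun u => sphereCalc.lieRot κ (fun a b => D.shearFn a b u) a b :=
  (WeightLipschitz.of_decays (HasTimeDeriv.lieRot D.hasTimeDeriv_shearFn κ a b).hasDerivAt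
    (h.lieRot_news κ a b)).uniformlyBounded h.pos

lemma fluxDensity : Decays ε (D.fluxDensity κ) :=
  .sum fun a _ => .sum fun b _ =>
    (h.news a b).mul_bounded (h.uniformlyBounded_lieRot_shearFn κ a b)

lemma nonlinearMassRate : Decays ε D.nonlinearMassRate :=
  (Decays.sum fun a _ => .sum fun b _ =>
    (h.news a b).mul_bounded ((h.news a b).uniformlyBounded h.pos)).const_smul _

lemma rot_nonlinearMassRate : Decays ε fun u => sphereCalc.rot κ (D.nonlinearMassRate u) := by
  simp only [NullInfinityData.nonlinearMassRate, Derivation.map_smul, map_sum, rot_mul]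
  refine (Decays.sum fun a _ => .sum fun b _ => ?_).const_smul _
  have hbdd := (h.news a b).uniformlyBounded h.pos
  have hprod := (h.rot_news κ a b).mul_bounded hbdd
  exact hprod.add (by simpa only [mul_comm] using hprod)

lemma weightLipschitz_nonlinearMass : WeightLipschitz ε fun u x => D.nonlinearMass u x :=
  .of_decays D.hasTimeDeriv_nonlinearMass.hasDerivAt h.nonlinearMassRate

lemma weightLipschitz_rot_nonlinearMass :
    WeightLipschitz ε fun u x => sphereCalc.rot κ (D.nonlinearMass u) x :=
  .of_decays (D.hasTimeDeriv_nonlinearMass.rot κ).hasDerivAt (h.rot_nonlinearMassRate κ)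

lemma exists_tendsto_localJ (hκ : IsSkew κ) {l : Filter ℝ} (hl : IsEnd ε l) :
    ∃ j, Tendsto (D.localJ κ) l (𝓝 j) := by
  obtain ⟨K, -, hK⟩ := (h.fluxDensity κ).exists_bound
  refine hl.exists_tendsto_of_dist_le (K := 1 / 4 * (K * areaS2.real Set.univ)) fun u v => ?_
  refine abs_sub_le_weightIntegral (D.hasDerivAt_localJ hκ) (fun s => ?_) u v
  have hle : |sphereCalc.integral (D.fluxDensity κ s)| ≤ K * weight ε s * areaS2.real Set.univ :=
    norm_integral_le_of_norm_le_const (μ := areaS2) (f := D.fluxDensity κ s)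
      (Eventually.of_forall fun x => hK s x)
  rw [abs_mul, abs_neg, abs_of_pos (by norm_num : (0 : ℝ) < 1 / 4)]
  linarith

end NullInfinityData.Falloff

/-! ### Fluxes that agree up to a shift of retarded time -/

/-- The primitive, in retarded time, of a family of functions on the sphere. -/
def timePrimitive (F : ℝ → S2 → ℝ) (u : ℝ) (x : S2) : ℝ := ∫ s in (0 : ℝ)..u, F s x

lemma hasDerivAt_timePrimitive {F : ℝ → S2 → ℝ} (hF : Continuous fun p : ℝ × S2 => F p.1 p.2)
    (u : ℝ) (x : S2) : HasDerivAt (fun s => timePrimitive F s x) (F u x) u :=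
  ((hF.comp (Continuous.prodMk_left x)).integral_hasStrictDerivAt 0 u).hasDerivAt

lemma continuous_timePrimitive {F : ℝ → S2 → ℝ} (hF : Continuous fun p : ℝ × S2 => F p.1 p.2) :
    Continuous fun p : ℝ × S2 => timePrimitive F p.1 p.2 :=
  intervalIntegral.continuous_parametric_intervalIntegral_of_continuous
    (f := fun (p : ℝ × S2) s => F s p.2)
    (hF.comp (continuous_snd.prodMk (continuous_snd.comp continuous_fst))) continuous_fst

lemma hasDerivAt_integralS2_shift {F F' : ℝ → S2 → ℝ}
    (hF : Continuous fun p : ℝ × S2 => F p.1 p.2) (hF' : Continuous fun p : ℝ × S2 => F' p.1 p.2)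
    (hderiv : ∀ u x, HasDerivAt (fun s => F s x) (F' u x) u) {f : S2 → ℝ} (hf : Continuous f)
    (u : ℝ) : HasDerivAt (fun s => integralS2 fun x => F (s + f x) x)
      (integralS2 fun x => F' (u + f x) x) u := by
  have hshift : Continuous fun p : ℝ × S2 => (p.1 + f p.2, p.2) :=
    (continuous_fst.add (hf.comp continuous_snd)).prodMk continuous_snd
  exact hasDerivAt_integralS2 (F := fun s x => F (s + f x) x) (F' := fun s x => F' (s + f x) x)
    (fun s => (hF.comp hshift).comp (Continuous.prodMk_right s))
    (hF'.comp hshift) (fun s x => (hderiv (s + f x) x).comp_add_const s (f x)) u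

lemma exists_eq_add_const_of_hasDerivAt {φ ψ φ' : ℝ → ℝ} (hφ : ∀ u, HasDerivAt φ (φ' u) u)
    (hψ : ∀ u, HasDerivAt ψ (φ' u) u) : ∃ K, ∀ u, φ u = ψ u + K := by
  have hsub (u : ℝ) : HasDerivAt (fun s => φ s - ψ s) 0 u :=
    ((hφ u).sub (hψ u)).congr_deriv (sub_self _)
  refine ⟨φ 0 - ψ 0, fun u => ?_⟩
  linarith [is_const_of_deriv_eq_zero (fun s => (hsub s).differentiableAt)
    (fun s => (hsub s).deriv) u 0]

lemma exists_tendsto_sub_of_shifted_flux {ε r : ℝ} {F E E' : ℝ → SmoothFn} {f : SmoothFn}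
    {J J' : ℝ → ℝ} (hFc : Continuous fun p : ℝ × S2 => F p.1 p.2) (hF : Decays ε F)
    (hE : HasTimeDeriv E E') (hE' : Decays ε E')
    (hJ : ∀ u, HasDerivAt J (r * integralS2 (F u)) u)
    (hJ' : ∀ u, HasDerivAt J' (r * integralS2 fun x => F (u + f x) x + E' (u + f x) x) u) :
    ∃ K, ∀ l, IsEnd ε l → Tendsto (fun u => J' u - J u - r * integralS2 (E u)) l (𝓝 K) := by
  set P : ℝ → S2 → ℝ := timePrimitive fun u x => F u x
  have hPc : Continuous fun p : ℝ × S2 => P p.1 p.2 := continuous_timePrimitive hFc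
  have hPu (u : ℝ) : Continuous (P u) := hPc.comp (Continuous.prodMk_right u)
  have hP (u : ℝ) (x : S2) : HasDerivAt (fun s => P s x) (F u x) u :=
    hasDerivAt_timePrimitive hFc u x
  have hPE (u : ℝ) (x : S2) : HasDerivAt (fun s => P s x + E s x) ((F u + E' u) x) u :=
    (hP u x).add (hE.hasDerivAt u x)
  have hPEc : Continuous fun p : ℝ × S2 => P p.1 p.2 + E p.1 p.2 := hPc.add hE.continuous
  obtain ⟨K, hK⟩ := exists_eq_add_const_of_hasDerivAt hJ
    fun u => (hasDerivAt_integralS2 hPu hFc hP u).const_mul r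
  obtain ⟨K', hK'⟩ := exists_eq_add_const_of_hasDerivAt hJ' fun u =>
    (hasDerivAt_integralS2_shift hPEc (hFc.add hE.continuous') hPE
      f.smoothS2.continuous u).const_mul r
  refine ⟨K' - K, fun l hl => ?_⟩
  have hshift := (WeightLipschitz.of_decays hPE (hF.add hE')).tendsto_integral_shift_sub hPEc f hl
  have hlim := (hshift.const_mul r).add_const (K' - K)
  rw [mul_zero, zero_add] at hlim
  refine hlim.congr fun u => ?_
  have hsplit : integralS2 (fun x => P u x + E u x) = integralS2 (P u) + integralS2 (E u) :=
    integral_add (integrable_areaS2 (hPu u)) (E u).integrable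
  rw [hK, hK', hsplit]
  ring

/-! ### Supertranslations -/

namespace SphereCalculus

variable {A : Type*} [CommRing A] [Algebra ℝ A] {S : SphereCalculus A}

lemma IsSTT.sum_mul_hessian {T : Fin 3 → Fin 3 → A} (hT : S.IsSTT T) (F : A) :
    ∑ a, ∑ b, T a b * S.hessian F a b = ∑ a, ∑ b, T a b * S.D a (S.D b F) := by
  have hnormal (a : Fin 3) : ∑ b, T a b * (S.X b * S.D a F) = 0 := by
    rw [← zero_mul (S.D a F), ← hT.sum_mul_X a, Finset.sum_mul]
    exact Finset.sum_congr rfl fun b _ => by ring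
  simp only [hessian, mul_add, Finset.sum_add_distrib, hnormal, add_zero]

lemma biLaplacian_algebraMap (r : ℝ) : S.biLaplacian (algebraMap ℝ A r) = 0 := by
  rw [← divDiv_electricShear]
  simp only [divDiv, div, electricShear_algebraMap, map_zero, Finset.sum_const_zero]

lemma biLaplacian_X (k : Fin 3) : S.biLaplacian (S.X k) = 0 := by
  rw [← divDiv_electricShear]
  simp only [divDiv, div, electricShear_X, map_zero, Finset.sum_const_zero]

end SphereCalculus

/-- The family `F` at the retarded time `u + f`. -/
def SmoothFn.shift {F : ℝ → SmoothFn} (hF : SmoothScri fun u x => F u x) (f : SmoothFn) (u : ℝ) :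
    SmoothFn :=
  .mk ((hF.comp_add f.smoothS2).smoothS2 u)

@[simp]
lemma SmoothFn.shift_apply {F : ℝ → SmoothFn} (hF : SmoothScri fun u x => F u x) (f : SmoothFn)
    (u : ℝ) (x : S2) : SmoothFn.shift hF f u x = F (u + f x) x := rfl

namespace HasTimeDeriv

lemma D_shift {F F' : ℝ → SmoothFn} (hF : HasTimeDeriv F F') (f : SmoothFn) (u : ℝ) (a : Fin 3) :
    sphereCalc.D a (.shift hF.smooth f u) =
      .shift (hF.D a).smooth f u + .shift hF.smooth' f u * sphereCalc.D a f := by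
  refine ContMDiffMap.ext fun x => ?_
  have hchain := hF.smooth.grad0_comp_add f.smoothS2 u x a
  rw [hF.timeDeriv_eq] at hchain
  exact hchain

lemma rot_shift {F F' : ℝ → SmoothFn} (hF : HasTimeDeriv F F') (f : SmoothFn) (u : ℝ)
    (κ : Fin 3 → Fin 3 → ℝ) : sphereCalc.rot κ (.shift hF.smooth f u) =
      .shift (hF.rot κ).smooth f u + .shift hF.smooth' f u * sphereCalc.rot κ f := by
  refine ContMDiffMap.ext fun x => ?_
  simp only [rot_apply, hF.D_shift, SmoothFn.add_apply, SmoothFn.mul_apply, SmoothFn.sum_apply,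
    SmoothFn.shift_apply, Finset.mul_sum, ← Finset.sum_add_distrib]
  exact Finset.sum_congr rfl fun a _ => by ring

lemma lieRot_shift_apply {T T' : Fin 3 → Fin 3 → ℝ → SmoothFn}
    (hT : ∀ a b, HasTimeDeriv (T a b) (T' a b)) (f : SmoothFn) (κ : Fin 3 → Fin 3 → ℝ) (u : ℝ)
    (x : S2) (a b : Fin 3) :
    sphereCalc.lieRot κ (fun a b => .shift (hT a b).smooth f u) a b x =
      sphereCalc.lieRot κ (fun a b => T a b (u + f x)) a b x +
      T' a b (u + f x) x * sphereCalc.rot κ f x := by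
  simp only [SphereCalculus.lieRot, (hT a b).rot_shift, SmoothFn.add_apply, SmoothFn.mul_apply,
    SmoothFn.sum_apply, SmoothFn.shift_apply]
  ring

lemma D_D_shift_apply {F F' F'' : ℝ → SmoothFn} (hF : HasTimeDeriv F F')
    (hF' : HasTimeDeriv F' F'') (f : SmoothFn) (u : ℝ) (x : S2) (a b : Fin 3) :
    sphereCalc.D b (sphereCalc.D a (.shift hF.smooth f u)) x =
      sphereCalc.D b (sphereCalc.D a (F (u + f x))) x +
      sphereCalc.D a (F' (u + f x)) x * sphereCalc.D b f x +
      sphereCalc.D b (F' (u + f x)) x * sphereCalc.D a f x +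
      F'' (u + f x) x * sphereCalc.D a f x * sphereCalc.D b f x +
      F' (u + f x) x * sphereCalc.D b (sphereCalc.D a f) x := by
  rw [hF.D_shift, map_add, D_mul, (hF.D a).D_shift, hF'.D_shift]
  simp only [SmoothFn.add_apply, SmoothFn.mul_apply, SmoothFn.shift_apply]
  ring

lemma divDiv_shift_apply {T T' T'' : Fin 3 → Fin 3 → ℝ → SmoothFn}
    (hT : ∀ a b, HasTimeDeriv (T a b) (T' a b)) (hT' : ∀ a b, HasTimeDeriv (T' a b) (T'' a b))
    (hSTT : ∀ u, sphereCalc.IsSTT fun a b => T' a b u) (f : SmoothFn) (u : ℝ) (x : S2) :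
    sphereCalc.divDiv (fun a b => .shift (hT a b).smooth f u) x =
      sphereCalc.divDiv (fun a b => T a b (u + f x)) x +
      2 * ∑ b, sphereCalc.div (fun a b => T' a b (u + f x)) b x * sphereCalc.D b f x +
      ∑ a, ∑ b, T'' a b (u + f x) x * sphereCalc.D a f x * sphereCalc.D b f x +
      ∑ a, ∑ b, T' a b (u + f x) x * sphereCalc.hessian f a b x := by
  have hhess := congrArg (fun F : SmoothFn => F x) ((hSTT (u + f x)).sum_mul_hessian f)
  simp only [SmoothFn.sum_apply, SmoothFn.mul_apply] at hhess
  have hsymm : ∑ a, ∑ b, sphereCalc.D b (T' a b (u + f x)) x * sphereCalc.D a f x =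
      ∑ b, ∑ a, sphereCalc.D a (T' a b (u + f x)) x * sphereCalc.D b f x := by
    simp only [(hSTT (u + f x)).symm]
  have hsymm' : ∑ a, ∑ b, T' a b (u + f x) x * sphereCalc.D a (sphereCalc.D b f) x =
      ∑ b, ∑ a, T' a b (u + f x) x * sphereCalc.D b (sphereCalc.D a f) x := by
    simp only [(hSTT (u + f x)).symm]
  rw [hhess, hsymm', Finset.sum_comm (f := fun a b =>
    T'' a b (u + f x) x * sphereCalc.D a f x * sphereCalc.D b f x)]
  simp only [SphereCalculus.divDiv, div, map_sum, SmoothFn.sum_apply,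
    D_D_shift_apply (hT _ _) (hT' _ _), Finset.sum_add_distrib, Finset.sum_mul]
  rw [Finset.sum_comm (f := fun b a => sphereCalc.D b (T' a b (u + f x)) x * sphereCalc.D a f x),
    hsymm]
  ring

end HasTimeDeriv

namespace IsSupertranslation

open NullInfinityData

variable {D D' : NullInfinityData} {f : SmoothFn} (h : IsSupertranslation f D D')
include h

lemma shearFn_eq (a b : Fin 3) (u : ℝ) : D'.shearFn a b u =
    .shift (D.hasTimeDeriv_shearFn a b).smooth f u - sphereCalc.electricShear f a b := by
  refine ContMDiffMap.ext fun x => ?_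
  have htransform : D'.shearFn a b u x = _ := h.shear u x a b
  have hshear : D.C (u + f x) x a b = D.shearFn a b (u + f x) x := rfl
  rw [htransform, hess_eq_hessian, lap_eq_laplacian, hshear]
  simp only [electricShear, SmoothFn.sub_apply, SmoothFn.mul_apply, SmoothFn.ofNat_apply,
    sphereCalc_metric, SmoothFn.shift_apply]
  ring

lemma newsFn_apply (a b : Fin 3) (u : ℝ) (x : S2) :
    D'.newsFn a b u x = D.newsFn a b (u + f x) x := by
  have hderiv := (D'.hasTimeDeriv_shearFn a b).hasDerivAt u x
  simp only [h.shearFn_eq, SmoothFn.sub_apply, SmoothFn.shift_apply] at hderiv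
  exact hderiv.unique
    ((((D.hasTimeDeriv_shearFn a b).hasDerivAt (u + f x) x).comp_add_const u (f x)).sub_const _)

lemma massAspect_apply (u : ℝ) (x : S2) : D'.massAspect u x = D.massAspect (u + f x) x
    + 1 / 2 * ∑ b, sphereCalc.div (fun a b => D.newsFn a b (u + f x)) b x * sphereCalc.D b f x
    + 1 / 4 * ∑ a, ∑ b, D.newsRate a b (u + f x) x * sphereCalc.D a f x * sphereCalc.D b f x
    + 1 / 4 * ∑ a, ∑ b, D.newsFn a b (u + f x) x * sphereCalc.hessian f a b x := by
  have htransform : D'.massAspect u x = _ := h.mass u x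
  simp only [hess_eq_hessian, D.div2_news, (D.isSTT_newsFn _).tangentDiv_eq] at htransform
  exact htransform

lemma nonlinearMass_eq (u : ℝ) : D'.nonlinearMass u =
    .shift D.hasTimeDeriv_nonlinearMass.smooth f u +
      (1 / 4 : ℝ) • sphereCalc.biLaplacian f := by
  refine ContMDiffMap.ext fun x => ?_
  have hdivDiv := divDiv_sub (S := sphereCalc)
    (T := fun a b => .shift (D.hasTimeDeriv_shearFn a b).smooth f u)
    (U := sphereCalc.electricShear f)
  simp only [nonlinearMass, h.shearFn_eq, hdivDiv, divDiv_electricShear, SmoothFn.sub_apply,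
    SmoothFn.smul_apply, SmoothFn.add_apply, SmoothFn.shift_apply, h.massAspect_apply,
    HasTimeDeriv.divDiv_shift_apply D.hasTimeDeriv_shearFn D.hasTimeDeriv_newsFn D.isSTT_newsFn]
  ring

lemma rot_nonlinearMass_eq (κ : Fin 3 → Fin 3 → ℝ) (u : ℝ) :
    sphereCalc.rot κ (D'.nonlinearMass u) =
      .shift (D.hasTimeDeriv_nonlinearMass.rot κ).smooth f u +
      .shift D.hasTimeDeriv_nonlinearMass.smooth' f u * sphereCalc.rot κ f +
      (1 / 4 : ℝ) • sphereCalc.rot κ (sphereCalc.biLaplacian f) := by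
  rw [h.nonlinearMass_eq, map_add, D.hasTimeDeriv_nonlinearMass.rot_shift, Derivation.map_smul]

end IsSupertranslation

namespace NullInfinityData

variable (D : NullInfinityData) (κ : Fin 3 → Fin 3 → ℝ) (f : SmoothFn)

/-- The part of the flux density of the data supertranslated by `f` that depends on `f`, taken at
the unshifted retarded time. -/
def excessFlux (u : ℝ) : SmoothFn :=
  ∑ a, ∑ b, (D.newsFn a b u * D.newsFn a b u * sphereCalc.rot κ f
    - D.newsFn a b u * sphereCalc.lieRot κ (sphereCalc.electricShear f) a b)

/-- A primitive of `excessFlux` in retarded time. -/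
def excessFluxPrimitive (u : ℝ) : SmoothFn :=
  (-8 : ℝ) • (D.nonlinearMass u * sphereCalc.rot κ f)
    - ∑ a, ∑ b, D.shearFn a b u * sphereCalc.lieRot κ (sphereCalc.electricShear f) a b

lemma hasTimeDeriv_excessFluxPrimitive :
    HasTimeDeriv (D.excessFluxPrimitive κ f) (D.excessFlux κ f) := by
  have hmass : HasTimeDeriv (fun u => D.nonlinearMass u * sphereCalc.rot κ f)
      fun u => D.nonlinearMassRate u * sphereCalc.rot κ f := by
    simpa only [mul_comm] using D.hasTimeDeriv_nonlinearMass.const_mul (sphereCalc.rot κ f)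
  have hshear (a b : Fin 3) : HasTimeDeriv
      (fun u => D.shearFn a b u * sphereCalc.lieRot κ (sphereCalc.electricShear f) a b)
      fun u => D.newsFn a b u * sphereCalc.lieRot κ (sphereCalc.electricShear f) a b := by
    simpa only [mul_comm] using (D.hasTimeDeriv_shearFn a b).const_mul
      (sphereCalc.lieRot κ (sphereCalc.electricShear f) a b)
  have hrate : D.excessFlux κ f = fun u => (-8 : ℝ) • (D.nonlinearMassRate u * sphereCalc.rot κ f)
      - ∑ a, ∑ b, D.newsFn a b u * sphereCalc.lieRot κ (sphereCalc.electricShear f) a b := by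
    refine funext fun u => ?_
    simp only [excessFlux, nonlinearMassRate, Finset.sum_sub_distrib, ← Finset.sum_mul,
      smul_mul_assoc, smul_smul]
    norm_num
  rw [hrate]
  exact (hmass.const_smul (-8)).sub (.sum fun a _ => .sum fun b _ => hshear a b)

lemma continuous_fluxDensity : Continuous fun p : ℝ × S2 => D.fluxDensity κ p.1 p.2 :=
  (HasTimeDeriv.sum fun a _ => .sum fun b _ => (D.hasTimeDeriv_newsFn a b).mul
    (.lieRot D.hasTimeDeriv_shearFn κ a b)).continuous

variable {D κ}

lemma integral_excessFluxPrimitive (hκ : IsSkew κ) {u : ℝ} {c : SmoothFn}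
    (hc : IsClosedPotential (fun a b => D.shearFn a b u) c) :
    sphereCalc.integral (D.excessFluxPrimitive κ f u) =
      -8 * sphereCalc.integral (D.nonlinearMass u * sphereCalc.rot κ f)
      - sphereCalc.integral (c * sphereCalc.rot κ (sphereCalc.biLaplacian f)) := by
  rw [excessFluxPrimitive, map_sub, map_smul, smul_eq_mul,
    integral_sum_mul_lieRot_electricShear hκ hc.isSTT hc.biLaplacian_eq]

lemma Falloff.excessFlux {ε : ℝ} (h : D.Falloff ε) (κ : Fin 3 → Fin 3 → ℝ) :
    Decays ε (D.excessFlux κ f) := by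
  refine .sum fun a _ => .sum fun b _ => ?_
  simp only [sub_eq_add_neg, ← mul_neg]
  exact (((h.news a b).mul_bounded ((h.news a b).uniformlyBounded h.pos)).mul_bounded
    (sphereCalc.rot κ f).uniformlyBounded).add ((h.news a b).mul_bounded
      (-sphereCalc.lieRot κ (sphereCalc.electricShear f) a b).uniformlyBounded)

end NullInfinityData

namespace IsSupertranslation

open NullInfinityData

variable {D D' : NullInfinityData} {f : SmoothFn} (h : IsSupertranslation f D D') {ε : ℝ}
  (hD : D.Falloff ε) {κ : Fin 3 → Fin 3 → ℝ}
include h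

lemma fluxDensity_apply (κ : Fin 3 → Fin 3 → ℝ) (u : ℝ) (x : S2) :
    D'.fluxDensity κ u x = D.fluxDensity κ (u + f x) x + D.excessFlux κ f (u + f x) x := by
  have hlie (a b : Fin 3) : sphereCalc.lieRot κ (fun a b => D'.shearFn a b u) a b x =
      sphereCalc.lieRot κ (fun a b => D.shearFn a b (u + f x)) a b x +
        D.newsFn a b (u + f x) x * sphereCalc.rot κ f x -
        sphereCalc.lieRot κ (sphereCalc.electricShear f) a b x := by
    simp only [h.shearFn_eq, lieRot_sub, SmoothFn.sub_apply,
      HasTimeDeriv.lieRot_shift_apply D.hasTimeDeriv_shearFn]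
  simp only [fluxDensity, excessFlux, SmoothFn.sum_apply, SmoothFn.sub_apply, SmoothFn.mul_apply,
    h.newsFn_apply, hlie, ← Finset.sum_add_distrib]
  exact Finset.sum_congr rfl fun a _ => Finset.sum_congr rfl fun b _ => by ring

include hD

lemma exists_tendsto_localJ_sub (hκ : IsSkew κ) : ∃ K, ∀ l, IsEnd ε l → Tendsto (fun u =>
    D'.localJ κ u - D.localJ κ u + 1 / 4 * sphereCalc.integral (D.excessFluxPrimitive κ f u)) l
      (𝓝 K) := by
  have hflux (u : ℝ) : HasDerivAt (D'.localJ κ) (-(1 / 4) * integralS2 fun x =>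
      D.fluxDensity κ (u + f x) x + D.excessFlux κ f (u + f x) x) u := by
    simp only [← h.fluxDensity_apply]
    exact D'.hasDerivAt_localJ hκ u
  obtain ⟨K, hK⟩ := exists_tendsto_sub_of_shifted_flux (D.continuous_fluxDensity κ)
    (hD.fluxDensity κ) (D.hasTimeDeriv_excessFluxPrimitive κ f) (hD.excessFlux f κ)
    (D.hasDerivAt_localJ hκ) hflux
  refine ⟨K, fun l hl => (hK l hl).congr fun u => ?_⟩
  rw [sphereCalc_integral]
  ring

variable {l : Filter ℝ} (hl : IsEnd ε l)
include hl

lemma tendsto_rot_nonlinearMass_sub : Tendsto (fun u => (sphereCalc.rot κ (D'.nonlinearMass u) -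
    sphereCalc.rot κ (D.nonlinearMass u)).toL2) l
      (𝓝 ((1 / 4 : ℝ) • (sphereCalc.rot κ (sphereCalc.biLaplacian f)).toL2)) := by
  have hshift := (hD.weightLipschitz_rot_nonlinearMass κ).tendsto_toL2_shift_sub f
    (SmoothFn.shift_apply (D.hasTimeDeriv_nonlinearMass.rot κ).smooth f) hl
  have hrate := ((hD.nonlinearMassRate.shift hD.pos f (SmoothFn.shift_apply
    D.hasTimeDeriv_nonlinearMass.smooth' f)).mul_bounded
      (sphereCalc.rot κ f).uniformlyBounded).tendsto_toL2 hl
  have hlim := (hshift.add hrate).add_const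
    ((1 / 4 : ℝ) • (sphereCalc.rot κ (sphereCalc.biLaplacian f)).toL2)
  rw [add_zero, zero_add] at hlim
  refine hlim.congr fun u => ?_
  rw [h.rot_nonlinearMass_eq]
  simp only [map_add, map_sub, map_smul]
  abel

variable {g : SmoothFn} (hg : SupportedGE2 g)
  (hgf : sphereCalc.biLaplacian g = sphereCalc.biLaplacian f) {c c' : ℝ → SmoothFn}
  (hc : ∀ u, IsClosedPotential (fun a b => D.shearFn a b u) (c u))
  (hc' : ∀ u, IsClosedPotential (fun a b => D'.shearFn a b u) (c' u))
include hg hgf hc hc'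

lemma tendsto_potential_sub :
    Tendsto (fun u => (c' u - c u).toL2) l (𝓝 (-(2 : ℝ) • g.toL2)) := by
  have hf : IsClosedPotential (sphereCalc.electricShear f) ((2 : ℝ) • g) :=
    ⟨isSTT_electricShear f, by
      rw [map_smul, hgf, divDiv_electricShear, ofNat_smul_eq_nsmul, nsmul_eq_mul]; rfl,
      hg.const_smul 2⟩
  have hzero : Tendsto (fun u => (c u - c' u - (2 : ℝ) • g).toL2) l (𝓝 0) := by
    refine IsClosedPotential.tendsto_toL2_zero
      (T := fun a b u => D.shearFn a b u - D'.shearFn a b u - sphereCalc.electricShear f a b)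
      (fun u => ((hc u).sub (hc' u)).sub hf) fun a b => ?_
    have hshift := (hD.weightLipschitz_shearFn a b).tendsto_toL2_shift_sub f
      (SmoothFn.shift_apply (D.hasTimeDeriv_shearFn a b).smooth f) hl
    have hneg := hshift.neg
    rw [neg_zero] at hneg
    refine hneg.congr fun u => ?_
    rw [h.shearFn_eq, ← map_neg]
    congr 1
    ring
  have hlim := hzero.neg.sub_const ((2 : ℝ) • g.toL2)
  rw [neg_zero, zero_sub, ← neg_smul] at hlim
  refine hlim.congr fun u => ?_
  simp only [map_sub, map_smul]
  abel

lemma tendsto_integral_potential_mul_sub (hκ : IsSkew κ) : Tendsto (fun u =>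
    sphereCalc.integral (c' u * sphereCalc.rot κ (D'.nonlinearMass u)) -
      sphereCalc.integral (c u * sphereCalc.rot κ (D.nonlinearMass u)) -
      1 / 4 * sphereCalc.integral (c u * sphereCalc.rot κ (sphereCalc.biLaplacian f)) -
      2 * sphereCalc.integral (D.nonlinearMass u * sphereCalc.rot κ g)) l (𝓝 0) := by
  have := hl.neBot
  obtain ⟨v, hv⟩ := IsClosedPotential.exists_tendsto_toL2 hc fun a b =>
    (hD.weightLipschitz_shearFn a b).exists_tendsto_toL2 hl
  obtain ⟨w, hw⟩ := (hD.weightLipschitz_rot_nonlinearMass κ).exists_tendsto_toL2 hl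
  set H := (sphereCalc.rot κ (sphereCalc.biLaplacian f)).toL2
  have hv' := hv.add (h.tendsto_potential_sub hD hl hg hgf hc hc')
  have hw' := hw.add (h.tendsto_rot_nonlinearMass_sub hD (κ := κ) hl)
  have hgH : inner ℝ g.toL2 H = 0 := by
    rw [SmoothFn.inner_toL2, ← hgf, integral_mul_rot_biLaplacian hκ]
  have hH : Tendsto (fun _ : ℝ => H) l (𝓝 H) := tendsto_const_nhds
  have hg' : Tendsto (fun _ : ℝ => g.toL2) l (𝓝 g.toL2) := tendsto_const_nhds
  have hlim := (((hv'.inner (𝕜 := ℝ) hw').sub (hv.inner (𝕜 := ℝ) hw)).sub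
    ((hv.inner (𝕜 := ℝ) hH).const_mul (1 / 4))).add ((hg'.inner (𝕜 := ℝ) hw).const_mul 2)
  have hvalue : inner ℝ (v + -(2 : ℝ) • g.toL2) (w + (1 / 4 : ℝ) • H) - inner ℝ v w
      - 1 / 4 * inner ℝ v H + 2 * inner ℝ g.toL2 w = 0 := by
    simp only [inner_add_left, inner_add_right, real_inner_smul_left, real_inner_smul_right, hgH]
    ring
  rw [hvalue] at hlim
  refine hlim.congr fun u => ?_
  have hskew : sphereCalc.integral (g * sphereCalc.rot κ (D.nonlinearMass u)) =
      -sphereCalc.integral (D.nonlinearMass u * sphereCalc.rot κ g) := by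
    rw [mul_comm, integral_rot_mul hκ]
  simp only [← map_add, add_sub_cancel, SmoothFn.inner_toL2, H, hskew]
  ring

lemma tendsto_angularMomentum_sub {K : ℝ} (hκ : IsSkew κ) (hK : Tendsto (fun u =>
      D'.localJ κ u - D.localJ κ u + 1 / 4 * sphereCalc.integral (D.excessFluxPrimitive κ f u)) l
        (𝓝 K)) :
    Tendsto (fun u => D'.angularMomentum κ (c' u) u - D.angularMomentum κ (c u) u -
      2 * sphereCalc.integral (D.nonlinearMass u * sphereCalc.rot κ (f - g))) l (𝓝 K) := by
  have hlim := hK.sub (h.tendsto_integral_potential_mul_sub hD hl hg hgf hc hc' hκ)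
  rw [sub_zero] at hlim
  refine hlim.congr fun u => ?_
  simp only [integral_excessFluxPrimitive f hκ (hc u), angularMomentum, map_sub, mul_sub]
  ring

end IsSupertranslation

namespace NullInfinityData

lemma two_mul_integral_nonlinearMass_mul_rot (D : NullInfinityData) (α₀ : ℝ) (α : Fin 3 → ℝ)
    (k : Fin 3) (u : ℝ) :
    2 * sphereCalc.integral (D.nonlinearMass u * sphereCalc.rot (axis k)
      (algebraMap ℝ SmoothFn α₀ + ∑ i, α i • sphereCalc.X i)) =
      ∑ i, ∑ j, α i * leviCivita i k j * linearMomentum D j u := by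
  simp only [map_add, Derivation.map_algebraMap, zero_add, map_sum, Derivation.map_smul, rot_axis_X,
    Finset.smul_sum, smul_smul, Finset.mul_sum, mul_smul_comm, map_smul, smul_eq_mul,
    linearMomentum_eq]
  exact Finset.sum_congr rfl fun i _ => Finset.sum_congr rfl fun j _ => by ring

namespace Falloff

variable {D : NullInfinityData} {ε : ℝ} (h : D.Falloff ε) {l : Filter ℝ} (hl : IsEnd ε l)
include h hl

lemma exists_tendsto_linearMomentum (k : Fin 3) :
    ∃ p, Tendsto (linearMomentum D k) l (𝓝 p) := by
  obtain ⟨v, hv⟩ := h.weightLipschitz_nonlinearMass.exists_tendsto_toL2 hl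
  refine ⟨2 * inner ℝ v (sphereCalc.X k).toL2,
    ((hv.inner tendsto_const_nhds).const_mul 2).congr fun u => ?_⟩
  rw [linearMomentum_eq, SmoothFn.inner_toL2]

lemma exists_tendsto_angularMomentum {κ : Fin 3 → Fin 3 → ℝ} (hκ : IsSkew κ) {c : ℝ → SmoothFn}
    (hc : ∀ u, IsClosedPotential (fun a b => D.shearFn a b u) (c u)) :
    ∃ j, Tendsto (fun u => D.angularMomentum κ (c u) u) l (𝓝 j) := by
  have := hl.neBot
  obtain ⟨j, hj⟩ := h.exists_tendsto_localJ κ hκ hl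
  obtain ⟨v, hv⟩ := IsClosedPotential.exists_tendsto_toL2 hc fun a b =>
    (h.weightLipschitz_shearFn a b).exists_tendsto_toL2 hl
  obtain ⟨w, hw⟩ := (h.weightLipschitz_rot_nonlinearMass κ).exists_tendsto_toL2 hl
  refine ⟨j - inner ℝ v w, (hj.sub (hv.inner hw)).congr fun u => ?_⟩
  rw [angularMomentum, SmoothFn.inner_toL2]

end Falloff

end NullInfinityData

lemma IsSupertranslation.exists_tendsto_momenta {D D' : NullInfinityData} {ε : ℝ}
    (hD : D.Falloff ε) {α₀ : ℝ} {α : Fin 3 → ℝ} {g : SmoothFn} (hg : SupportedGE2 g)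
    (h : IsSupertranslation
      (algebraMap ℝ SmoothFn α₀ + ∑ i, α i • sphereCalc.X i + g : SmoothFn) D D')
    {c cu c' cu' : ℝ → S2 → ℝ} (hc : ∀ u, IsPotentialPair (D.C u) (c u) (cu u))
    (hc' : ∀ u, IsPotentialPair (D'.C u) (c' u) (cu' u)) :
    ∃ K : Fin 3 → ℝ, ∀ l, IsEnd ε l → ∃ J Jf P : Fin 3 → ℝ,
      (∀ k, Tendsto (cwyAngularMomentum D c k) l (𝓝 (J k))) ∧
      (∀ k, Tendsto (cwyAngularMomentum D' c' k) l (𝓝 (Jf k))) ∧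
      (∀ k, Tendsto (linearMomentum D k) l (𝓝 (P k))) ∧
      ∀ k, Jf k - J k = K k + ∑ i, ∑ j, α i * leviCivita i k j * P j := by
  choose K hK using fun k => h.exists_tendsto_localJ_sub hD (isSkew_axis k)
  refine ⟨K, fun l hl => ?_⟩
  choose J hJ using fun k => hD.exists_tendsto_angularMomentum hl (isSkew_axis k)
    fun u => (hc u).isClosedPotential
  choose P hP using hD.exists_tendsto_linearMomentum hl
  have hmodes : sphereCalc.biLaplacian g = sphereCalc.biLaplacian
      (algebraMap ℝ SmoothFn α₀ + ∑ i, α i • sphereCalc.X i + g) := by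
    simp only [map_add, map_sum, map_smul, biLaplacian_algebraMap, biLaplacian_X, smul_zero,
      Finset.sum_const_zero, zero_add]
  refine ⟨J, fun k => J k + (K k + ∑ i, ∑ j, α i * leviCivita i k j * P j), P,
    fun k => (hJ k).congr fun u => ((hc u).cwyAngularMomentum_eq k).symm, fun k => ?_, hP,
    fun k => add_sub_cancel_left _ _⟩
  have hdiff := h.tendsto_angularMomentum_sub hD hl hg hmodes (fun u => (hc u).isClosedPotential)
    (fun u => (hc' u).isClosedPotential) (isSkew_axis k) (hK k l hl)
  have hlinear : Tendsto (fun u => ∑ i, ∑ j, α i * leviCivita i k j * linearMomentum D j u) l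
      (𝓝 (∑ i, ∑ j, α i * leviCivita i k j * P j)) :=
    tendsto_finsetSum _ fun i _ => tendsto_finsetSum _ fun j _ => (hP j).const_mul _
  refine ((hJ k).add (hdiff.add hlinear)).congr fun u => ?_
  rw [(hc' u).cwyAngularMomentum_eq, add_sub_cancel_right, D.two_mul_integral_nonlinearMass_mul_rot]
  ring

end

theorem mainTheorem5
    (D D' : NullInfinityData) (hN : NewsDecay D)
    (f g : S2 → ℝ) (α₀ : ℝ) (α : Fin 3 → ℝ)
    (hg : SmoothS2 g) (hg2 : SupportedGE2 g)
    (hf : ∀ x, f x = α₀ + ∑ i, α i * coordX i x + g x)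
    (hD' : IsSupertranslation f D D')
    (c cu c' cu' : ℝ → S2 → ℝ)
    (hc : ∀ u, IsPotentialPair (D.C u) (c u) (cu u))
    (hc' : ∀ u, IsPotentialPair (D'.C u) (c' u) (cu' u)) :
    ∃ Jp Jm Jfp Jfm Pp Pm : Fin 3 → ℝ,
      (∀ k, Tendsto (cwyAngularMomentum D c k) atTop (𝓝 (Jp k))) ∧
      (∀ k, Tendsto (cwyAngularMomentum D c k) atBot (𝓝 (Jm k))) ∧
      (∀ k, Tendsto (cwyAngularMomentum D' c' k) atTop (𝓝 (Jfp k))) ∧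
      (∀ k, Tendsto (cwyAngularMomentum D' c' k) atBot (𝓝 (Jfm k))) ∧
      (∀ k, Tendsto (linearMomentum D k) atTop (𝓝 (Pp k))) ∧
      (∀ k, Tendsto (linearMomentum D k) atBot (𝓝 (Pm k))) ∧
      ∀ k, (Jfp k - Jfm k) - (Jp k - Jm k)
        = ∑ i, ∑ j, α i * leviCivita i k j * (Pp j - Pm j) := by
  obtain ⟨ε, hε⟩ := hN.exists_falloff
  obtain rfl : f = (algebraMap ℝ SmoothFn α₀ + ∑ i, α i • sphereCalc.X i + .mk hg : SmoothFn) :=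
    funext fun x => by simp [hf]
  obtain ⟨K, hK⟩ := hD'.exists_tendsto_momenta hε hg2 hc hc'
  obtain ⟨Jp, Jfp, Pp, hJp, hJfp, hPp, hp⟩ := hK atTop (isEnd_atTop hε.pos)
  obtain ⟨Jm, Jfm, Pm, hJm, hJfm, hPm, hm⟩ := hK atBot (isEnd_atBot hε.pos)
  refine ⟨Jp, Jm, Jfp, Jfm, Pp, Pm, hJp, hJm, hJfp, hJfm, hPp, hPm, fun k => ?_⟩
  simp only [mul_sub, Finset.sum_sub_distrib]
  linarith [hp k, hm k]
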